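/- **Setting.** Let $f=(f^1,\dots,f^d)$ with $f^k\in C^1(\mathbb R^N,\mathbb R^N)$. An *entropy pair* is $(\eta,q)$ with $\eta:\mathbb R^N\to\mathbb R$ convex and differentiable and $(q^k)'=\eta'\cdot(f^k)'$ for $k=1,\dots,d$. A *Young measure* from $D$ to $\mathbb R^N$ is a map $z\mapsto\nu_z$ into the probability measures on $\mathbb R^N$ such that $z\mapsto\langle\nu_z,g\rangle=\int g\,d\nu_z$ is Lebesgue measurable for all $g\in C_0(\mathbb R^N)$. For a family $s$ of signed measures put $\langle\psi,\langle s,g\rangle\rangle=\int_D\psi(z)\langle s_z,g\rangle\,dz$. Narrow convergence $\nu_n\rightharpoonup\nu$ means $\langle\psi,\langle\nu_n,g\rangle\rangle\to\langle\psi,\langle\nu,g\rangle\rangle$ for all $\psi\in L^1(D)$ and $g\in C_b(\mathbb R^N)$. A Young measure $\nu$ on $\mathbb R^d\times[0,\infty)$ is an *entropy measure valued solution* with initial data $\sigma$ (a Young measure on $\mathbb R^d$) if $$\int\!\!\int \Big(\partial_t\varphi\cdot\langle\nu,\mathrm{id}\rangle+\sum_k\partial_k\varphi\cdot\langle\nu,f^k\rangle\Big)dx\,dt+\int\varphi(x,0)\cdot\langle\sigma_x,\mathrm{id}\rangle\,dx=0$$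 for all $\varphi\in C^1_c(\mathbb R^d\times[0,\infty),\mathbb R^N)$, and $$\int\!\!\int\Big(\partial_t\varphi\,\langle\nu,\eta\rangle+\sum_k\partial_k\varphi\,\langle\nu,q^k\rangle\Big)dx\,dt+\int\varphi(x,0)\langle\sigma_x,\eta\rangle\,dx\ge0$$ for all entropy pairs $(\eta,q)$ and all $0\le\varphi\in C^1_c(\mathbb R^d\times[0,\infty))$. It is part of the definition that $\langle\nu,|h|\rangle$ for $h=\mathrm{id},f^k,\eta,q^k$, and $\langle\sigma,|h|\rangle$ for $h=\mathrm{id},\eta$, are locally integrable. *Scheme.* Let $\Delta x_0>0$ and $\Delta x_l=2^{-l}\Delta x_0$ for $l\in\mathbb N$. Given is a numerical flux $F^{k,\Delta x}$, $k=1,\dots,d$: the flux $F^{k,\Delta x}_{i+e_k/2}$ between the cells $i$ and $i+e_k$ is a locally Lipschitz function of $(u_{i+me_k})_{-p<m\le p}$. It is consistent with $f$: for every compact $K\subset\mathbb R^N$ there is $C$, independent of $\Delta x$, with $|F^{k,\Delta x}_{i+e_k/2}-f^k(u_i)|\le C\sum_{-p<m\le p}|u_i-u_{i+me_k}|$ whenever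 all $u_{i+me_k}\in K$. Let $\mathcal S^{\Delta x_l}:L^\infty(\mathbb R^d,\mathbb R^N)\to L^\infty(\mathbb R^d\times[0,\infty),\mathbb R^N)$ be an evolution operator of the semi-discrete scheme. It maps $v$ to the function that is constant on the cells $\prod_k[i_k\Delta x_l,(i_k+1)\Delta x_l)$, $i\in\mathbb Z^d$, and whose cell values solve $$\tfrac{d}{dt}u_i+\sum_k\tfrac1{\Delta x_l}\big(F^{k,\Delta x_l}_{i+e_k/2}-F^{k,\Delta x_l}_{i-e_k/2}\big)=0,\qquad u_i(0)=v(x_i),$$ with $x_i$ the midpoint of cell $i$. Since point values are used, elements of $L^\infty(\mathbb R^d,\mathbb R^N)$ are here bounded measurable functions, not classes. $\mathcal S^{\Delta x_l}$ is assumed measurable, in that each value $\mathcal S^{\Delta x_l}(v)(x,t)$ depends measurably on $v$ for the $\sigma$-algebra generated by the point evaluations. Let $\sigma$ be a Young measure from $\mathbb R^d$ to $\mathbb R^N$, let $(\Omega,\Sigma,\mathbb P)$ be a probability space, and let $u_0$ be a random element of $L^\infty(\mathbb R^d,\mathbb R^N)$ on it with $\mathrm{Law}(u_0(\cdot,x))=\sigma_x$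 for all $x$. Put $u^l(\omega)=\mathcal S^{\Delta x_l}(u_0(\omega))$ and $\nu^{\Delta x_l}_{x,t}=\mathrm{Law}(u^l(\cdot,x,t))$. *Samples.* Let $L\in\mathbb N$ and integers $M_0,\dots,M_L\ge1$. On some probability space let $u_0^{k,l}$ ($0\le l\le L$, $1\le k\le M_l$) be random elements of $L^\infty(\mathbb R^d,\mathbb R^N)$ with the same law as $u_0$ such that, for each $l$, $u_0^{1,l},\dots,u_0^{M_l,l}$ are independent. The MLMC estimator is $$\nu^{MLMC}=\frac1{M_0}\sum_{k=1}^{M_0}\delta_{\mathcal S^{\Delta x_0}(u_0^{k,0})}+\sum_{l=1}^L\frac1{M_l}\sum_{k=1}^{M_l}\Big(\delta_{\mathcal S^{\Delta x_l}(u_0^{k,l})}-\delta_{\mathcal S^{\Delta x_{l-1}}(u_0^{k,l})}\Big).$$ **Theorem 3.1 (weak convergence of MLMC).** (a) Suppose that the scheme satisfies the following requirements. 1. *Uniform boundedness:* there is $C$ with $|u^l(\omega,x,t)|\le C$ for all $l,\omega,x$ and $t\ge0$. 2. *Weak BV:* there is $1\le r<\infty$ such that for all $\omega$ and $T>0$,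 $\int_0^T\sum_{i\in\mathbb Z^d}\sum_k|u^l_{i+e_k}(\omega,t)-u^l_i(\omega,t)|^r\,\Delta x_l^d\,dt\to0$ as $l\to\infty$. 3. *Entropy consistency:* for every entropy pair $(\eta,q)$ there is a numerical entropy flux $Q^{k,\Delta x}$, locally Lipschitz and consistent with $q$ in the sense above (possibly with another stencil width), such that $\frac{d}{dt}\eta(u^l_i)+\sum_k\frac1{\Delta x_l}(Q^{k,\Delta x_l}_{i+e_k/2}-Q^{k,\Delta x_l}_{i-e_k/2})\le0$ for all $l$, $\omega$, $i$ and $t>0$. 4. *Consistency with the initial data:* $\langle\sigma,|\mathrm{id}|\rangle$ and $\langle\sigma,|\eta|\rangle$ are locally integrable for all entropy pairs $(\eta,q)$. With $\sigma^l_x=\mathrm{Law}(u^l(\cdot,x,0))$, one has $\lim_{l\to\infty}\int\psi\,(\langle\sigma^l,\mathrm{id}\rangle-\langle\sigma,\mathrm{id}\rangle)\,dx=0$ for all $\psi\in C_c^1(\mathbb R^d)$, and $\limsup_{l\to\infty}\int\psi\,(\langle\sigma^l,\eta\rangle-\langle\sigma,\eta\rangle)\,dx\le0$ for all entropy pairs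 $(\eta,q)$ and all $0\le\psi\in C^1_c(\mathbb R^d)$. Then there is an entropy measure valued solution $\nu$ with initial data $\sigma$ such that $\nu^{\Delta x_L}\rightharpoonup\nu$ along a subsequence of $L\to\infty$. (b) Let $\nu$ be any entropy measure valued solution with initial data $\sigma$ to which $\nu^{\Delta x_L}$ converges narrowly along a subsequence. Then for all $L$, $M_0,\dots,M_L$, all samples as above, all $g\in C_b(\mathbb R^N)$ and all $\psi\in L^1(\mathbb R^d\times[0,\infty))$, the random variable $\langle\psi,\langle\nu-\nu^{MLMC},g\rangle\rangle$ is in $L^2$ and $$\big\|\langle\psi,\langle\nu-\nu^{MLMC},g\rangle\rangle\big\|_{L^2}\le\big|\langle\psi,\langle\nu-\nu^{\Delta x_L},g\rangle\rangle\big|+\frac{\sqrt{\mathrm{Var}(\langle\psi,g(u^0)\rangle)}}{\sqrt{M_0}}+\sum_{l=1}^L\frac{\sqrt{\mathrm{Var}(\langle\psi,g(u^l)-g(u^{l-1})\rangle)}}{\sqrt{M_l}}.$$ (c) If, moreover, the samples are independent across levels, that is, $u_0^{k,l}$ and $u_0^{k',l'}$ are independent for all $l\ne l'$ and all $k,k'$,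 then (whether or not a limit $\nu$ exists) $\langle\psi,\langle\nu^{\Delta x_L}-\nu^{MLMC},g\rangle\rangle$ is in $L^2$ and $$\big\|\langle\psi,\langle\nu^{\Delta x_L}-\nu^{MLMC},g\rangle\rangle\big\|_{L^2}^2=\frac{\mathrm{Var}(\langle\psi,g(u^0)\rangle)}{M_0}+\sum_{l=1}^L\frac{\mathrm{Var}(\langle\psi,g(u^l)-g(u^{l-1})\rangle)}{M_l}.$$ -/

import Mathlib

open MeasureTheory ProbabilityTheory Filter Topology
open scoped ENNReal BoundedContinuousFunction ZeroAtInfty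

namespace MLMC

noncomputable section

/-! ### Space, time and state space -/

/-- The spatial domain `ℝ^d`. -/
abbrev Space (d : ℕ) : Type := EuclideanSpace ℝ (Fin d)

/-- The state space `ℝ^N` of the conserved variables. -/
abbrev Phase (N : ℕ) : Type := EuclideanSpace ℝ (Fin N)

/-- Lebesgue measure on the space-time domain `ℝ^d × [0, ∞)`, as a measure on `ℝ^d × ℝ`. -/
def spaceTime (d : ℕ) : Measure (Space d × ℝ) := volume.restrict {z | 0 ≤ z.2}

/-! ### Young measures -/

section Young

variable {Z : Type*} [MeasurableSpace Z] {N : ℕ}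

/-- `ν` is a Young measure from `(Z, μ)` to `ℝ^N`: a map into the probability measures for which
`z ↦ ⟨ν_z, g⟩` is (Lebesgue-)measurable for every `g ∈ C₀(ℝ^N)`. -/
def IsYoungMeasure (μ : Measure Z) (ν : Z → ProbabilityMeasure (Phase N)) : Prop :=
  ∀ g : C₀(Phase N, ℝ), AEMeasurable (fun z => ∫ ξ, g ξ ∂(ν z : Measure (Phase N))) μ

/-- A Young measure, seen as a map into the signed measures. -/
def signed (ν : Z → ProbabilityMeasure (Phase N)) (z : Z) : SignedMeasure (Phase N) :=
  (ν z : Measure (Phase N)).toSignedMeasure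

/-- The law `z ↦ Law(u(·, z))` of a random field, seen as a map into the signed measures. -/
def lawOf {Ω : Type*} [MeasurableSpace Ω] (P : Measure Ω) [IsProbabilityMeasure P]
    (u : Ω → Z → Phase N) (z : Z) : SignedMeasure (Phase N) :=
  (P.map (fun ω => u ω z)).toSignedMeasure

/-- The pairing `⟨ψ, ⟨s, g⟩⟩ = ∫ ψ(z) ⟨s_z, g⟩ dz`, for a family `s` of signed measures. -/
def pairing (μ : Measure Z) (ψ : Z → ℝ) (s : Z → SignedMeasure (Phase N))
    (g : Phase N →ᵇ ℝ) : ℝ :=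
  ∫ z, ψ z * (∫ᵛ ξ, g ξ ∂<•(s z)) ∂μ

/-- Narrow convergence: `⟨ψ, ⟨s n, g⟩⟩ → ⟨ψ, ⟨s', g⟩⟩` for all `ψ ∈ L¹` and `g ∈ C_b`. -/
def TendstoNarrowly (μ : Measure Z) (s : ℕ → Z → SignedMeasure (Phase N))
    (s' : Z → SignedMeasure (Phase N)) : Prop :=
  ∀ ψ : Z → ℝ, Integrable ψ μ → ∀ g : Phase N →ᵇ ℝ,
    Tendsto (fun n => pairing μ ψ (s n) g) atTop (𝓝 (pairing μ ψ s' g))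

/-- `⟨ν, |h|⟩` is locally integrable; this is what makes sense of `∫ φ ⟨ν, h⟩` for compactly
supported continuous `φ`. -/
def LocIntegrable [TopologicalSpace Z] {E : Type*} [NormedAddCommGroup E] (μ : Measure Z)
    (ν : Z → ProbabilityMeasure (Phase N)) (h : Phase N → E) : Prop :=
  ∀ K : Set Z, IsCompact K → ∫⁻ z in K, ∫⁻ ξ, ‖h ξ‖ₑ ∂(ν z : Measure (Phase N)) ∂μ < ∞

end Young

/-! ### Entropy measure valued solutions -/

/-- The time derivative of a function on space-time. -/
def dt {d : ℕ} {E : Type*} [NormedAddCommGroup E] [NormedSpace ℝ E] (φ : Space d × ℝ → E)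
    (z : Space d × ℝ) : E :=
  fderiv ℝ φ z (0, 1)

/-- The `k`-th spatial partial derivative of a function on space-time. -/
def dx {d : ℕ} {E : Type*} [NormedAddCommGroup E] [NormedSpace ℝ E] (k : Fin d)
    (φ : Space d × ℝ → E) (z : Space d × ℝ) : E :=
  fderiv ℝ φ z (EuclideanSpace.single k 1, 0)

/-- `(η, q)` is an entropy pair for the flux `f = (f¹, …, f^d)`: `η` is a convex differentiable
function and `(q^k)' = η' · (f^k)'`. -/
structure IsEntropyPair {d N : ℕ} (f : Fin d → Phase N → Phase N) (η : Phase N → ℝ)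
    (q : Fin d → Phase N → ℝ) : Prop where
  convex : ConvexOn ℝ Set.univ η
  differentiable : Differentiable ℝ η
  flux : ∀ k u, HasFDerivAt (q k) ((fderiv ℝ η u).comp (fderiv ℝ (f k) u)) u

/-- `ν` is a measure valued solution of `∂_t ⟨ν, id⟩ + div_x ⟨ν, f⟩ = 0` with initial data `σ`.
The test functions in `C_c^1(ℝ^d × [0, ∞), ℝ^N)` are the restrictions of those in
`C_c^1(ℝ^d × ℝ, ℝ^N)`. -/
structure IsMVS {d N : ℕ} (f : Fin d → Phase N → Phase N)
    (σ : Space d → ProbabilityMeasure (Phase N))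
    (ν : Space d × ℝ → ProbabilityMeasure (Phase N)) : Prop where
  young : IsYoungMeasure (spaceTime d) ν
  locIntegrable_id : LocIntegrable (spaceTime d) ν id
  locIntegrable_flux : ∀ k, LocIntegrable (spaceTime d) ν (f k)
  locIntegrable_initial : LocIntegrable volume σ id
  weak : ∀ φ : Space d × ℝ → Phase N, ContDiff ℝ 1 φ → HasCompactSupport φ →
    ∫ z, (inner ℝ (dt φ z) (∫ ξ, ξ ∂(ν z : Measure (Phase N)))
        + ∑ k, inner ℝ (dx k φ z) (∫ ξ, f k ξ ∂(ν z : Measure (Phase N)))) ∂(spaceTime d)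
      + ∫ x, inner ℝ (φ (x, 0)) (∫ ξ, ξ ∂(σ x : Measure (Phase N))) = 0

/-- `ν` is an entropy measure valued solution with initial data `σ`: the entropy inequality holds
for all entropy pairs and all nonnegative test functions in `C_c^1(ℝ^d × [0, ∞))`. The test
functions need not vanish at time zero, so the initial term is part of the inequality. -/
structure IsEMVS {d N : ℕ} (f : Fin d → Phase N → Phase N)
    (σ : Space d → ProbabilityMeasure (Phase N))
    (ν : Space d × ℝ → ProbabilityMeasure (Phase N)) : Prop extends IsMVS f σ ν where
  locIntegrable_entropy : ∀ η q, IsEntropyPair f η q → LocIntegrable (spaceTime d) ν η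
  locIntegrable_entropyFlux : ∀ η q, IsEntropyPair f η q →
    ∀ k, LocIntegrable (spaceTime d) ν (q k)
  locIntegrable_entropy_initial : ∀ η q, IsEntropyPair f η q → LocIntegrable volume σ η
  entropy : ∀ η q, IsEntropyPair f η q →
    ∀ φ : Space d × ℝ → ℝ, ContDiff ℝ 1 φ → HasCompactSupport φ → (∀ z, 0 ≤ φ z) →
    0 ≤ ∫ z, (dt φ z * (∫ ξ, η ξ ∂(ν z : Measure (Phase N)))
        + ∑ k, dx k φ z * (∫ ξ, q k ξ ∂(ν z : Measure (Phase N)))) ∂(spaceTime d)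
      + ∫ x, φ (x, 0) * (∫ ξ, η ξ ∂(σ x : Measure (Phase N)))

/-! ### Finite volume schemes -/

/-- Initial data: bounded measurable functions `ℝ^d → ℝ^N`. The schemes use point values, so
functions are not identified when they agree almost everywhere. The `σ`-algebra is the one
generated by the point evaluations. -/
abbrev InitialData (d N : ℕ) : Type :=
  {v : Space d → Phase N // Measurable v ∧ ∃ C : ℝ, ∀ x, ‖v x‖ ≤ C}

/-- The (multi-)index of the cell `∏ₖ [iₖ Δx, (iₖ + 1) Δx)` that contains `x`. -/
def cellIndex {d : ℕ} (Δx : ℝ) (x : Space d) : Fin d → ℤ := fun k => ⌊x k / Δx⌋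

/-- The midpoint of the cell with index `i`. -/
def midpoint {d : ℕ} (Δx : ℝ) (i : Fin d → ℤ) : Space d :=
  WithLp.toLp 2 fun k => ((i k : ℝ) + 1 / 2) * Δx

/-- The values of the grid function `w` that enter the numerical flux in direction `k` between the
cells `i` and `i + e_k`: those at `i + m e_k` for `m = -p + 1, …, p`. -/
def stencil {d N : ℕ} (p : ℕ) (k : Fin d) (w : (Fin d → ℤ) → Phase N) (i : Fin d → ℤ) :
    Fin (2 * p) → Phase N :=
  fun j => w (i + Pi.single k ((j : ℤ) - p + 1))

/-- The numerical flux `F` (which may depend on the mesh width) is locally Lipschitz and is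
consistent with `h`, with constants on compact sets that do not depend on the mesh width. -/
structure IsConsistentFlux {d N p : ℕ} {E : Type*} [NormedAddCommGroup E]
    (F : ℝ → Fin d → (Fin (2 * p) → Phase N) → E) (h : Fin d → Phase N → E) : Prop where
  locallyLipschitz : ∀ Δx, 0 < Δx → ∀ k, LocallyLipschitz (F Δx k)
  consistent : ∀ K : Set (Phase N), IsCompact K → ∃ C : ℝ, ∀ Δx, 0 < Δx →
    ∀ (k : Fin d) (w : (Fin d → ℤ) → Phase N) (i : Fin d → ℤ), (∀ j, stencil p k w i j ∈ K) →
      ‖F Δx k (stencil p k w i) - h k (w i)‖ ≤ C * ∑ j, ‖w i - stencil p k w i j‖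

/-- The difference quotient `∑ₖ (F^k_{i + e_k / 2} - F^k_{i - e_k / 2}) / Δx`. -/
def fluxDifference {d N p : ℕ} {E : Type*} [NormedAddCommGroup E] [NormedSpace ℝ E]
    (F : ℝ → Fin d → (Fin (2 * p) → Phase N) → E) (Δx : ℝ) (w : (Fin d → ℤ) → Phase N)
    (i : Fin d → ℤ) : E :=
  ∑ k, Δx⁻¹ • (F Δx k (stencil p k w i) - F Δx k (stencil p k w (i - Pi.single k 1)))

/-- A numerical evolution operator `L^∞(ℝ^d) → L^∞(ℝ^d × [0, ∞))` of the semi-discrete finite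
volume scheme with numerical flux `F` and mesh width `Δx`: it takes `v` to the function that is
constant on the cells, and whose cell values start from the values of `v` at the cell midpoints
and solve `d/dt u_i + ∑ₖ (F^k_{i + e_k / 2} - F^k_{i - e_k / 2}) / Δx = 0`. -/
structure NumericalEvolution {d N p : ℕ} (F : ℝ → Fin d → (Fin (2 * p) → Phase N) → Phase N)
    (Δx : ℝ) where
  evolve : InitialData d N → Space d → ℝ → Phase N
  measurable_evolve : ∀ x t, 0 ≤ t → Measurable fun v => evolve v x t
  bounded : ∀ v, ∃ C : ℝ, ∀ x t, 0 ≤ t → ‖evolve v x t‖ ≤ C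
  const_on_cells : ∀ v x t, 0 ≤ t → evolve v x t = evolve v (midpoint Δx (cellIndex Δx x)) t
  initial : ∀ v i, evolve v (midpoint Δx i) 0 = v.1 (midpoint Δx i)
  ode : ∀ v i t, 0 ≤ t → HasDerivWithinAt (fun s => evolve v (midpoint Δx i) s)
    (-fluxDifference F Δx (fun j => evolve v (midpoint Δx j) t) i) (Set.Ici 0) t

/-- The mesh widths `Δx_l = 2^{-l} Δx_0`. -/
def meshWidth (Δx₀ : ℝ) (l : ℕ) : ℝ := Δx₀ / 2 ^ l

section Approximation

variable {d N p : ℕ} {F : ℝ → Fin d → (Fin (2 * p) → Phase N) → Phase N} {Δx₀ : ℝ}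

/-- The approximate random field `u^l(ω, x, t) = S^{Δx_l}(u_0(ω))(x, t)`. -/
def approx {Ω : Type*} (S : ∀ l, NumericalEvolution F (meshWidth Δx₀ l))
    (u₀ : Ω → InitialData d N) (l : ℕ) (ω : Ω) (z : Space d × ℝ) : Phase N :=
  (S l).evolve (u₀ ω) z.1 z.2

/-- The value of `u^l(ω, ·, t)` in the cell `i`. -/
def cellValue {Ω : Type*} (S : ∀ l, NumericalEvolution F (meshWidth Δx₀ l))
    (u₀ : Ω → InitialData d N) (l : ℕ) (ω : Ω) (t : ℝ) (i : Fin d → ℤ) : Phase N :=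
  approx S u₀ l ω (midpoint (meshWidth Δx₀ l) i, t)

/-- The requirements on the scheme under which `ν^{Δx_l}` converges, up to a subsequence, to an
entropy measure valued solution. -/
structure SchemeRequirements {Ω : Type*} [MeasurableSpace Ω] (P : Measure Ω)
    (f : Fin d → Phase N → Phase N) (S : ∀ l, NumericalEvolution F (meshWidth Δx₀ l))
    (σ : Space d → ProbabilityMeasure (Phase N)) (u₀ : Ω → InitialData d N) : Prop where
  /-- Uniform boundedness. -/
  uniformlyBounded : ∃ C : ℝ, ∀ l ω x t, 0 ≤ t → ‖approx S u₀ l ω (x, t)‖ ≤ C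
  /-- Weak BV, for some exponent `1 ≤ r < ∞`. -/
  weakBV : ∃ r : ℝ, 1 ≤ r ∧ ∀ (ω : Ω) (T : ℝ), 0 < T →
    Tendsto (fun l => ∫⁻ t in Set.Icc 0 T, ∑' i : Fin d → ℤ, ∑ k : Fin d,
      ‖cellValue S u₀ l ω t (i + Pi.single k 1) - cellValue S u₀ l ω t i‖ₑ ^ r
        * ENNReal.ofReal (meshWidth Δx₀ l ^ d)) atTop (𝓝 0)
  /-- Entropy consistency: a discrete entropy inequality holds, with a numerical entropy flux `Q`
  that is consistent with `q`. -/
  entropyStable : ∀ η q, IsEntropyPair f η q →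
    ∃ (p' : ℕ) (Q : ℝ → Fin d → (Fin (2 * p') → Phase N) → ℝ), IsConsistentFlux Q q ∧
      ∀ l ω i t, 0 < t →
        deriv (fun s => η (cellValue S u₀ l ω s i)) t
          + fluxDifference Q (meshWidth Δx₀ l) (cellValue S u₀ l ω t) i ≤ 0
  /-- The pairings with the initial Young measure `σ` in the next two requirements make sense. -/
  initial_locIntegrable : LocIntegrable volume σ id ∧
    ∀ η q, IsEntropyPair f η q → LocIntegrable volume σ η
  /-- Consistency with the initial data, where `P.map …` is the law of `u^l(·, x, 0)`. -/
  initial_mean : ∀ ψ : Space d → ℝ, ContDiff ℝ 1 ψ → HasCompactSupport ψ →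
    Tendsto (fun l => ∫ x, ψ x • ((∫ ξ, ξ ∂(P.map fun ω => approx S u₀ l ω (x, 0)))
      - ∫ ξ, ξ ∂(σ x : Measure (Phase N)))) atTop (𝓝 0)
  /-- Consistency with the initial entropy: the upper limit is at most zero. -/
  initial_entropy : ∀ η q, IsEntropyPair f η q →
    ∀ ψ : Space d → ℝ, ContDiff ℝ 1 ψ → HasCompactSupport ψ → (∀ x, 0 ≤ ψ x) →
    ∀ ε : ℝ, 0 < ε → ∀ᶠ l in atTop,
      ∫ x, ψ x * ((∫ ξ, η ξ ∂(P.map fun ω => approx S u₀ l ω (x, 0)))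
        - ∫ ξ, η ξ ∂(σ x : Measure (Phase N))) ≤ ε

/-! ### The multilevel Monte-Carlo estimator -/

/-- The Dirac mass at `a`, as a signed measure. -/
def delta (a : Phase N) : SignedMeasure (Phase N) := (Measure.dirac a).toSignedMeasure

/-- The multilevel Monte-Carlo estimator, a random family of signed measures. The samples of the
initial data on level `l` are `U l k`, `k < M l`; on a level `l + 1`, every sample is evolved on the
mesh of level `l + 1` and on the mesh of level `l`. -/
def mlmc {Ω' : Type*} (S : ∀ l, NumericalEvolution F (meshWidth Δx₀ l)) (L : ℕ) (M : ℕ → ℕ)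
    (U : ℕ → ℕ → Ω' → InitialData d N) (ω : Ω') (z : Space d × ℝ) : SignedMeasure (Phase N) :=
  (M 0 : ℝ)⁻¹ • ∑ k ∈ Finset.range (M 0), delta (approx S (U 0 k) 0 ω z)
    + ∑ l ∈ Finset.range L, (M (l + 1) : ℝ)⁻¹ • ∑ k ∈ Finset.range (M (l + 1)),
        (delta (approx S (U (l + 1) k) (l + 1) ω z) - delta (approx S (U (l + 1) k) l ω z))

/-- `Var(⟨ψ, g(u⁰)⟩)`. -/
def baseVar {Ω : Type*} [MeasurableSpace Ω] (P : Measure Ω)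
    (S : ∀ l, NumericalEvolution F (meshWidth Δx₀ l)) (u₀ : Ω → InitialData d N)
    (ψ : Space d × ℝ → ℝ) (g : Phase N →ᵇ ℝ) : ℝ :=
  variance (fun ω => ∫ z, ψ z * g (approx S u₀ 0 ω z) ∂(spaceTime d)) P

/-- `Var(⟨ψ, g(u^{l+1}) - g(u^l)⟩)`. -/
def levelVar {Ω : Type*} [MeasurableSpace Ω] (P : Measure Ω)
    (S : ∀ l, NumericalEvolution F (meshWidth Δx₀ l)) (u₀ : Ω → InitialData d N)
    (ψ : Space d × ℝ → ℝ) (g : Phase N →ᵇ ℝ) (l : ℕ) : ℝ :=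
  variance (fun ω => ∫ z, ψ z * (g (approx S u₀ (l + 1) ω z) - g (approx S u₀ l ω z))
    ∂(spaceTime d)) P

end Approximation

/-- The `L²` norm of a real random variable. -/
def l2Norm {Ω' : Type*} [MeasurableSpace Ω'] (P' : Measure Ω') (X : Ω' → ℝ) : ℝ :=
  (eLpNorm X 2 P').toReal

end

end MLMC

/-!
The solution `S^{Δx}(v)(x, t)` is piecewise constant in
`x`, continuous in `t` and measurable in `v`, hence jointly measurable in `(v, x, t)`
(`measurable_field`). So `v ↦ ⟨ψ, g(S^{Δx}(v))⟩` is a bounded random variable, and by Fubini's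
theorem its expectation is the pairing of `ψ ⊗ g` with the law of the solution (`pairing_lawOf`).

*Error estimates.* The pairing with the estimator is the sum over the levels of sample means of
`⟨ψ, g(u^l) - g(u^{l-1})⟩`. The expectations of these increments telescope to the pairing with
`ν^{Δx_L}`, so the error is a deterministic bias `⟨ψ, ⟨ν - ν^{Δx_L}, g⟩⟩` minus a sum of centered
samples (`pairing_sub_mlmc_eq_bias_sub`). Independence within a level gives the `L²` norm of the
contribution of that level (`l2Norm_level`), and the triangle inequality concludes (`error_le`).
If the levels are independent as well, all samples are pairwise independent and the variances add up
(`l2Norm_levels_sq`, `error_sq_eq`).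

*Compactness.* The joint laws of the point and of the value of `u^l` there, with respect to a
probability measure equivalent to Lebesgue measure on space-time, are tight because the `u^l` are
uniformly bounded. A weak limit has the same first marginal, and its disintegration is the limit
Young measure (`exists_youngMeasure_tendsto`). Since the first marginals agree, the convergence can
be tested with `ψ ⊗ g` for `ψ` merely integrable.

*The limit is a solution.* This is the Lax–Wendroff argument, applied to each sample path.
Multiply the discrete entropy inequality by a test function and integrate. In space, summation by
parts is the invariance of Lebesgue measure under translation by one cell
(`integral_mul_flux_sub`). By consistency, the numerical flux differs from the flux at the cell
value by differences between nearby cells, and these vanish in `L¹_loc` by the weak BV bound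
(`tendsto_lintegral_jump`). So the weak entropy inequality holds up to a vanishing error
(`exists_tendsto_zero_le_weakForm`). Taking expectations, by dominated convergence, and then the
limit in the sense of Young measures yields the weak entropy inequality for `ν`
(`youngForm_nonneg`). The argument uses only the sign of the discrete inequality multiplied by the
test function, so it applies to the coordinates of the scheme itself, where equality holds, with
test functions `φ` and `-φ`: this gives the weak form of the conservation law.
-/

namespace MLMC

noncomputable section


/-! ### Young measures: pairings and measurability -/

section YoungMeasures

variable {N : ℕ}

theorem integral_signed {Z : Type*} [MeasurableSpace Z] (ν : Z → ProbabilityMeasure (Phase N))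
    (z : Z) (g : Phase N → ℝ) :
    ∫ᵛ ξ, g ξ ∂<•(signed ν z) = ∫ ξ, g ξ ∂(ν z : Measure (Phase N)) := by
  simp [signed]

theorem integral_lawOf {Z Ω : Type*} [MeasurableSpace Z] [MeasurableSpace Ω] (P : Measure Ω)
    [IsProbabilityMeasure P] (u : Ω → Z → Phase N) (z : Z) (hu : Measurable fun ω => u ω z)
    (g : Phase N →ᵇ ℝ) :
    ∫ᵛ ξ, g ξ ∂<•(lawOf P u z) = ∫ ω, g (u ω z) ∂P := by
  rw [lawOf, VectorMeasure.integral_toSignedMeasure, integral_map hu.aemeasurable]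
  exact g.continuous.aestronglyMeasurable

theorem integral_delta (a : Phase N) (g : Phase N →ᵇ ℝ) : ∫ᵛ ξ, g ξ ∂<•(delta a) = g a := by
  simp [delta]

theorem integrable_toSignedMeasure (μ : Measure (Phase N)) [IsFiniteMeasure μ]
    (g : Phase N →ᵇ ℝ) : μ.toSignedMeasure.Integrable g := by
  rw [VectorMeasure.Integrable]
  simpa using g.integrable μ

/-- A continuous cutoff function: it is `1` on the ball of radius `R` and `0` outside the ball of
radius `R + 1`. -/
def cutoff (R : ℝ) (ξ : Phase N) : ℝ := max 0 (min 1 (R + 1 - ‖ξ‖))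

theorem cutoff_eq_one {R : ℝ} {ξ : Phase N} (h : ‖ξ‖ ≤ R) : cutoff R ξ = 1 := by
  rw [cutoff, min_eq_left (by linarith), max_eq_right zero_le_one]

theorem continuous_cutoff (R : ℝ) : Continuous (cutoff R : Phase N → ℝ) := by
  unfold cutoff; fun_prop

theorem norm_cutoff_le (R : ℝ) (ξ : Phase N) : ‖cutoff R ξ‖ ≤ 1 := by
  rw [Real.norm_eq_abs, abs_of_nonneg (le_max_left _ _)]
  exact max_le zero_le_one (min_le_left _ _)

theorem hasCompactSupport_cutoff (R : ℝ) : HasCompactSupport (cutoff R : Phase N → ℝ) := by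
  refine HasCompactSupport.of_support_subset_isCompact (isCompact_closedBall (0 : Phase N) (R + 1))
    fun ξ hξ => ?_
  by_contra h
  rw [mem_closedBall_zero_iff, not_le] at h
  refine hξ ?_
  rw [cutoff, max_eq_left]
  exact (min_le_right _ _).trans (by linarith)

/-- A continuous function, truncated outside a ball to make it bounded. -/
def truncate (R : ℝ) (h : Phase N → ℝ) (hc : Continuous h) : Phase N →ᵇ ℝ :=
  ⟨⟨fun ξ => cutoff R ξ * h ξ, (continuous_cutoff R).mul hc⟩, by
    obtain ⟨C, hC⟩ := (hasCompactSupport_cutoff (N := N) R).mul_right (f' := h)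
      |>.exists_bound_of_continuous ((continuous_cutoff R).mul hc)
    refine ⟨C + C, fun x y => (dist_le_norm_add_norm _ _).trans (add_le_add (hC x) (hC y))⟩⟩

theorem truncate_apply (R : ℝ) (h : Phase N → ℝ) (hc : Continuous h) (ξ : Phase N) :
    truncate R h hc ξ = cutoff R ξ * h ξ := rfl

theorem truncate_of_norm_le {R : ℝ} (h : Phase N → ℝ) (hc : Continuous h) {ξ : Phase N}
    (hξ : ‖ξ‖ ≤ R) : truncate R h hc ξ = h ξ := by
  rw [truncate_apply, cutoff_eq_one hξ, one_mul]

/-- The measurability of `z ↦ ⟨ν_z, h⟩` for `h ∈ C₀` extends to all continuous `h` that are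
integrable. -/
theorem IsYoungMeasure.aemeasurable_integral {Z : Type*} [MeasurableSpace Z] {μ : Measure Z}
    {ν : Z → ProbabilityMeasure (Phase N)} (hν : IsYoungMeasure μ ν) {h : Phase N → ℝ}
    (hc : Continuous h) (hi : ∀ᵐ z ∂μ, Integrable h (ν z : Measure (Phase N))) :
    AEMeasurable (fun z => ∫ ξ, h ξ ∂(ν z : Measure (Phase N))) μ := by
  refine aemeasurable_of_tendsto_metrizable_ae (u := atTop)
    (f := fun (n : ℕ) z => ∫ ξ, cutoff n ξ * h ξ ∂(ν z : Measure (Phase N))) (fun n => ?_) ?_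
  · exact hν ⟨⟨fun ξ => cutoff n ξ * h ξ, (continuous_cutoff n).mul hc⟩,
      ((hasCompactSupport_cutoff (n : ℝ)).mul_right (f' := h)).is_zero_at_infty⟩
  · filter_upwards [hi] with z hz
    refine tendsto_integral_of_dominated_convergence (fun ξ => ‖h ξ‖)
      (fun n => ((continuous_cutoff n).mul hc).aestronglyMeasurable) hz.norm
      (fun n => ae_of_all _ fun ξ => ?_) (ae_of_all _ fun ξ => ?_)
    · rw [norm_mul]
      exact mul_le_of_le_one_left (norm_nonneg _) (norm_cutoff_le _ _)
    · refine tendsto_const_nhds.congr' ?_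
      obtain ⟨n, hn⟩ := exists_nat_ge ‖ξ‖
      filter_upwards [eventually_ge_atTop n] with m hm
      rw [cutoff_eq_one (hn.trans (by exact_mod_cast hm)), one_mul]

/-! ### Compactness of bounded Young measures -/

/-- A probability measure on a product with first marginal `ρ`, tested with a product `θ ⊗ g`. -/
theorem abs_integral_fst_mul_le {Z : Type*} [MeasurableSpace Z] {ρ : Measure Z}
    {m : Measure (Z × Phase N)} (hm : m.fst = ρ) {θ : Z → ℝ} (hθ : Integrable θ ρ)
    (g : Phase N →ᵇ ℝ) :
    Integrable (fun y : Z × Phase N => θ y.1 * g y.2) m ∧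
      |∫ y, θ y.1 * g y.2 ∂m| ≤ (∫ z, ‖θ z‖ ∂ρ) * ‖g‖ := by
  subst hm
  have h1 : Integrable (fun y : Z × Phase N => θ y.1) m := hθ.comp_measurable measurable_fst
  have h2 : Integrable (fun y : Z × Phase N => θ y.1 * g y.2) m :=
    h1.mul_bdd (c := ‖g‖) (g.continuous.measurable.comp measurable_snd).aestronglyMeasurable
      (ae_of_all _ fun y => g.norm_coe_le_norm _)
  refine ⟨h2, ?_⟩
  have h3 : ∫ z, ‖θ z‖ ∂m.fst = ∫ y, ‖θ y.1‖ ∂m := by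
    rw [Measure.fst, integral_map measurable_fst.aemeasurable hθ.aestronglyMeasurable.norm]
  rw [h3, ← integral_mul_const]
  refine (abs_integral_le_integral_abs).trans (integral_mono h2.abs (h1.norm.mul_const _) ?_)
  intro y
  simp only [abs_mul]
  exact mul_le_mul_of_nonneg_left (g.norm_coe_le_norm _) (abs_nonneg _)

/-- Weak convergence of measures with a common first marginal `ρ` may be tested with products
`θ ⊗ g`, where `θ` is only integrable. -/
theorem tendsto_integral_fst_mul {Z : Type*} [TopologicalSpace Z] [PolishSpace Z]
    [MeasurableSpace Z] [BorelSpace Z] {ρ : Measure Z} [IsProbabilityMeasure ρ]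
    {m : ℕ → ProbabilityMeasure (Z × Phase N)} {m₀ : ProbabilityMeasure (Z × Phase N)}
    (hm : ∀ n, (m n : Measure (Z × Phase N)).fst = ρ) (hm₀ : (m₀ : Measure (Z × Phase N)).fst = ρ)
    (hlim : Tendsto m atTop (𝓝 m₀)) {θ : Z → ℝ} (hθ : Integrable θ ρ) (g : Phase N →ᵇ ℝ) :
    Tendsto (fun n => ∫ y, θ y.1 * g y.2 ∂(m n : Measure (Z × Phase N))) atTop
      (𝓝 (∫ y, θ y.1 * g y.2 ∂(m₀ : Measure (Z × Phase N)))) := by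
  let _ := TopologicalSpace.upgradeIsCompletelyMetrizable Z
  rw [Metric.tendsto_atTop]
  intro ε hε
  have hg : 0 < ‖g‖ + 1 := by positivity
  obtain ⟨θ', hθ', hθ'i⟩ := hθ.exists_boundedContinuous_integral_sub_le
    (ε := ε / 3 / (‖g‖ + 1)) (by positivity)
  have key : ∀ m' : Measure (Z × Phase N), m'.fst = ρ →
      |(∫ y, θ y.1 * g y.2 ∂m') - ∫ y, θ' y.1 * g y.2 ∂m'| < ε / 3 := by
    intro m' hm'
    have h := abs_integral_fst_mul_le hm' (hθ.sub hθ'i) g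
    rw [← integral_sub (abs_integral_fst_mul_le hm' hθ g).1
      (abs_integral_fst_mul_le hm' hθ'i g).1]
    simp only [Pi.sub_apply, sub_mul] at h
    refine h.2.trans_lt ?_
    calc (∫ z, ‖θ z - θ' z‖ ∂ρ) * ‖g‖ ≤ ε / 3 / (‖g‖ + 1) * ‖g‖ := by gcongr
      _ < ε / 3 / (‖g‖ + 1) * (‖g‖ + 1) := by gcongr; linarith
      _ = ε / 3 := by field_simp
  let G : Z × Phase N →ᵇ ℝ := θ'.compContinuous ⟨Prod.fst, continuous_fst⟩ *
    g.compContinuous ⟨Prod.snd, continuous_snd⟩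
  have hG := (ProbabilityMeasure.tendsto_iff_forall_integral_tendsto.1 hlim) G
  rw [Metric.tendsto_atTop] at hG
  obtain ⟨n₀, hn₀⟩ := hG (ε / 3) (by positivity)
  refine ⟨n₀, fun n hn => ?_⟩
  have h1 := key _ (hm n)
  have h2 := key _ hm₀
  have h3 := hn₀ n hn
  simp only [G, BoundedContinuousFunction.coe_mul, Pi.mul_apply,
    BoundedContinuousFunction.compContinuous_apply, ContinuousMap.coe_mk, Real.dist_eq] at h3
  rw [Real.dist_eq]
  rw [abs_lt] at *
  constructor <;> linarith [h1.1, h1.2, h2.1, h2.2, h3.1, h3.2]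

/-- **Compactness of Young measures.** The laws of uniformly bounded random fields converge
narrowly, along a subsequence, to a Young measure that is carried by the same ball. -/
theorem exists_youngMeasure_tendsto {Z Ω : Type*} [TopologicalSpace Z] [PolishSpace Z]
    [MeasurableSpace Z] [BorelSpace Z] (μ : Measure Z) [SigmaFinite μ] [NeZero μ]
    [MeasurableSpace Ω] (P : Measure Ω) [IsProbabilityMeasure P]
    (u : ℕ → Z × Ω → Phase N) (hu : ∀ l, Measurable (u l)) (C : ℝ)
    (hC : ∀ l y, ‖u l y‖ ≤ C) :
    ∃ ν : Z → ProbabilityMeasure (Phase N), IsYoungMeasure μ ν ∧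
      (∀ᵐ z ∂μ, ∀ᵐ ξ ∂(ν z : Measure (Phase N)), ‖ξ‖ ≤ C) ∧
      ∃ χ : ℕ → ℕ, StrictMono χ ∧ ∀ ψ : Z → ℝ, Integrable ψ μ → ∀ g : Phase N →ᵇ ℝ,
        Tendsto (fun n => ∫ z, ψ z * ∫ ω, g (u (χ n) (z, ω)) ∂P ∂μ) atTop
          (𝓝 (∫ z, ψ z * ∫ ξ, g ξ ∂(ν z : Measure (Phase N)) ∂μ)) := by
  -- the joint laws of the point and the value, for a probability measure `ρ` equivalent to `μ`
  set ρ : Measure Z := μ.toFinite with hρ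
  have hT : ∀ l, Measurable fun y : Z × Ω => (y.1, u l y) := fun l => measurable_fst.prodMk (hu l)
  let m : ℕ → ProbabilityMeasure (Z × Phase N) := fun l =>
    ⟨(ρ.prod P).map fun y => (y.1, u l y), Measure.isProbabilityMeasure_map (hT l).aemeasurable⟩
  have hmval : ∀ l, (m l : Measure (Z × Phase N)) = (ρ.prod P).map fun y => (y.1, u l y) :=
    fun l => rfl
  have hmfst : ∀ l, (m l : Measure (Z × Phase N)).fst = ρ := by
    intro l
    rw [hmval, Measure.fst, Measure.map_map measurable_fst (hT l)]
    have : (Prod.fst ∘ fun y : Z × Ω => (y.1, u l y)) = Prod.fst := rfl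
    rw [this, ← Measure.fst, Measure.fst_prod]
  -- they are uniformly tight
  obtain ⟨τ, -, hτpos, hτ⟩ : ∃ τ : ℕ → NNReal, StrictAnti τ ∧ (∀ n, 0 < τ n) ∧
    Tendsto τ atTop (𝓝 0) := exists_seq_strictAnti_tendsto 0
  have htight : ∀ n, ∃ K : Set Z, IsCompact K ∧ ρ Kᶜ ≤ τ n := by
    intro n
    obtain ⟨K, hK, h⟩ := isTightMeasureSet_iff_exists_isCompact_measure_compl_le.1
      (isTightMeasureSet_singleton (μ := ρ)) (τ n) (by exact_mod_cast hτpos n)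
    exact ⟨K, hK, h ρ rfl⟩
  choose K hK hKτ using htight
  have hcpt := isCompact_setOfPred_probabilityMeasure_mass_eq_compl_isCompact_le
    (E := Z × Phase N) (K := fun n => K n ×ˢ Metric.closedBall (0 : Phase N) C) hτ
    (fun n => (hK n).prod (isCompact_closedBall _ _)) (Or.inl (by
      let _ := TopologicalSpace.upgradeIsCompletelyMetrizable Z
      infer_instance))
  have hmem : ∀ l, m l ∈ {m : ProbabilityMeasure (Z × Phase N) |
      ∀ n, m (K n ×ˢ Metric.closedBall (0 : Phase N) C)ᶜ ≤ τ n} := by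
    intro l n
    have h1 : (m l : Measure (Z × Phase N)) (K n ×ˢ Metric.closedBall (0 : Phase N) C)ᶜ
        ≤ τ n := by
      have hms : MeasurableSet (K n ×ˢ Metric.closedBall (0 : Phase N) C)ᶜ :=
        ((hK n).measurableSet.prod Metric.isClosed_closedBall.measurableSet).compl
      rw [hmval, Measure.map_apply (hT l) hms]
      refine le_trans ?_ (hKτ n)
      have : ((fun y : Z × Ω => (y.1, u l y)) ⁻¹' (K n ×ˢ Metric.closedBall (0 : Phase N) C)ᶜ)
          = (K n)ᶜ ×ˢ Set.univ := by
        ext y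
        simp [hC l y]
      rw [this, Measure.prod_prod, measure_univ, mul_one]
    exact ENNReal.coe_le_coe.1 (by simpa using h1)
  let _ := TopologicalSpace.upgradeIsCompletelyMetrizable Z
  obtain ⟨m₀, hm₀, χ, hχ, hlim⟩ := hcpt.isSeqCompact hmem
  have hm₀fst : (m₀ : Measure (Z × Phase N)).fst = ρ := by
    have h1 := ProbabilityMeasure.tendsto_map_of_tendsto_of_continuous _ _ hlim
      (continuous_fst (X := Z) (Y := Phase N))
    have h2 : ∀ n, (m n).map (continuous_fst (X := Z) (Y := Phase N)).measurable.aemeasurable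
        = ⟨ρ, inferInstance⟩ := by
      intro n
      apply Subtype.ext
      exact hmfst n
    simp only [Function.comp_apply, h2] at h1
    have h3 := tendsto_nhds_unique h1 tendsto_const_nhds
    exact congrArg Subtype.val h3
  have hm₀ball : ∀ᵐ y ∂(m₀ : Measure (Z × Phase N)), ‖y.2‖ ≤ C := by
    have h0 : (m₀ : Measure (Z × Phase N)) {y | ¬ ‖y.2‖ ≤ C} ≤ 0 := by
      refine ge_of_tendsto' (f := fun n => (τ n : ℝ≥0∞)) (x := atTop) ?_ fun n => ?_
      · simpa using ENNReal.tendsto_coe.2 hτ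
      · have h1 : (m₀ : Measure (Z × Phase N)) (K n ×ˢ Metric.closedBall (0 : Phase N) C)ᶜ
            ≤ τ n := by
          have := ENNReal.coe_le_coe.2 (hm₀ n)
          simpa using this
        refine (measure_mono ?_).trans h1
        intro y hy
        simp only [Set.mem_compl_iff, Set.mem_prod, mem_closedBall_zero_iff, not_and]
        exact fun _ => hy
    exact le_antisymm h0 zero_le
  -- disintegration of the limit
  let M₀ : Measure (Z × Phase N) := (m₀ : Measure (Z × Phase N))
  have hdis : M₀ = ρ ⊗ₘ M₀.condKernel := by
    rw [← hm₀fst]; exact (M₀.disintegrate M₀.condKernel).symm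
  let ν : Z → ProbabilityMeasure (Phase N) := fun z => ⟨M₀.condKernel z, inferInstance⟩
  have hνval : ∀ z, (ν z : Measure (Phase N)) = M₀.condKernel z := fun z => rfl
  refine ⟨ν, ?_, ?_, χ, hχ, ?_⟩
  · intro g
    simp only [hνval]
    exact (g.continuous.measurable.stronglyMeasurable.integral_kernel).measurable.aemeasurable
  · have h1 : ∀ᵐ y ∂(ρ ⊗ₘ M₀.condKernel), ‖y.2‖ ≤ C := hdis ▸ hm₀ball
    have h2 := Measure.ae_ae_of_ae_compProd h1
    rwa [hρ, ae_toFinite] at h2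
  · intro ψ hψ g
    -- transfer from `μ` to `ρ`
    have hac : μ ≪ ρ := absolutelyContinuous_toFinite μ
    set θ : Z → ℝ := fun z => (μ.rnDeriv ρ z).toReal * ψ z with hθdef
    have hθ : Integrable θ ρ := by
      have := (integrable_rnDeriv_smul_iff (f := ψ) hac).2 hψ
      simpa [hθdef, smul_eq_mul] using this
    have htr : ∀ G : Z → ℝ, ∫ z, ψ z * G z ∂μ = ∫ z, θ z * G z ∂ρ := by
      intro G
      rw [← integral_rnDeriv_smul hac]
      simp [hθdef, smul_eq_mul, mul_assoc]
    have hl : ∀ l, ∫ z, ψ z * ∫ ω, g (u l (z, ω)) ∂P ∂μ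
        = ∫ y, θ y.1 * g y.2 ∂(m l : Measure (Z × Phase N)) := by
      intro l
      have hi := (abs_integral_fst_mul_le (hmfst l) hθ g).1
      rw [hmval] at hi ⊢
      rw [htr, integral_map (hT l).aemeasurable hi.aestronglyMeasurable, integral_prod]
      · simp only [integral_const_mul]
      · exact hi.comp_measurable (hT l)
    have hr : ∫ z, ψ z * ∫ ξ, g ξ ∂(ν z : Measure (Phase N)) ∂μ = ∫ y, θ y.1 * g y.2 ∂M₀ := by
      have hi := (abs_integral_fst_mul_le hm₀fst hθ g).1
      change Integrable _ M₀ at hi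
      rw [htr, hdis, Measure.integral_compProd (hdis ▸ hi)]
      simp only [integral_const_mul, hνval]
    simp only [hl, hr]
    exact tendsto_integral_fst_mul (fun n => hmfst (χ n)) hm₀fst hlim hθ g

end YoungMeasures

/-! ### Monte-Carlo sums -/

theorem l2Norm_nonneg {Ω' : Type*} [MeasurableSpace Ω'] (P' : Measure Ω') (X : Ω' → ℝ) :
    0 ≤ l2Norm P' X := ENNReal.toReal_nonneg

theorem l2Norm_const {Ω' : Type*} [MeasurableSpace Ω'] (P' : Measure Ω') [IsProbabilityMeasure P']
    (c : ℝ) : l2Norm P' (fun _ => c) = |c| := by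
  rw [l2Norm, eLpNorm_const' _ (by norm_num) (by norm_num)]
  simp

theorem l2Norm_add_le {Ω' : Type*} [MeasurableSpace Ω'] {P' : Measure Ω'} {X Y : Ω' → ℝ}
    (hX : MemLp X 2 P') (hY : MemLp Y 2 P') :
    l2Norm P' (fun ω => X ω + Y ω) ≤ l2Norm P' X + l2Norm P' Y := by
  rw [l2Norm, l2Norm, l2Norm, ← ENNReal.toReal_add hX.2.ne hY.2.ne]
  exact ENNReal.toReal_mono (ENNReal.add_ne_top.2 ⟨hX.2.ne, hY.2.ne⟩)
    (eLpNorm_add_le hX.1 hY.1 (by norm_num))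

theorem l2Norm_sum_le {Ω' ι : Type*} [MeasurableSpace Ω'] {P' : Measure Ω'} {X : ι → Ω' → ℝ}
    {s : Finset ι} (hX : ∀ i ∈ s, MemLp (X i) 2 P') :
    l2Norm P' (fun ω => ∑ i ∈ s, X i ω) ≤ ∑ i ∈ s, l2Norm P' (X i) := by
  have h := eLpNorm_sum_le (p := 2) (fun i hi => (hX i hi).1) (by norm_num)
  simp only [l2Norm]
  rw [← ENNReal.toReal_sum fun i hi => (hX i hi).2.ne]
  convert ENNReal.toReal_mono (ENNReal.sum_ne_top.2 fun i hi => (hX i hi).2.ne) h using 3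
  ext ω
  simp

theorem l2Norm_sub_integral_sq {Ω' : Type*} [MeasurableSpace Ω'] {P' : Measure Ω'}
    [IsProbabilityMeasure P'] {X : Ω' → ℝ} (hX : MemLp X 2 P') :
    l2Norm P' (fun ω => X ω - ∫ ω', X ω' ∂P') ^ 2 = variance X P' := by
  have h : MemLp (fun ω => X ω - ∫ ω', X ω' ∂P') 2 P' := hX.sub (memLp_const _)
  rw [variance_eq_integral hX.aemeasurable, l2Norm,
    h.eLpNorm_eq_integral_rpow_norm (by norm_num) (by norm_num),
    ENNReal.toReal_ofReal (by positivity)]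
  simp only [ENNReal.toReal_ofNat, Real.rpow_two, Real.norm_eq_abs, sq_abs]
  rw [← Real.rpow_natCast, ← Real.rpow_mul (integral_nonneg fun _ => sq_nonneg _)]
  norm_num

/-- The mean square deviation of a sum of pairwise independent random variables. -/
theorem l2Norm_sum_sub_integral_sq {Ω' ι : Type*} [MeasurableSpace Ω'] {P' : Measure Ω'}
    [IsProbabilityMeasure P'] {X : ι → Ω' → ℝ} {s : Finset ι} (hX : ∀ i ∈ s, MemLp (X i) 2 P')
    (hind : Set.Pairwise ↑s fun i j => IndepFun (X i) (X j) P') :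
    l2Norm P' (fun ω => ∑ i ∈ s, (X i ω - ∫ ω', X i ω' ∂P')) ^ 2 = ∑ i ∈ s, variance (X i) P' := by
  rw [← IndepFun.variance_sum hX hind, ← l2Norm_sub_integral_sq (memLp_finsetSum' s hX)]
  congr 2
  ext ω
  simp only [Finset.sum_apply, Finset.sum_sub_distrib]
  rw [integral_finsetSum s fun i hi => (hX i hi).integrable (by norm_num)]

section Samples

variable {Ω Ω' V : Type*} [MeasurableSpace Ω] [MeasurableSpace Ω'] [MeasurableSpace V]
  {P : Measure Ω} {P' : Measure Ω'}
  {u₀ : Ω → V} {L : ℕ} {M : ℕ → ℕ} {U : ℕ → ℕ → Ω' → V} {Φ : ℕ → V → ℝ} {B : ℕ → ℝ}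

/-- A weighted sample of the functional `Φ l`, centered. -/
def centeredSample (P : Measure Ω) (u₀ : Ω → V) (M : ℕ → ℕ) (U : ℕ → ℕ → Ω' → V)
    (Φ : ℕ → V → ℝ) (l k : ℕ) (ω : Ω') : ℝ :=
  (M l : ℝ)⁻¹ * Φ l (U l k ω) - (M l : ℝ)⁻¹ * ∫ ω', Φ l (u₀ ω') ∂P

theorem memLp_sample [IsProbabilityMeasure P']
    (hU : ∀ l ≤ L, ∀ k < M l, IdentDistrib (U l k) u₀ P' P)
    (hΦ : ∀ l, Measurable (Φ l)) (hB : ∀ l v, |Φ l v| ≤ B l) {l k : ℕ} (hl : l ≤ L)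
    (hk : k < M l) : MemLp (fun ω => (M l : ℝ)⁻¹ * Φ l (U l k ω)) 2 P' :=
  (MemLp.of_bound ((hΦ l).comp_aemeasurable (hU l hl k hk).aemeasurable_fst).aestronglyMeasurable
    (B l) (ae_of_all _ fun _ => hB l _)).const_mul _

theorem memLp_centeredSample [IsProbabilityMeasure P']
    (hU : ∀ l ≤ L, ∀ k < M l, IdentDistrib (U l k) u₀ P' P)
    (hΦ : ∀ l, Measurable (Φ l)) (hB : ∀ l v, |Φ l v| ≤ B l) {l k : ℕ} (hl : l ≤ L)
    (hk : k < M l) : MemLp (centeredSample P u₀ M U Φ l k) 2 P' :=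
  (memLp_sample hU hΦ hB hl hk).sub (memLp_const _)

theorem centeredSample_eq (hU : ∀ l ≤ L, ∀ k < M l, IdentDistrib (U l k) u₀ P' P)
    (hΦ : ∀ l, Measurable (Φ l)) {l k : ℕ} (hl : l ≤ L) (hk : k < M l) (ω : Ω') :
    centeredSample P u₀ M U Φ l k ω = (M l : ℝ)⁻¹ * Φ l (U l k ω)
      - ∫ ω', (M l : ℝ)⁻¹ * Φ l (U l k ω') ∂P' := by
  have h := ((hU l hl k hk).comp (hΦ l)).integral_eq
  simp only [Function.comp_apply] at h
  rw [centeredSample, integral_const_mul, h]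

theorem variance_sample (hU : ∀ l ≤ L, ∀ k < M l, IdentDistrib (U l k) u₀ P' P)
    (hΦ : ∀ l, Measurable (Φ l)) {l k : ℕ} (hl : l ≤ L) (hk : k < M l) :
    variance (fun ω => (M l : ℝ)⁻¹ * Φ l (U l k ω)) P'
      = (M l : ℝ)⁻¹ ^ 2 * variance (fun ω => Φ l (u₀ ω)) P := by
  rw [variance_const_mul]
  congr 1
  exact ((hU l hl k hk).comp (hΦ l)).variance_eq

theorem indepFun_sample_of_level (hind : ∀ l ≤ L, iIndepFun (fun k : Fin (M l) => U l k) P')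
    (hΦ : ∀ l, Measurable (Φ l)) {l k k' : ℕ} (hl : l ≤ L) (hk : k < M l) (hk' : k' < M l)
    (hkk : k ≠ k') :
    IndepFun (fun ω => (M l : ℝ)⁻¹ * Φ l (U l k ω)) (fun ω => (M l : ℝ)⁻¹ * Φ l (U l k' ω)) P' := by
  have h := (hind l hl).indepFun (i := ⟨k, hk⟩) (j := ⟨k', hk'⟩) (by simpa using hkk)
  exact h.comp (φ := fun v => (M l : ℝ)⁻¹ * Φ l v) (ψ := fun v => (M l : ℝ)⁻¹ * Φ l v)
    ((hΦ l).const_mul _) ((hΦ l).const_mul _)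

/-- The mean square error of the Monte-Carlo estimator on one level. -/
theorem l2Norm_level [IsProbabilityMeasure P'] (hM : ∀ l ≤ L, 0 < M l)
    (hU : ∀ l ≤ L, ∀ k < M l, IdentDistrib (U l k) u₀ P' P)
    (hind : ∀ l ≤ L, iIndepFun (fun k : Fin (M l) => U l k) P')
    (hΦ : ∀ l, Measurable (Φ l)) (hB : ∀ l v, |Φ l v| ≤ B l) {l : ℕ} (hl : l ≤ L) :
    l2Norm P' (fun ω => ∑ k ∈ Finset.range (M l), centeredSample P u₀ M U Φ l k ω)
      = √(variance (fun ω => Φ l (u₀ ω)) P) / √(M l : ℝ) := by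
  have hM' : (0 : ℝ) < M l := by exact_mod_cast hM l hl
  rw [← Real.sqrt_div (variance_nonneg _ _), eq_comm,
    Real.sqrt_eq_iff_eq_sq (div_nonneg (variance_nonneg _ _) hM'.le) (l2Norm_nonneg _ _)]
  have h := l2Norm_sum_sub_integral_sq (P' := P') (s := Finset.range (M l))
    (X := fun k ω => (M l : ℝ)⁻¹ * Φ l (U l k ω))
    (fun k hk => memLp_sample hU hΦ hB hl (Finset.mem_range.1 hk))
    (fun k hk k' hk' hkk => indepFun_sample_of_level hind hΦ hl (Finset.mem_range.1 hk)
      (Finset.mem_range.1 hk') hkk)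
  rw [Finset.sum_congr rfl fun k hk => variance_sample hU hΦ hl (Finset.mem_range.1 hk)] at h
  simp only [Finset.sum_const, Finset.card_range, nsmul_eq_mul] at h
  calc variance (fun ω => Φ l (u₀ ω)) P / M l
      = M l * ((M l : ℝ)⁻¹ ^ 2 * variance (fun ω => Φ l (u₀ ω)) P) := by field_simp
    _ = _ := by
      rw [← h]
      congr 2
      ext ω
      exact Finset.sum_congr rfl fun k hk =>
        (centeredSample_eq hU hΦ hl (Finset.mem_range.1 hk) ω).symm

/-- The mean square error of the multilevel estimator when the levels are independent. -/
theorem l2Norm_levels_sq [IsProbabilityMeasure P'] (hM : ∀ l ≤ L, 0 < M l)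
    (hU : ∀ l ≤ L, ∀ k < M l, IdentDistrib (U l k) u₀ P' P)
    (hind : ∀ l ≤ L, iIndepFun (fun k : Fin (M l) => U l k) P')
    (hind' : ∀ l ≤ L, ∀ l' ≤ L, l ≠ l' → ∀ k < M l, ∀ k' < M l', IndepFun (U l k) (U l' k') P')
    (hΦ : ∀ l, Measurable (Φ l)) (hB : ∀ l v, |Φ l v| ≤ B l) :
    l2Norm P' (fun ω => ∑ l ∈ Finset.range (L + 1), ∑ k ∈ Finset.range (M l),
        centeredSample P u₀ M U Φ l k ω) ^ 2
      = ∑ l ∈ Finset.range (L + 1), variance (fun ω => Φ l (u₀ ω)) P / M l := by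
  have hs : ∀ i ∈ (Finset.range (L + 1)).sigma fun l => Finset.range (M l),
      i.1 ≤ L ∧ i.2 < M i.1 := by
    intro i hi
    simp only [Finset.mem_sigma, Finset.mem_range] at hi
    exact ⟨by omega, hi.2⟩
  have h := l2Norm_sum_sub_integral_sq (P' := P')
    (s := (Finset.range (L + 1)).sigma fun l => Finset.range (M l))
    (X := fun i ω => (M i.1 : ℝ)⁻¹ * Φ i.1 (U i.1 i.2 ω))
    (fun i hi => memLp_sample hU hΦ hB (hs i hi).1 (hs i hi).2)
    (by
      rintro ⟨l, k⟩ hi ⟨l', k'⟩ hj hij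
      have h1 := hs _ hi
      have h2 := hs _ hj
      by_cases hll : l = l'
      · subst hll
        exact indepFun_sample_of_level hind hΦ h1.1 h1.2 h2.2 fun hk =>
          hij (Sigma.ext rfl (heq_of_eq hk))
      · exact (hind' l h1.1 l' h2.1 hll k h1.2 k' h2.2).comp
          (φ := fun v => (M l : ℝ)⁻¹ * Φ l v) (ψ := fun v => (M l' : ℝ)⁻¹ * Φ l' v)
          ((hΦ l).const_mul _) ((hΦ l').const_mul _))
  rw [Finset.sum_congr rfl fun i hi => variance_sample hU hΦ (hs i hi).1 (hs i hi).2,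
    Finset.sum_sigma] at h
  simp only [Finset.sum_const, Finset.card_range, nsmul_eq_mul] at h
  rw [Finset.sum_congr rfl fun l hl => ?_]
  · rw [← h]
    congr 2
    ext ω
    rw [Finset.sum_sigma]
    exact Finset.sum_congr rfl fun l hl => Finset.sum_congr rfl fun k hk =>
      centeredSample_eq hU hΦ (by simpa [Nat.lt_succ_iff] using hl) (Finset.mem_range.1 hk) ω
  · have hM' : (0 : ℝ) < M l := by
      exact_mod_cast hM l (by simpa [Nat.lt_succ_iff] using hl)
    field_simp

end Samples

/-! ### Joint measurability of the numerical solutions -/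

section Field

variable {d N p : ℕ} {F : ℝ → Fin d → (Fin (2 * p) → Phase N) → Phase N} {Δx : ℝ}

theorem measurable_cellIndex (Δx : ℝ) : Measurable (cellIndex Δx : Space d → Fin d → ℤ) := by
  refine measurable_pi_lambda _ fun k => ?_
  exact Int.measurable_floor.comp (by fun_prop)

/-- The numerical solution, extended by its initial value to negative times. Unlike `evolve`, which
is arbitrary at negative times, it is jointly measurable. -/
def field (T : NumericalEvolution F Δx) (v : InitialData d N) (z : Space d × ℝ) : Phase N :=
  T.evolve v z.1 (max z.2 0)

theorem field_of_nonneg (T : NumericalEvolution F Δx) (v : InitialData d N) {z : Space d × ℝ}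
    (hz : 0 ≤ z.2) : field T v z = T.evolve v z.1 z.2 := by
  rw [field, max_eq_left hz]

/-- The cell values of the numerical solution, extended to negative times. -/
def cells (T : NumericalEvolution F Δx) (v : InitialData d N) (i : Fin d → ℤ) (t : ℝ) : Phase N :=
  T.evolve v (midpoint Δx i) (max t 0)

theorem field_eq_cells (T : NumericalEvolution F Δx) (v : InitialData d N) (z : Space d × ℝ) :
    field T v z = cells T v (cellIndex Δx z.1) z.2 :=
  T.const_on_cells v z.1 _ (le_max_right _ _)

theorem continuous_cells (T : NumericalEvolution F Δx) (v : InitialData d N) (i : Fin d → ℤ) :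
    Continuous (cells T v i) := by
  have h : ContinuousOn (fun s => T.evolve v (midpoint Δx i) s) (Set.Ici 0) :=
    fun t ht => (T.ode v i t ht).continuousWithinAt
  exact h.comp_continuous (by fun_prop) fun t => le_max_right t 0

theorem measurable_cells (T : NumericalEvolution F Δx) (i : Fin d → ℤ) :
    Measurable fun y : InitialData d N × ℝ => cells T y.1 i y.2 := by
  have h := measurable_uncurry_of_continuous_of_measurable
    (u := fun (t : ℝ) (v : InitialData d N) => cells T v i t)
    (fun v => continuous_cells T v i) (fun t => T.measurable_evolve _ _ (le_max_right _ _))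
  exact h.comp measurable_swap

theorem measurable_field (T : NumericalEvolution F Δx) :
    Measurable fun y : InitialData d N × (Space d × ℝ) => field T y.1 y.2 := by
  have h : Measurable fun y : (InitialData d N × ℝ) × (Fin d → ℤ) => cells T y.1.1 y.2 y.1.2 :=
    measurable_from_prod_countable_left fun i => measurable_cells T i
  have h2 : Measurable fun y : InitialData d N × (Space d × ℝ) =>
      ((y.1, y.2.2), cellIndex Δx y.2.1) :=
    (measurable_fst.prodMk (measurable_snd.comp measurable_snd)).prodMk
      ((measurable_cellIndex Δx).comp (measurable_fst.comp measurable_snd))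
  simp only [field_eq_cells]
  exact h.comp h2

theorem ae_spaceTime_nonneg : ∀ᵐ z ∂(spaceTime d), 0 ≤ z.2 :=
  ae_restrict_mem (measurableSet_le measurable_const measurable_snd)

instance : SigmaFinite (spaceTime d) := by unfold spaceTime; infer_instance

instance : IsFiniteMeasureOnCompacts (spaceTime d) := by unfold spaceTime; infer_instance

end Field

/-! ### The error of the multilevel Monte-Carlo estimator -/

section Estimator

variable {d N p : ℕ} {F : ℝ → Fin d → (Fin (2 * p) → Phase N) → Phase N} {Δx₀ : ℝ}
  (S : ∀ l, NumericalEvolution F (meshWidth Δx₀ l))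

/-- The functional `v ↦ ⟨ψ, g(S^{Δx_l}(v))⟩`. -/
def observable (ψ : Space d × ℝ → ℝ) (g : Phase N →ᵇ ℝ) (l : ℕ) (v : InitialData d N) : ℝ :=
  ∫ z, ψ z * g (field (S l) v z) ∂(spaceTime d)

/-- The functional that is sampled on level `l`: the observable on the coarsest mesh for `l = 0`,
and the difference of the observables on two successive meshes otherwise. -/
def increment (ψ : Space d × ℝ → ℝ) (g : Phase N →ᵇ ℝ) : ℕ → InitialData d N → ℝ
  | 0, v => observable S ψ g 0 v
  | l + 1, v => observable S ψ g (l + 1) v - observable S ψ g l v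

theorem integrable_observable {ψ : Space d × ℝ → ℝ} (hψ : Integrable ψ (spaceTime d))
    (g : Phase N →ᵇ ℝ) (l : ℕ) (v : InitialData d N) :
    Integrable (fun z => ψ z * g (field (S l) v z)) (spaceTime d) :=
  hψ.mul_bdd (c := ‖g‖) (g.continuous.measurable.comp
    ((measurable_field (S l)).comp measurable_prodMk_left)).aestronglyMeasurable
    (ae_of_all _ fun _ => g.norm_coe_le_norm _)

theorem measurable_observable {ψ : Space d × ℝ → ℝ} (hψ : Integrable ψ (spaceTime d))
    (g : Phase N →ᵇ ℝ) (l : ℕ) : Measurable (observable S ψ g l) := by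
  have h1 : observable S ψ g l = fun v =>
      ∫ z, hψ.1.mk ψ z * g (field (S l) v z) ∂(spaceTime d) := by
    ext v
    refine integral_congr_ae ?_
    filter_upwards [hψ.1.ae_eq_mk] with z hz
    rw [hz]
  rw [h1]
  have h2 : StronglyMeasurable fun y : InitialData d N × (Space d × ℝ) =>
      hψ.1.mk ψ y.2 * g (field (S l) y.1 y.2) :=
    ((hψ.1.stronglyMeasurable_mk.measurable.comp measurable_snd).mul
      (g.continuous.measurable.comp (measurable_field (S l)))).stronglyMeasurable
  exact h2.integral_prod_right'.measurable

theorem abs_observable_le {ψ : Space d × ℝ → ℝ} (hψ : Integrable ψ (spaceTime d))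
    (g : Phase N →ᵇ ℝ) (l : ℕ) (v : InitialData d N) :
    |observable S ψ g l v| ≤ (∫ z, ‖ψ z‖ ∂(spaceTime d)) * ‖g‖ := by
  rw [observable, ← integral_mul_const]
  refine abs_integral_le_integral_abs.trans (integral_mono
    (integrable_observable S hψ g l v).abs (hψ.norm.mul_const _) fun z => ?_)
  simp only [abs_mul]
  exact mul_le_mul_of_nonneg_left (g.norm_coe_le_norm _) (abs_nonneg _)

theorem measurable_increment {ψ : Space d × ℝ → ℝ} (hψ : Integrable ψ (spaceTime d))
    (g : Phase N →ᵇ ℝ) : ∀ l, Measurable (increment S ψ g l)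
  | 0 => measurable_observable S hψ g 0
  | l + 1 => (measurable_observable S hψ g (l + 1)).sub (measurable_observable S hψ g l)

theorem abs_increment_le {ψ : Space d × ℝ → ℝ} (hψ : Integrable ψ (spaceTime d))
    (g : Phase N →ᵇ ℝ) (l : ℕ) (v : InitialData d N) :
    |increment S ψ g l v| ≤ 2 * ((∫ z, ‖ψ z‖ ∂(spaceTime d)) * ‖g‖) := by
  have h0 : 0 ≤ (∫ z, ‖ψ z‖ ∂(spaceTime d)) * ‖g‖ :=
    mul_nonneg (integral_nonneg fun _ => norm_nonneg _) (norm_nonneg _)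
  cases l with
  | zero => exact (abs_observable_le S hψ g 0 v).trans (by linarith)
  | succ l =>
    refine (abs_sub _ _).trans ?_
    linarith [abs_observable_le S hψ g (l + 1) v, abs_observable_le S hψ g l v]

theorem observable_eq {Ω : Type*} (u₀ : Ω → InitialData d N) (ψ : Space d × ℝ → ℝ)
    (g : Phase N →ᵇ ℝ) (l : ℕ) (ω : Ω) :
    ∫ z, ψ z * g (approx S u₀ l ω z) ∂(spaceTime d) = observable S ψ g l (u₀ ω) := by
  refine integral_congr_ae ?_
  filter_upwards [ae_spaceTime_nonneg] with z hz
  simp only [approx, field_of_nonneg _ _ hz]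

theorem integrable_approx {Ω : Type*} (u₀ : Ω → InitialData d N) {ψ : Space d × ℝ → ℝ}
    (hψ : Integrable ψ (spaceTime d)) (g : Phase N →ᵇ ℝ) (l : ℕ) (ω : Ω) :
    Integrable (fun z => ψ z * g (approx S u₀ l ω z)) (spaceTime d) := by
  refine (integrable_observable S hψ g l (u₀ ω)).congr ?_
  filter_upwards [ae_spaceTime_nonneg] with z hz
  simp only [approx, field_of_nonneg _ _ hz]

theorem baseVar_eq {Ω : Type*} [MeasurableSpace Ω] (P : Measure Ω) (u₀ : Ω → InitialData d N)
    (ψ : Space d × ℝ → ℝ) (g : Phase N →ᵇ ℝ) :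
    baseVar P S u₀ ψ g = variance (fun ω => increment S ψ g 0 (u₀ ω)) P := by
  simp only [baseVar, observable_eq, increment]

theorem levelVar_eq {Ω : Type*} [MeasurableSpace Ω] (P : Measure Ω) (u₀ : Ω → InitialData d N)
    {ψ : Space d × ℝ → ℝ} (hψ : Integrable ψ (spaceTime d)) (g : Phase N →ᵇ ℝ) (l : ℕ) :
    levelVar P S u₀ ψ g l = variance (fun ω => increment S ψ g (l + 1) (u₀ ω)) P := by
  simp only [levelVar, increment, ← observable_eq]
  congr 1
  ext ω
  rw [← integral_sub (integrable_approx S u₀ hψ g _ ω) (integrable_approx S u₀ hψ g _ ω)]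
  simp only [mul_sub]

theorem integral_mlmc {Ω' : Type*} (L : ℕ) (M : ℕ → ℕ) (U : ℕ → ℕ → Ω' → InitialData d N)
    (ω : Ω') (z : Space d × ℝ) (g : Phase N →ᵇ ℝ) :
    (mlmc S L M U ω z).Integrable g ∧ ∫ᵛ ξ, g ξ ∂<•(mlmc S L M U ω z)
      = (M 0 : ℝ)⁻¹ * ∑ k ∈ Finset.range (M 0), g (approx S (U 0 k) 0 ω z)
        + ∑ l ∈ Finset.range L, (M (l + 1) : ℝ)⁻¹ * ∑ k ∈ Finset.range (M (l + 1)),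
          (g (approx S (U (l + 1) k) (l + 1) ω z) - g (approx S (U (l + 1) k) l ω z)) := by
  have hd : ∀ a : Phase N, (delta a).Integrable g := fun a => integrable_toSignedMeasure _ g
  have h0 : ∀ k ∈ Finset.range (M 0), (delta (approx S (U 0 k) 0 ω z)).Integrable g :=
    fun k _ => hd _
  have h1 : ∀ l, ∀ k ∈ Finset.range (M (l + 1)), (delta (approx S (U (l + 1) k) (l + 1) ω z)
      - delta (approx S (U (l + 1) k) l ω z)).Integrable g :=
    fun l k _ => (hd _).sub_vectorMeasure (hd _)
  have h2 := (VectorMeasure.Integrable.finsetSum_vectorMeasure h0).smul_vectorMeasure (M 0 : ℝ)⁻¹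
  have h3 : ∀ l ∈ Finset.range L, ((M (l + 1) : ℝ)⁻¹ • ∑ k ∈ Finset.range (M (l + 1)),
        (delta (approx S (U (l + 1) k) (l + 1) ω z)
          - delta (approx S (U (l + 1) k) l ω z))).Integrable g := fun l _ =>
    (VectorMeasure.Integrable.finsetSum_vectorMeasure (h1 l)).smul_vectorMeasure _
  have h4 := VectorMeasure.Integrable.finsetSum_vectorMeasure h3
  refine ⟨h2.add_vectorMeasure h4, ?_⟩
  rw [mlmc, VectorMeasure.integral_add_vectorMeasure h2 h4,
    VectorMeasure.integral_smul_vectorMeasure, VectorMeasure.integral_finsetSum_vectorMeasure h0,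
    VectorMeasure.integral_finsetSum_vectorMeasure h3]
  simp only [integral_delta, smul_eq_mul]
  congr 1
  refine Finset.sum_congr rfl fun l _ => ?_
  rw [VectorMeasure.integral_smul_vectorMeasure,
    VectorMeasure.integral_finsetSum_vectorMeasure (h1 l)]
  simp only [VectorMeasure.integral_sub_vectorMeasure (hd _) (hd _), integral_delta, smul_eq_mul]

/-- The pairing with the estimator is a sum of sample means of the increments. -/
theorem pairing_sub_mlmc {Ω' : Type*} (L : ℕ) (M : ℕ → ℕ) (U : ℕ → ℕ → Ω' → InitialData d N)
    (ω : Ω') {ψ : Space d × ℝ → ℝ} (hψ : Integrable ψ (spaceTime d)) (g : Phase N →ᵇ ℝ)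
    (s : Space d × ℝ → SignedMeasure (Phase N)) (hs : ∀ᵐ z ∂(spaceTime d), (s z).Integrable g)
    (hsi : Integrable (fun z => ψ z * ∫ᵛ ξ, g ξ ∂<•(s z)) (spaceTime d)) :
    pairing (spaceTime d) ψ (s - mlmc S L M U ω) g = pairing (spaceTime d) ψ s g
      - ∑ l ∈ Finset.range (L + 1), ∑ k ∈ Finset.range (M l),
          (M l : ℝ)⁻¹ * increment S ψ g l (U l k ω) := by
  have ha : ∀ l l' k, Integrable (fun z => ψ z * g (approx S (U l k) l' ω z)) (spaceTime d) :=
    fun l l' k => integrable_approx S (U l k) hψ g l' ω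
  have h0 : Integrable (fun z => ∑ k ∈ Finset.range (M 0),
      (M 0 : ℝ)⁻¹ * (ψ z * g (approx S (U 0 k) 0 ω z))) (spaceTime d) :=
    integrable_finsetSum _ fun k _ => (ha 0 0 k).const_mul _
  have h3 : ∀ l k, Integrable (fun z => (M (l + 1) : ℝ)⁻¹ *
      (ψ z * g (approx S (U (l + 1) k) (l + 1) ω z) - ψ z * g (approx S (U (l + 1) k) l ω z)))
      (spaceTime d) := fun l k => ((ha _ _ k).sub (ha _ _ k)).const_mul _
  have h1 : ∀ l, Integrable (fun z => ∑ k ∈ Finset.range (M (l + 1)), (M (l + 1) : ℝ)⁻¹ *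
      (ψ z * g (approx S (U (l + 1) k) (l + 1) ω z) - ψ z * g (approx S (U (l + 1) k) l ω z)))
      (spaceTime d) := fun l => integrable_finsetSum _ fun k _ => h3 l k
  have h2 := integrable_finsetSum (Finset.range L) fun l _ => h1 l
  have hpt : ∀ᵐ z ∂(spaceTime d), ψ z * ∫ᵛ ξ, g ξ ∂<•((s - mlmc S L M U ω) z)
      = ψ z * (∫ᵛ ξ, g ξ ∂<•(s z)) - ((∑ k ∈ Finset.range (M 0),
          (M 0 : ℝ)⁻¹ * (ψ z * g (approx S (U 0 k) 0 ω z)))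
        + ∑ l ∈ Finset.range L, ∑ k ∈ Finset.range (M (l + 1)), (M (l + 1) : ℝ)⁻¹ *
          (ψ z * g (approx S (U (l + 1) k) (l + 1) ω z)
            - ψ z * g (approx S (U (l + 1) k) l ω z))) := by
    filter_upwards [hs] with z hz
    have hm := integral_mlmc S L M U ω z g
    rw [Pi.sub_apply, VectorMeasure.integral_sub_vectorMeasure hz hm.1, hm.2]
    simp only [mul_sub, mul_add, Finset.mul_sum]
    congr 1
    congr 1
    · exact Finset.sum_congr rfl fun k _ => by ring
    · exact Finset.sum_congr rfl fun l _ => Finset.sum_congr rfl fun k _ => by ring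
  rw [pairing, integral_congr_ae hpt, integral_sub hsi (h0.fun_add h2), integral_add h0 h2, pairing,
    integral_finsetSum _ fun k _ => (ha 0 0 k).const_mul _,
    integral_finsetSum _ fun l _ => h1 l, Finset.sum_range_succ' _ L, add_comm (∑ _ ∈ _, _)]
  congr 2
  · refine Finset.sum_congr rfl fun l _ => ?_
    rw [integral_finsetSum _ fun k _ => h3 l k]
    refine Finset.sum_congr rfl fun k _ => ?_
    rw [integral_const_mul, integral_sub (ha _ _ k) (ha _ _ k), observable_eq, observable_eq,
      increment]
  · simp only [integral_const_mul, increment, observable_eq]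

theorem integrable_mul_integral_signed {ν : Space d × ℝ → ProbabilityMeasure (Phase N)}
    (hν : IsYoungMeasure (spaceTime d) ν) {ψ : Space d × ℝ → ℝ}
    (hψ : Integrable ψ (spaceTime d)) (g : Phase N →ᵇ ℝ) :
    Integrable (fun z => ψ z * ∫ ξ, g ξ ∂(ν z : Measure (Phase N))) (spaceTime d) := by
  refine hψ.mul_bdd (c := ‖g‖) (hν.aemeasurable_integral g.continuous
    (ae_of_all _ fun z => g.integrable _)).aestronglyMeasurable (ae_of_all _ fun z => ?_)
  exact (norm_integral_le_of_norm_le_const (ae_of_all _ fun ξ => g.norm_coe_le_norm ξ)).trans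
    (by simp)

section Law

variable {Ω : Type*} [MeasurableSpace Ω] (P : Measure Ω) [IsProbabilityMeasure P]
  {u₀ : Ω → InitialData d N}

theorem measurable_approx (hu₀ : Measurable u₀) (l : ℕ) {z : Space d × ℝ} (hz : 0 ≤ z.2) :
    Measurable fun ω => approx S u₀ l ω z :=
  ((S l).measurable_evolve _ _ hz).comp hu₀

theorem measurable_field_comp (hu₀ : Measurable u₀) (l : ℕ) :
    Measurable fun y : (Space d × ℝ) × Ω => field (S l) (u₀ y.2) y.1 :=
  (measurable_field (S l)).comp ((hu₀.comp measurable_snd).prodMk measurable_fst)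

theorem integral_lawOf_approx (hu₀ : Measurable u₀) (l : ℕ) (g : Phase N →ᵇ ℝ) :
    ∀ᵐ z ∂(spaceTime d), ∫ᵛ ξ, g ξ ∂<•(lawOf P (approx S u₀ l) z)
      = ∫ ω, g (field (S l) (u₀ ω) z) ∂P := by
  filter_upwards [ae_spaceTime_nonneg] with z hz
  rw [integral_lawOf P _ z (measurable_approx S hu₀ l hz)]
  simp only [approx, field_of_nonneg _ _ hz]

theorem integrable_mul_integral_lawOf (hu₀ : Measurable u₀) (l : ℕ) {ψ : Space d × ℝ → ℝ}
    (hψ : Integrable ψ (spaceTime d)) (g : Phase N →ᵇ ℝ) :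
    Integrable (fun z => ψ z * ∫ᵛ ξ, g ξ ∂<•(lawOf P (approx S u₀ l) z)) (spaceTime d) := by
  have h : Integrable (fun z => ψ z * ∫ ω, g (field (S l) (u₀ ω) z) ∂P) (spaceTime d) := by
    refine hψ.mul_bdd (c := ‖g‖) ?_ (ae_of_all _ fun z => ?_)
    · exact (g.continuous.measurable.comp
        (measurable_field_comp S hu₀ l)).stronglyMeasurable.integral_prod_right'
          |>.aestronglyMeasurable
    · exact (norm_integral_le_of_norm_le_const (ae_of_all _ fun ω => g.norm_coe_le_norm _)).trans
        (by simp)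
  refine h.congr ?_
  filter_upwards [integral_lawOf_approx S P hu₀ l g] with z hz
  rw [hz]

/-- By Fubini's theorem, the pairing with the law of `u^l` is an expectation. -/
theorem pairing_lawOf (hu₀ : Measurable u₀) (l : ℕ) {ψ : Space d × ℝ → ℝ}
    (hψ : Integrable ψ (spaceTime d)) (g : Phase N →ᵇ ℝ) :
    pairing (spaceTime d) ψ (lawOf P (approx S u₀ l)) g = ∫ ω, observable S ψ g l (u₀ ω) ∂P := by
  have h1 : pairing (spaceTime d) ψ (lawOf P (approx S u₀ l)) g
      = ∫ z, ∫ ω, ψ z * g (field (S l) (u₀ ω) z) ∂P ∂(spaceTime d) := by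
    refine integral_congr_ae ?_
    filter_upwards [integral_lawOf_approx S P hu₀ l g] with z hz
    rw [hz, integral_const_mul]
  rw [h1, integral_integral_swap]
  · rfl
  · exact (hψ.comp_fst P).mul_bdd (c := ‖g‖) (g.continuous.measurable.comp
      (measurable_field_comp S hu₀ l)).aestronglyMeasurable
      (ae_of_all _ fun y => g.norm_coe_le_norm _)

/-- The increments telescope: their expectations add up to the pairing on the finest mesh. -/
theorem sum_integral_increment (hu₀ : Measurable u₀) (L : ℕ) {ψ : Space d × ℝ → ℝ}
    (hψ : Integrable ψ (spaceTime d)) (g : Phase N →ᵇ ℝ) :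
    ∑ l ∈ Finset.range (L + 1), ∫ ω, increment S ψ g l (u₀ ω) ∂P
      = pairing (spaceTime d) ψ (lawOf P (approx S u₀ L)) g := by
  have hi : ∀ l, Integrable (fun ω => observable S ψ g l (u₀ ω)) P := fun l =>
    Integrable.of_bound ((measurable_observable S hψ g l).comp hu₀).aestronglyMeasurable _
      (ae_of_all _ fun ω => abs_observable_le S hψ g l (u₀ ω))
  rw [pairing_lawOf S P hu₀ L hψ g, Finset.sum_range_succ']
  simp only [increment, integral_sub (hi _) (hi _)]
  rw [Finset.sum_range_sub fun l => ∫ ω, observable S ψ g l (u₀ ω) ∂P]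
  ring

end Law

end Estimator

section ErrorEstimates

variable {d N p : ℕ} {F : ℝ → Fin d → (Fin (2 * p) → Phase N) → Phase N} {Δx₀ : ℝ}
  (S : ∀ l, NumericalEvolution F (meshWidth Δx₀ l))
  {Ω Ω' : Type*} [MeasurableSpace Ω] {P : Measure Ω}
  {u₀ : Ω → InitialData d N} {L : ℕ} {M : ℕ → ℕ} {U : ℕ → ℕ → Ω' → InitialData d N}

/-- The error of the estimator is a deterministic bias plus the centered sampling error. -/
theorem pairing_sub_mlmc_eq_bias_sub [IsProbabilityMeasure P]
    (hu₀ : Measurable u₀) (hM : ∀ l ≤ L, 0 < M l)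
    {ψ : Space d × ℝ → ℝ} (hψ : Integrable ψ (spaceTime d)) (g : Phase N →ᵇ ℝ)
    (s : Space d × ℝ → SignedMeasure (Phase N)) (hs : ∀ᵐ z ∂(spaceTime d), (s z).Integrable g)
    (hsi : Integrable (fun z => ψ z * ∫ᵛ ξ, g ξ ∂<•(s z)) (spaceTime d)) (ω : Ω') :
    pairing (spaceTime d) ψ (s - mlmc S L M U ω) g
      = (pairing (spaceTime d) ψ s g - pairing (spaceTime d) ψ (lawOf P (approx S u₀ L)) g)
        + -∑ l ∈ Finset.range (L + 1), ∑ k ∈ Finset.range (M l),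
            centeredSample P u₀ M U (increment S ψ g) l k ω := by
  have hcenter : ∑ l ∈ Finset.range (L + 1), ∑ k ∈ Finset.range (M l),
      centeredSample P u₀ M U (increment S ψ g) l k ω
      = ∑ l ∈ Finset.range (L + 1), ((∑ k ∈ Finset.range (M l), (M l : ℝ)⁻¹ *
        increment S ψ g l (U l k ω)) - ∫ ω', increment S ψ g l (u₀ ω') ∂P) := by
    refine Finset.sum_congr rfl fun l hl => ?_
    have hM' : (0 : ℝ) < M l := by
      exact_mod_cast hM l (by simpa [Nat.lt_succ_iff] using hl)
    simp only [centeredSample, Finset.sum_sub_distrib, Finset.sum_const, Finset.card_range,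
      nsmul_eq_mul]
    rw [mul_inv_cancel_left₀ hM'.ne']
  rw [pairing_sub_mlmc S L M U ω hψ g s hs hsi, ← sum_integral_increment S P hu₀ L hψ g, hcenter,
    Finset.sum_sub_distrib]
  ring

variable [MeasurableSpace Ω'] {P' : Measure Ω'}

theorem memLp_samplingError [IsProbabilityMeasure P']
    (hU : ∀ l ≤ L, ∀ k < M l, IdentDistrib (U l k) u₀ P' P)
    {ψ : Space d × ℝ → ℝ} (hψ : Integrable ψ (spaceTime d)) (g : Phase N →ᵇ ℝ) :
    MemLp (fun ω => ∑ l ∈ Finset.range (L + 1), ∑ k ∈ Finset.range (M l),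
      centeredSample P u₀ M U (increment S ψ g) l k ω) 2 P' :=
  memLp_finsetSum _ fun l hl => memLp_finsetSum _ fun k hk =>
    memLp_centeredSample hU (measurable_increment S hψ g) (abs_increment_le S hψ g)
      (by simpa [Nat.lt_succ_iff] using hl) (Finset.mem_range.1 hk)

theorem l2Norm_neg (X : Ω' → ℝ) : l2Norm P' (fun ω => -X ω) = l2Norm P' X := by
  have : (fun ω => -X ω) = -X := rfl
  rw [l2Norm, this, eLpNorm_neg, l2Norm]

theorem l2Norm_const_add_neg_le [IsProbabilityMeasure P'] {X : Ω' → ℝ} (hX : MemLp X 2 P')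
    (b : ℝ) : MemLp (fun ω => b + -X ω) 2 P' ∧
      l2Norm P' (fun ω => b + -X ω) ≤ |b| + l2Norm P' X := by
  refine ⟨(memLp_const b).add hX.neg, (l2Norm_add_le (memLp_const b) hX.neg).trans_eq ?_⟩
  rw [l2Norm_const, ← l2Norm_neg X]
  rfl

theorem integrable_lawOf [IsProbabilityMeasure P]
    (u : Ω → Space d × ℝ → Phase N) (z : Space d × ℝ) (g : Phase N →ᵇ ℝ) :
    (lawOf P u z).Integrable g := integrable_toSignedMeasure _ g

/-- The `L²` error is at most the bias plus the sampling errors of the levels. No independence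
across levels is needed: the levels are added up by the triangle inequality. -/
theorem error_le [IsProbabilityMeasure P] [IsProbabilityMeasure P']
    (hu₀ : Measurable u₀) (hM : ∀ l ≤ L, 0 < M l)
    (hU : ∀ l ≤ L, ∀ k < M l, IdentDistrib (U l k) u₀ P' P)
    (hind : ∀ l ≤ L, iIndepFun (fun k : Fin (M l) => U l k) P')
    {ψ : Space d × ℝ → ℝ} (hψ : Integrable ψ (spaceTime d)) (g : Phase N →ᵇ ℝ)
    {ν : Space d × ℝ → ProbabilityMeasure (Phase N)} (hν : IsYoungMeasure (spaceTime d) ν) :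
    MemLp (fun ω => pairing (spaceTime d) ψ (signed ν - mlmc S L M U ω) g) 2 P' ∧
      l2Norm P' (fun ω => pairing (spaceTime d) ψ (signed ν - mlmc S L M U ω) g)
        ≤ |pairing (spaceTime d) ψ (signed ν - lawOf P (approx S u₀ L)) g|
          + √(baseVar P S u₀ ψ g) / √(M 0 : ℝ)
          + ∑ l ∈ Finset.range L, √(levelVar P S u₀ ψ g l) / √(M (l + 1) : ℝ) := by
  have hνi : ∀ z, (signed ν z).Integrable g := fun z => integrable_toSignedMeasure _ g
  have hνp : Integrable (fun z => ψ z * ∫ᵛ ξ, g ξ ∂<•(signed ν z)) (spaceTime d) := by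
    simpa only [integral_signed] using integrable_mul_integral_signed hν hψ g
  have herr := memLp_samplingError (P := P) S hU hψ g
  rw [funext (pairing_sub_mlmc_eq_bias_sub (P := P) (U := U) S hu₀ hM hψ g (signed ν)
    (ae_of_all _ hνi) hνp)]
  have hbias : pairing (spaceTime d) ψ (signed ν - lawOf P (approx S u₀ L)) g
      = pairing (spaceTime d) ψ (signed ν) g
        - pairing (spaceTime d) ψ (lawOf P (approx S u₀ L)) g := by
    simp only [pairing]
    rw [← integral_sub hνp (integrable_mul_integral_lawOf S P hu₀ L hψ g)]
    refine integral_congr_ae (ae_of_all _ fun z => ?_)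
    simp only
    rw [Pi.sub_apply, VectorMeasure.integral_sub_vectorMeasure (hνi z) (integrable_lawOf _ z g),
      mul_sub]
  rw [← hbias]
  generalize pairing (spaceTime d) ψ (signed ν - lawOf P (approx S u₀ L)) g = b
  have hlev : ∀ l ∈ Finset.range (L + 1), MemLp (fun ω => ∑ k ∈ Finset.range (M l),
      centeredSample P u₀ M U (increment S ψ g) l k ω) 2 P' := fun l hl =>
    memLp_finsetSum _ fun k hk =>
      memLp_centeredSample hU (measurable_increment S hψ g) (abs_increment_le S hψ g)
        (by simpa [Nat.lt_succ_iff] using hl) (Finset.mem_range.1 hk)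
  have hsum := l2Norm_sum_le hlev
  rw [Finset.sum_congr rfl fun l hl => l2Norm_level hM hU hind (measurable_increment S hψ g)
    (abs_increment_le S hψ g) (by simpa [Nat.lt_succ_iff] using hl), Finset.sum_range_succ',
    ← baseVar_eq] at hsum
  simp only [← levelVar_eq S P u₀ hψ] at hsum
  have h := l2Norm_const_add_neg_le herr b
  rw [add_assoc]
  exact ⟨h.1, h.2.trans (add_le_add le_rfl (hsum.trans_eq (add_comm _ _)))⟩

/-- When the levels are independent, the squared distance of the estimator from its mean, the law on
the finest mesh, is exactly the sum of the variances. -/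
theorem error_sq_eq [IsProbabilityMeasure P] [IsProbabilityMeasure P']
    (hu₀ : Measurable u₀) (hM : ∀ l ≤ L, 0 < M l)
    (hU : ∀ l ≤ L, ∀ k < M l, IdentDistrib (U l k) u₀ P' P)
    (hind : ∀ l ≤ L, iIndepFun (fun k : Fin (M l) => U l k) P')
    (hind' : ∀ l ≤ L, ∀ l' ≤ L, l ≠ l' → ∀ k < M l, ∀ k' < M l', IndepFun (U l k) (U l' k') P')
    {ψ : Space d × ℝ → ℝ} (hψ : Integrable ψ (spaceTime d)) (g : Phase N →ᵇ ℝ) :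
    MemLp (fun ω => pairing (spaceTime d) ψ
        (lawOf P (approx S u₀ L) - mlmc S L M U ω) g) 2 P' ∧
      l2Norm P' (fun ω => pairing (spaceTime d) ψ
          (lawOf P (approx S u₀ L) - mlmc S L M U ω) g) ^ 2
        = baseVar P S u₀ ψ g / (M 0 : ℝ)
          + ∑ l ∈ Finset.range L, levelVar P S u₀ ψ g l / (M (l + 1) : ℝ) := by
  have herr := memLp_samplingError (P := P) S hU hψ g
  rw [funext (pairing_sub_mlmc_eq_bias_sub (P := P) (U := U) S hu₀ hM hψ g
    (lawOf P (approx S u₀ L)) (ae_of_all _ fun z => integrable_lawOf _ z g)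
    (integrable_mul_integral_lawOf S P hu₀ L hψ g))]
  simp only [sub_self, zero_add]
  refine ⟨herr.neg, ?_⟩
  rw [l2Norm_neg, l2Norm_levels_sq hM hU hind hind' (measurable_increment S hψ g)
    (abs_increment_le S hψ g), Finset.sum_range_succ', add_comm, baseVar_eq]
  simp only [levelVar_eq S P u₀ hψ]

end ErrorEstimates

/-! ### Grid functions -/

section Grid

variable {d N : ℕ}

/-- The vector of length `h` in the direction of the `k`-th coordinate axis of space-time. -/
def shift (h : ℝ) (k : Fin d) : Space d × ℝ := (EuclideanSpace.single k h, 0)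

theorem cellIndex_add_single {h : ℝ} (hh : 0 < h) (k : Fin d) (x : Space d) :
    cellIndex h (x + EuclideanSpace.single k h) = cellIndex h x + Pi.single k 1 := by
  ext j
  simp only [cellIndex, PiLp.add_apply, PiLp.single_apply, Pi.add_apply,
    Pi.single_apply]
  split_ifs with hj
  · rw [add_div, div_self hh.ne', Int.floor_add_one]
  · simp

theorem measurable_comp_cellIndex {E : Type*} [MeasurableSpace E] (h : ℝ)
    {Ψ : (Fin d → ℤ) → ℝ → E} (hΨ : ∀ i, Measurable (Ψ i)) :
    Measurable fun z : Space d × ℝ => Ψ (cellIndex h z.1) z.2 := by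
  have h1 : Measurable fun y : ℝ × (Fin d → ℤ) => Ψ y.2 y.1 :=
    measurable_from_prod_countable_left hΨ
  exact h1.comp (measurable_snd.prodMk ((measurable_cellIndex h).comp measurable_fst))

theorem volume_cellIndex_preimage {h : ℝ} (hh : 0 < h) (i : Fin d → ℤ) :
    volume (cellIndex h ⁻¹' {i} : Set (Space d)) = ENNReal.ofReal (h ^ d) := by
  have h1 : (cellIndex h ⁻¹' {i} : Set (Space d)) = (WithLp.ofLp : Space d → Fin d → ℝ) ⁻¹'
      (Set.univ.pi fun k => Set.Ico ((i k : ℝ) * h) ((i k + 1) * h)) := by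
    ext x
    simp only [Set.mem_preimage, Set.mem_singleton_iff, funext_iff, cellIndex, Int.floor_eq_iff,
      Set.mem_pi, Set.mem_univ, true_implies, Set.mem_Ico, le_div_iff₀ hh, div_lt_iff₀ hh]
  rw [h1, (PiLp.volume_preserving_ofLp (Fin d)).measure_preimage
    (MeasurableSet.univ_pi fun _ => measurableSet_Ico).nullMeasurableSet, Real.volume_pi_Ico]
  simp only [← sub_mul, add_sub_cancel_left, one_mul, Finset.prod_const, Finset.card_univ,
    Fintype.card_fin]
  rw [ENNReal.ofReal_pow hh.le]

theorem lintegral_comp_cellIndex {h : ℝ} (hh : 0 < h) (Φ : (Fin d → ℤ) → ℝ≥0∞) :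
    ∫⁻ x : Space d, Φ (cellIndex h x) = ∑' i, Φ i * ENNReal.ofReal (h ^ d) := by
  rw [← lintegral_map (μ := volume) (f := Φ) (measurable_of_countable _) (measurable_cellIndex h),
    lintegral_countable']
  refine tsum_congr fun i => ?_
  rw [Measure.map_apply (measurable_cellIndex h) (measurableSet_singleton i),
    volume_cellIndex_preimage hh]

/-- The space-time integral of `‖u_{i + a} - u_i‖^r` for the grid function `W`. -/
def jump (h r T : ℝ) (W : (Fin d → ℤ) → ℝ → Phase N) (a : Fin d → ℤ) : ℝ≥0∞ :=
  ∫⁻ t in Set.Icc 0 T, ∑' i : Fin d → ℤ, ‖W (i + a) t - W i t‖ₑ ^ r * ENNReal.ofReal (h ^ d)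

theorem jump_zero {r : ℝ} (hr : 1 ≤ r) (h T : ℝ) (W : (Fin d → ℤ) → ℝ → Phase N) :
    jump h r T W 0 = 0 := by
  simp [jump, ENNReal.zero_rpow_of_pos (by linarith : 0 < r)]

theorem jump_neg (h r T : ℝ) (W : (Fin d → ℤ) → ℝ → Phase N) (a : Fin d → ℤ) :
    jump h r T W (-a) = jump h r T W a := by
  refine lintegral_congr fun t => ?_
  rw [← (Equiv.addRight a).tsum_eq]
  refine tsum_congr fun i => ?_
  rw [Equiv.coe_addRight, add_neg_cancel_right, enorm_sub_rev]

theorem jump_add_le {r : ℝ} (hr : 1 ≤ r) (h T : ℝ) {W : (Fin d → ℤ) → ℝ → Phase N}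
    (hW : ∀ i, Measurable (W i)) (a b : Fin d → ℤ) :
    jump h r T W (a + b) ≤ 2 ^ (r - 1) * (jump h r T W a + jump h r T W b) := by
  have hmeas : ∀ i, Measurable fun t => ‖W (i + a) t - W i t‖ₑ ^ r * ENNReal.ofReal (h ^ d) :=
    fun i => (((hW _).sub (hW i)).enorm.pow_const r).mul_const _
  simp only [jump]
  rw [← lintegral_add_left (Measurable.tsum hmeas),
    ← lintegral_const_mul' _ _ (ENNReal.rpow_ne_top_of_nonneg (by linarith) (by norm_num))]
  refine lintegral_mono fun t => ?_
  have hshift : ∑' i, ‖W (i + b) t - W i t‖ₑ ^ r * ENNReal.ofReal (h ^ d)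
      = ∑' i, ‖W (i + a + b) t - W (i + a) t‖ₑ ^ r * ENNReal.ofReal (h ^ d) :=
    ((Equiv.addRight a).tsum_eq
      fun i => ‖W (i + b) t - W i t‖ₑ ^ r * ENNReal.ofReal (h ^ d)).symm
  simp only
  rw [hshift, ← ENNReal.tsum_add, ← ENNReal.tsum_mul_left]
  refine ENNReal.tsum_le_tsum fun i => ?_
  rw [← add_mul, ← mul_assoc]
  refine mul_le_mul_left ?_ _
  have h2 : ‖W (i + (a + b)) t - W i t‖ₑ
      ≤ ‖W (i + a) t - W i t‖ₑ + ‖W (i + a + b) t - W (i + a) t‖ₑ := by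
    rw [← add_assoc]
    refine le_trans (le_of_eq ?_) (enorm_add_le _ _)
    congr 1
    abel
  exact (ENNReal.rpow_le_rpow h2 (by linarith)).trans (ENNReal.rpow_add_le_mul_rpow_add_rpow _ _ hr)

/-- If the jumps between neighbouring cells tend to zero, then so do those between cells at any
fixed distance. -/
theorem tendsto_jump {r : ℝ} (hr : 1 ≤ r) {h : ℕ → ℝ} {T : ℝ}
    {W : ℕ → (Fin d → ℤ) → ℝ → Phase N} (hW : ∀ l i, Measurable (W l i)) (k : Fin d)
    (h1 : Tendsto (fun l => jump (h l) r T (W l) (Pi.single k 1)) atTop (𝓝 0)) (m : ℤ) :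
    Tendsto (fun l => jump (h l) r T (W l) (Pi.single k m)) atTop (𝓝 0) := by
  have hnat : ∀ n : ℕ,
      Tendsto (fun l => jump (h l) r T (W l) (Pi.single k (n : ℤ))) atTop (𝓝 0) := by
    intro n
    induction n with
    | zero => simp only [Nat.cast_zero, Pi.single_zero, jump_zero hr]; exact tendsto_const_nhds
    | succ n ih =>
      have h2 := ENNReal.Tendsto.const_mul (a := (2 : ℝ≥0∞) ^ (r - 1)) (ih.add h1)
        (Or.inr (ENNReal.rpow_ne_top_of_nonneg (by linarith) (by norm_num)))
      rw [add_zero, mul_zero] at h2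
      refine tendsto_of_tendsto_of_tendsto_of_le_of_le tendsto_const_nhds h2
        (fun l => zero_le) fun l => ?_
      rw [Nat.cast_succ, Pi.single_add]
      exact jump_add_le hr (h l) T (hW l) _ _
  obtain ⟨n, rfl | rfl⟩ := m.eq_nat_or_neg
  · exact hnat n
  · simpa only [Pi.single_neg, jump_neg] using hnat n

/-- On a finite measure space, convergence to zero in `L^r` implies convergence in `L^1`. -/
theorem tendsto_lintegral_enorm_of_rpow {Z E : Type*} [MeasurableSpace Z] [NormedAddCommGroup E]
    {μ : Measure Z} [IsFiniteMeasure μ] {f : ℕ → Z → E} (hf : ∀ l, AEStronglyMeasurable (f l) μ)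
    {r : ℝ} (hr : 1 ≤ r) (h : Tendsto (fun l => ∫⁻ z, ‖f l z‖ₑ ^ r ∂μ) atTop (𝓝 0)) :
    Tendsto (fun l => ∫⁻ z, ‖f l z‖ₑ ∂μ) atTop (𝓝 0) := by
  have hr0 : 0 < r := by linarith
  have h1 : ∀ l, ∫⁻ z, ‖f l z‖ₑ ∂μ
      ≤ (∫⁻ z, ‖f l z‖ₑ ^ r ∂μ) ^ (1 / r) * μ Set.univ ^ (1 - 1 / r) := by
    intro l
    have := eLpNorm_le_eLpNorm_mul_rpow_measure_univ (p := 1) (q := ENNReal.ofReal r)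
      (by simpa using hr) (hf l)
    rw [eLpNorm_one_eq_lintegral_enorm, eLpNorm_eq_lintegral_rpow_enorm_toReal
      (by simpa using hr0) ENNReal.ofReal_ne_top] at this
    simpa [ENNReal.toReal_ofReal hr0.le] using this
  have h2 := ENNReal.Tendsto.mul_const (b := μ Set.univ ^ (1 - 1 / r))
    ((ENNReal.continuous_rpow_const (y := 1 / r)).tendsto 0 |>.comp h)
    (Or.inr (ENNReal.rpow_ne_top_of_nonneg (by
      rw [sub_nonneg, div_le_one hr0]; exact hr) (measure_ne_top _ _)))
  rw [ENNReal.zero_rpow_of_pos (by positivity), zero_mul] at h2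
  exact tendsto_of_tendsto_of_tendsto_of_le_of_le tendsto_const_nhds h2 (fun l => zero_le) h1

/-- The restriction of Lebesgue measure on space-time to a ball. -/
def ballMeasure (d : ℕ) (R : ℝ) : Measure (Space d × ℝ) :=
  (spaceTime d).restrict (Metric.closedBall 0 R)

instance (R : ℝ) : IsFiniteMeasure (ballMeasure d R) :=
  ⟨by simpa [ballMeasure] using (isCompact_closedBall (0 : Space d × ℝ) R).measure_lt_top⟩

theorem ballMeasure_le (R : ℝ) :
    ballMeasure d R ≤ (volume : Measure (Space d)).prod (volume.restrict (Set.Icc 0 R)) := by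
  have h1 : (volume : Measure (Space d)).prod (volume.restrict (Set.Icc 0 R))
      = (volume : Measure (Space d × ℝ)).restrict (Set.univ ×ˢ Set.Icc 0 R) := by
    rw [Measure.volume_eq_prod, ← Measure.prod_restrict, Measure.restrict_univ]
  rw [h1, ballMeasure, spaceTime,
    Measure.restrict_restrict Metric.isClosed_closedBall.measurableSet]
  refine Measure.restrict_mono (fun z hz => ?_) le_rfl
  refine ⟨Set.mem_univ _, hz.2, ?_⟩
  have h2 := hz.1
  rw [mem_closedBall_zero_iff] at h2
  exact (le_abs_self _).trans ((norm_snd_le z).trans h2)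

/-- Weak BV implies that the differences between values in neighbouring cells vanish in
`L^1_loc`. -/
theorem tendsto_lintegral_jump {r : ℝ} (hr : 1 ≤ r) {h : ℕ → ℝ} (hh : ∀ l, 0 < h l)
    {W : ℕ → (Fin d → ℤ) → ℝ → Phase N} (hW : ∀ l i, Measurable (W l i)) (k : Fin d) {R : ℝ}
    (h1 : Tendsto (fun l => jump (h l) r R (W l) (Pi.single k 1)) atTop (𝓝 0)) (m : ℤ) :
    Tendsto (fun l => ∫⁻ z, ‖W l (cellIndex (h l) z.1 + Pi.single k m) z.2
      - W l (cellIndex (h l) z.1) z.2‖ₑ ∂(ballMeasure d R)) atTop (𝓝 0) := by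
  have hmeas : ∀ l, Measurable fun z : Space d × ℝ =>
      W l (cellIndex (h l) z.1 + Pi.single k m) z.2 - W l (cellIndex (h l) z.1) z.2 := fun l =>
    measurable_comp_cellIndex (h l) (Ψ := fun i t => W l (i + Pi.single k m) t - W l i t)
      fun i => (hW l _).sub (hW l i)
  refine tendsto_lintegral_enorm_of_rpow (fun l => (hmeas l).aestronglyMeasurable) hr ?_
  refine tendsto_of_tendsto_of_tendsto_of_le_of_le tendsto_const_nhds
    (tendsto_jump hr hW k h1 m) (fun l => zero_le) fun l => ?_
  have h2 := lintegral_mono' (ballMeasure_le R) (le_refl fun z : Space d × ℝ =>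
    ‖W l (cellIndex (h l) z.1 + Pi.single k m) z.2 - W l (cellIndex (h l) z.1) z.2‖ₑ ^ r)
  rw [lintegral_prod_symm' _ ((hmeas l).enorm.pow_const r)] at h2
  rw [jump]
  refine h2.trans_eq (lintegral_congr fun t => ?_)
  rw [← lintegral_comp_cellIndex (hh l)]

end Grid

/-! ### Test functions -/

section TestFunctions

variable {d : ℕ} {φ : Space d × ℝ → ℝ}

theorem continuous_dt (hφ : ContDiff ℝ 1 φ) : Continuous (dt φ) :=
  (hφ.continuous_fderiv one_ne_zero).clm_apply continuous_const

theorem continuous_dx (hφ : ContDiff ℝ 1 φ) (k : Fin d) : Continuous (dx k φ) :=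
  (hφ.continuous_fderiv one_ne_zero).clm_apply continuous_const

theorem hasCompactSupport_dt (hs : HasCompactSupport φ) : HasCompactSupport (dt φ) :=
  hs.fderiv_apply (𝕜 := ℝ) _

theorem hasCompactSupport_dx (hs : HasCompactSupport φ) (k : Fin d) :
    HasCompactSupport (dx k φ) :=
  hs.fderiv_apply (𝕜 := ℝ) _

theorem hasDerivAt_time (hφ : ContDiff ℝ 1 φ) (x : Space d) (t : ℝ) :
    HasDerivAt (fun s => φ (x, s)) (dt φ (x, t)) t :=
  ((hφ.differentiable one_ne_zero) (x, t)).hasFDerivAt.comp_hasDerivAt t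
    ((hasDerivAt_const t x).prodMk (hasDerivAt_id t))

/-- The difference quotient of `φ` in the direction of the `k`-th coordinate axis. -/
def diffQuot (h : ℝ) (k : Fin d) (φ : Space d × ℝ → ℝ) (z : Space d × ℝ) : ℝ :=
  h⁻¹ * (φ (z + shift h k) - φ z)

theorem norm_shift {h : ℝ} (hh : 0 ≤ h) (k : Fin d) : ‖shift h k‖ = h := by
  simp [shift, Prod.norm_def, abs_of_nonneg hh, hh]

theorem abs_diffQuot_sub_dx_le (hφ : ContDiff ℝ 1 φ) (hs : HasCompactSupport φ) (k : Fin d)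
    {ε : ℝ} (hε : 0 < ε) :
    ∃ δ > 0, ∀ h, 0 < h → h < δ → ∀ z, |diffQuot h k φ z - dx k φ z| ≤ ε := by
  have huc : UniformContinuous (fderiv ℝ φ) :=
    (hφ.continuous_fderiv one_ne_zero).uniformContinuous_of_tendsto_cocompact
      (hs.fderiv (𝕜 := ℝ)).is_zero_at_infty
  obtain ⟨δ, hδ, hδε⟩ := Metric.uniformContinuous_iff.1 huc ε hε
  refine ⟨δ, hδ, fun h hh hhδ z => ?_⟩
  have h1 := (convex_ball z δ).norm_image_sub_le_of_norm_fderiv_le' (𝕜 := ℝ) (f := φ) (C := ε)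
    (φ := fderiv ℝ φ z) (x := z) (y := z + shift h k)
    (fun y _ => (hφ.differentiable one_ne_zero) y)
    (fun y hy => by rw [← dist_eq_norm]; exact (hδε hy).le)
    (Metric.mem_ball_self hδ) (by simpa [norm_shift hh.le] using hhδ)
  rw [add_sub_cancel_left, norm_shift hh.le] at h1
  have h2 : fderiv ℝ φ z (shift h k) = h * dx k φ z := by
    have : shift h k = h • ((EuclideanSpace.single k 1, 0) : Space d × ℝ) := by
      ext j <;> simp [shift]
    rw [this, map_smul, smul_eq_mul, dx]
  rw [h2, Real.norm_eq_abs] at h1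
  have h3 : diffQuot h k φ z - dx k φ z = h⁻¹ * (φ (z + shift h k) - φ z - h * dx k φ z) := by
    rw [diffQuot]; field_simp
  rw [h3, abs_mul, abs_of_pos (inv_pos.2 hh), inv_mul_le_iff₀ hh]
  linarith

theorem exists_radius (hs : HasCompactSupport φ) :
    ∃ R, 0 < R ∧ ∀ z, R < ‖z‖ → φ z = 0 ∧ fderiv ℝ φ z = 0 := by
  obtain ⟨R, hR, hsub⟩ := hs.isCompact.isBounded.subset_closedBall_lt 0 0
  refine ⟨R, hR, fun z hz => ?_⟩
  have hz' : z ∉ tsupport φ := fun hmem => by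
    have := hsub hmem
    rw [mem_closedBall_zero_iff] at this
    linarith
  exact ⟨image_eq_zero_of_notMem_tsupport hz',
    image_eq_zero_of_notMem_tsupport fun hmem => hz' (tsupport_fderiv_subset ℝ hmem)⟩

theorem hasCompactSupport_trace (hs : HasCompactSupport φ) :
    HasCompactSupport fun x => φ (x, 0) := by
  obtain ⟨R, -, hR⟩ := exists_radius hs
  refine HasCompactSupport.of_support_subset_isCompact (isCompact_closedBall 0 R) fun x hx => ?_
  rw [mem_closedBall_zero_iff]
  by_contra hlt
  exact hx (hR (x, 0) ((not_le.1 hlt).trans_le (norm_fst_le (x, (0 : ℝ))))).1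

theorem diffQuot_eq_zero {R : ℝ} (hR : ∀ z, R < ‖z‖ → φ z = 0) {h : ℝ} (hh : 0 ≤ h)
    (hh1 : h ≤ 1) (k : Fin d) {z : Space d × ℝ} (hz : R + 1 < ‖z‖) : diffQuot h k φ z = 0 := by
  have h1 : ‖z‖ ≤ ‖z + shift h k‖ + h := by
    have := norm_sub_le (z + shift h k) (shift h k)
    rwa [add_sub_cancel_right, norm_shift hh] at this
  rw [diffQuot, hR z (by linarith), hR _ (by linarith), sub_zero, mul_zero]

theorem continuous_diffQuot (hφ : Continuous φ) (h : ℝ) (k : Fin d) :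
    Continuous (diffQuot h k φ) := by
  unfold diffQuot; fun_prop

theorem hasCompactSupport_diffQuot (hs : HasCompactSupport φ) (h : ℝ) (k : Fin d) :
    HasCompactSupport (diffQuot h k φ) := by
  have h1 : HasCompactSupport fun z => φ (z + shift h k) :=
    hs.comp_homeomorph (Homeomorph.addRight (shift h k))
  exact (h1.sub hs).mul_left (f := fun _ => h⁻¹)

theorem integrable_mul_of_bound {Z : Type*} [TopologicalSpace Z] [MeasurableSpace Z]
    [OpensMeasurableSpace Z] {μ : Measure Z} [IsFiniteMeasureOnCompacts μ] {χ b : Z → ℝ} {B : ℝ}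
    (hχ : Continuous χ) (hs : HasCompactSupport χ) (hb : Measurable b) (hB : ∀ z, |b z| ≤ B) :
    Integrable (fun z => χ z * b z) μ :=
  (hχ.integrable_of_hasCompactSupport hs).mul_bdd (c := B) hb.aestronglyMeasurable
    (ae_of_all _ hB)

theorem spaceTime_eq_prod :
    spaceTime d = (volume : Measure (Space d)).prod (volume.restrict (Set.Ici 0)) := by
  have h1 : {z : Space d × ℝ | 0 ≤ z.2} = Set.univ ×ˢ Set.Ici 0 := by ext; simp
  rw [spaceTime, h1, Measure.volume_eq_prod, ← Measure.prod_restrict, Measure.restrict_univ]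

theorem measurePreserving_add_shift (h : ℝ) (k : Fin d) :
    MeasurePreserving (fun z => z + shift h k) (spaceTime d) (spaceTime d) := by
  rw [spaceTime_eq_prod]
  convert (measurePreserving_add_right (volume : Measure (Space d))
    (EuclideanSpace.single k h)).prod (MeasurePreserving.id (volume.restrict (Set.Ici (0 : ℝ))))
    using 1
  ext z <;> simp [shift]

/-- Summation by parts. As the integrand is constant on cells, it amounts to the invariance of
Lebesgue measure under the translation by one cell. -/
theorem integral_mul_flux_sub {h : ℝ} (hh : 0 < h) (k : Fin d) (hφ : Continuous φ)
    (hs : HasCompactSupport φ) {G : (Fin d → ℤ) → ℝ → ℝ} (hG : ∀ i, Measurable (G i)) {B : ℝ}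
    (hB : ∀ i t, |G i t| ≤ B) :
    ∫ z, φ z * (h⁻¹ * (G (cellIndex h z.1) z.2
        - G (cellIndex h z.1 - Pi.single k 1) z.2)) ∂(spaceTime d)
      = -∫ z, diffQuot h k φ z * G (cellIndex h z.1) z.2 ∂(spaceTime d) := by
  have hm1 := measurable_comp_cellIndex h hG
  have hm2 := measurable_comp_cellIndex h (Ψ := fun i t => G (i - Pi.single k 1) t)
    fun i => hG _
  have hi1 : Integrable (fun z => φ z * G (cellIndex h z.1) z.2) (spaceTime d) :=
    integrable_mul_of_bound hφ hs hm1 fun z => hB _ _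
  have hi2 : Integrable (fun z => φ z * G (cellIndex h z.1 - Pi.single k 1) z.2) (spaceTime d) :=
    integrable_mul_of_bound hφ hs hm2 fun z => hB _ _
  have hi3 : Integrable (fun z => φ (z + shift h k) * G (cellIndex h z.1) z.2) (spaceTime d) :=
    integrable_mul_of_bound (hφ.comp (continuous_id.add continuous_const))
      (hs.comp_homeomorph (Homeomorph.addRight (shift h k))) hm1 fun z => hB _ _
  have htr := (measurePreserving_add_shift h k).integral_comp
    (MeasurableEquiv.addRight (shift h k)).measurableEmbedding
    (fun z => φ z * G (cellIndex h z.1 - Pi.single k 1) z.2)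
  have hcell : ∀ z : Space d × ℝ, cellIndex h (z + shift h k).1 - Pi.single k 1 = cellIndex h z.1 :=
    fun z => by rw [shift, Prod.fst_add, cellIndex_add_single hh, add_sub_cancel_right]
  have hsnd : ∀ z : Space d × ℝ, (z + shift h k).2 = z.2 := fun z => by simp [shift]
  simp only [hcell, hsnd] at htr
  have hl : ∀ z : Space d × ℝ, φ z * (h⁻¹ * (G (cellIndex h z.1) z.2
      - G (cellIndex h z.1 - Pi.single k 1) z.2)) = h⁻¹ * (φ z * G (cellIndex h z.1) z.2
        - φ z * G (cellIndex h z.1 - Pi.single k 1) z.2) := fun z => by ring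
  have hr : ∀ z : Space d × ℝ, diffQuot h k φ z * G (cellIndex h z.1) z.2
      = h⁻¹ * (φ (z + shift h k) * G (cellIndex h z.1) z.2 - φ z * G (cellIndex h z.1) z.2) :=
    fun z => by rw [diffQuot]; ring
  simp only [hl, hr, integral_const_mul]
  rw [integral_sub hi1 hi2, integral_sub hi3 hi1, htr]
  ring

end TestFunctions

/-! ### The discrete entropy inequality in weak form -/

section Discrete

variable {d N : ℕ} {φ : Space d × ℝ → ℝ}

/-- The time integral of a differential inequality `φ (a' + c) ≤ 0`, after integration by parts. The
derivative of `a` need not be integrable: only the upper bound `φ a' ≤ -φ c` enters. -/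
theorem time_inequality (hφ : ContDiff ℝ 1 φ) {R : ℝ} (hR0 : 0 < R)
    (hR : ∀ z, R < ‖z‖ → φ z = 0 ∧ fderiv ℝ φ z = 0) (x : Space d) {a c : ℝ → ℝ}
    (ha : Continuous a) (hc : Continuous c)
    (hineq : ∀ t, 0 < t → ∃ a', HasDerivAt a a' t ∧ φ (x, t) * (a' + c t) ≤ 0) :
    0 ≤ φ (x, 0) * a 0 + ∫ t in Set.Ici 0, (dt φ (x, t) * a t - φ (x, t) * c t) := by
  have hpair : Continuous fun t : ℝ => (x, t) := by fun_prop
  have hcont : Continuous fun t => dt φ (x, t) * a t - φ (x, t) * c t :=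
    (((continuous_dt hφ).comp hpair).mul ha).sub ((hφ.continuous.comp hpair).mul hc)
  have hzero : ∀ t, R + 1 ≤ t → φ (x, t) = 0 ∧ fderiv ℝ φ (x, t) = 0 := fun t ht =>
    hR _ ((by rw [Real.norm_eq_abs]; linarith [le_abs_self t] : R < ‖t‖).trans_le
      (norm_snd_le (x, t)))
  have h1 : ∫ t in Set.Ici 0, (dt φ (x, t) * a t - φ (x, t) * c t)
      = ∫ t in (0)..(R + 1), (dt φ (x, t) * a t - φ (x, t) * c t) := by
    rw [intervalIntegral.integral_of_le (by linarith), integral_Ici_eq_integral_Ioi]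
    refine setIntegral_eq_of_subset_of_forall_sdiff_eq_zero measurableSet_Ioi
      Set.Ioc_subset_Ioi_self fun t ht => ?_
    have ht' : R + 1 ≤ t := by
      by_contra hlt
      exact ht.2 ⟨ht.1, (not_le.1 hlt).le⟩
    simp [dt, (hzero t ht').1, (hzero t ht').2]
  choose! a' ha' hle using hineq
  have h2 := intervalIntegral.sub_le_integral_of_hasDeriv_right_of_le (a := 0) (b := R + 1)
    (g := fun t => φ (x, t) * a t) (g' := fun t => dt φ (x, t) * a t + φ (x, t) * a' t)
    (φ := fun t => dt φ (x, t) * a t - φ (x, t) * c t) (by linarith)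
    ((hφ.continuous.comp hpair).mul ha).continuousOn
    (fun t ht => ((hasDerivAt_time hφ x t).mul (ha' t ht.1)).hasDerivWithinAt)
    hcont.continuousOn.integrableOn_Icc
    (fun t ht => by have := hle t ht.1; linarith)
  simp only [(hzero (R + 1) le_rfl).1, zero_mul] at h2
  rw [h1]
  linarith

/-- A differential inequality for the cell values implies an inequality in the sense of
distributions, with difference quotients in place of the spatial derivatives. -/
theorem discrete_weak_inequality {h : ℝ} (hh : 0 < h) (hφ : ContDiff ℝ 1 φ)
    (hs : HasCompactSupport φ) {a : (Fin d → ℤ) → ℝ → ℝ} (ha : ∀ i, Continuous (a i)) {A : ℝ}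
    (hA : ∀ i t, |a i t| ≤ A) {G : Fin d → (Fin d → ℤ) → ℝ → ℝ} (hG : ∀ k i, Continuous (G k i))
    {B : ℝ} (hB : ∀ k i t, |G k i t| ≤ B)
    (hineq : ∀ x t, 0 < t → ∃ a', HasDerivAt (a (cellIndex h x)) a' t ∧
      φ (x, t) * (a' + ∑ k, h⁻¹ * (G k (cellIndex h x) t
        - G k (cellIndex h x - Pi.single k 1) t)) ≤ 0) :
    0 ≤ (∫ x, φ (x, 0) * a (cellIndex h x) 0)
      + (∫ z, dt φ z * a (cellIndex h z.1) z.2 ∂(spaceTime d))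
      + ∑ k, ∫ z, diffQuot h k φ z * G k (cellIndex h z.1) z.2 ∂(spaceTime d) := by
  obtain ⟨R, hR0, hR⟩ := exists_radius hs
  have hma := measurable_comp_cellIndex h fun i => (ha i).measurable
  have hmG : ∀ k, Measurable fun z : Space d × ℝ => h⁻¹ * (G k (cellIndex h z.1) z.2
        - G k (cellIndex h z.1 - Pi.single k 1) z.2) := fun k =>
    measurable_comp_cellIndex h
      (Ψ := fun i t => h⁻¹ * (G k i t - G k (i - Pi.single k 1) t))
      fun i => ((hG k i).sub (hG k _)).measurable.const_mul _
  have hi1 : Integrable (fun z => dt φ z * a (cellIndex h z.1) z.2) (spaceTime d) :=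
    integrable_mul_of_bound (continuous_dt hφ) (hasCompactSupport_dt hs) hma fun z => hA _ _
  have hi2 : ∀ k, Integrable (fun z => φ z * (h⁻¹ * (G k (cellIndex h z.1) z.2
        - G k (cellIndex h z.1 - Pi.single k 1) z.2))) (spaceTime d) := fun k => by
    refine integrable_mul_of_bound (B := h⁻¹ * (B + B)) hφ.continuous hs (hmG k) fun z => ?_
    rw [abs_mul, abs_of_pos (inv_pos.2 hh)]
    refine mul_le_mul_of_nonneg_left ?_ (inv_pos.2 hh).le
    exact (abs_sub _ _).trans (add_le_add (hB _ _ _) (hB _ _ _))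
  have hi3 : Integrable (fun z : Space d × ℝ => dt φ z * a (cellIndex h z.1) z.2
      - ∑ k, φ z * (h⁻¹ * (G k (cellIndex h z.1) z.2
        - G k (cellIndex h z.1 - Pi.single k 1) z.2))) (spaceTime d) :=
    hi1.sub (integrable_finsetSum _ fun k _ => hi2 k)
  have hi4 : Integrable fun x : Space d => φ (x, 0) * a (cellIndex h x) 0 := by
    refine integrable_mul_of_bound (hφ.continuous.comp (by fun_prop)) ?_
      (hma.comp (g := fun z : Space d × ℝ => a (cellIndex h z.1) z.2)
        (f := fun x => (x, 0)) (by fun_prop)) fun x => hA _ _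
    exact hasCompactSupport_trace hs
  have hsum : ∀ k, ∫ z, diffQuot h k φ z * G k (cellIndex h z.1) z.2 ∂(spaceTime d)
      = -∫ z, φ z * (h⁻¹ * (G k (cellIndex h z.1) z.2
        - G k (cellIndex h z.1 - Pi.single k 1) z.2)) ∂(spaceTime d) := fun k => by
    rw [integral_mul_flux_sub hh k hφ.continuous hs (fun i => (hG k i).measurable) (hB k), neg_neg]
  simp only [hsum]
  rw [Finset.sum_neg_distrib, ← integral_finsetSum _ fun k _ => hi2 k, add_assoc, ← sub_eq_add_neg,
    ← integral_sub hi1 (integrable_finsetSum _ fun k _ => hi2 k), spaceTime_eq_prod,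
    integral_prod _ (spaceTime_eq_prod ▸ hi3), ← integral_add hi4
      (spaceTime_eq_prod ▸ hi3).integral_prod_left]
  refine integral_nonneg fun x => ?_
  have h1 := time_inequality hφ hR0 hR x (ha (cellIndex h x))
    (c := fun t => ∑ k, h⁻¹ * (G k (cellIndex h x) t - G k (cellIndex h x - Pi.single k 1) t))
    (continuous_finsetSum _ fun k _ => ((hG k _).sub (hG k _)).const_mul _) (hineq x)
  simp only [Finset.mul_sum] at h1
  exact h1

end Discrete

/-! ### Consistency of the scheme along a sequence of meshes -/

section Consistency

variable {d N p : ℕ} {φ : Space d × ℝ → ℝ} {Q : ℝ → Fin d → (Fin (2 * p) → Phase N) → ℝ}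
  {q : Fin d → Phase N → ℝ} {h : ℕ → ℝ} {W : ℕ → (Fin d → ℤ) → ℝ → Phase N} {C : ℝ}

/-- The numerical flux in direction `k` between the cells `i` and `i + e_k` at time `t`. -/
def fluxAt (Q : ℝ → Fin d → (Fin (2 * p) → Phase N) → ℝ) (h : ℝ)
    (W : (Fin d → ℤ) → ℝ → Phase N) (k : Fin d) (i : Fin d → ℤ) (t : ℝ) : ℝ :=
  Q h k (stencil p k (fun j => W j t) i)

theorem continuous_fluxAt (hQ : IsConsistentFlux Q q) {h : ℝ} (hh : 0 < h)
    {W : (Fin d → ℤ) → ℝ → Phase N} (hW : ∀ i, Continuous (W i)) (k : Fin d) (i : Fin d → ℤ) :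
    Continuous (fluxAt Q h W k i) :=
  (hQ.locallyLipschitz h hh k).continuous.comp (continuous_pi fun _ => hW _)

theorem abs_fluxAt_sub_le (hQ : IsConsistentFlux Q q) (C : ℝ) :
    ∃ A, 0 ≤ A ∧ ∀ h, 0 < h → ∀ W : (Fin d → ℤ) → ℝ → Phase N, (∀ i t, ‖W i t‖ ≤ C) →
      ∀ k i t, |fluxAt Q h W k i t - q k (W i t)|
        ≤ A * ∑ j : Fin (2 * p), ‖W (i + Pi.single k ((j : ℤ) - p + 1)) t - W i t‖ := by
  obtain ⟨A, hA⟩ := hQ.consistent _ (isCompact_closedBall (0 : Phase N) C)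
  refine ⟨max A 0, le_max_right _ _, fun h hh W hW k i t => ?_⟩
  have h1 := hA h hh k (fun j => W j t) i fun j => by
    rw [mem_closedBall_zero_iff]; exact hW _ _
  refine h1.trans ((mul_le_mul_of_nonneg_right (le_max_left A 0)
    (Finset.sum_nonneg fun _ _ => norm_nonneg _)).trans_eq ?_)
  congr 1
  exact Finset.sum_congr rfl fun j _ => norm_sub_rev _ _

theorem exists_bound_on_ball {η : Phase N → ℝ} (hη : Continuous η) (C : ℝ) :
    ∃ B, 0 ≤ B ∧ ∀ ξ : Phase N, ‖ξ‖ ≤ C → |η ξ| ≤ B := by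
  obtain ⟨B, hB⟩ := (isCompact_closedBall (0 : Phase N) C).exists_bound_of_continuousOn
    hη.continuousOn
  exact ⟨max B 0, le_max_right _ _, fun ξ hξ => (hB ξ (by simpa using hξ)).trans (le_max_left _ _)⟩

theorem abs_fluxAt_le (hQ : IsConsistentFlux Q q) (hq : ∀ k, Continuous (q k)) (C : ℝ) :
    ∃ B, 0 ≤ B ∧ ∀ h, 0 < h → ∀ W : (Fin d → ℤ) → ℝ → Phase N, (∀ i t, ‖W i t‖ ≤ C) →
      ∀ k i t, |fluxAt Q h W k i t| ≤ B := by
  obtain ⟨A, hA0, hA⟩ := abs_fluxAt_sub_le hQ C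
  choose b hb0 hb using fun k => exists_bound_on_ball (hq k) C
  refine ⟨A * (2 * p * (|C| + |C|)) + ∑ k, b k, ?_, fun h hh W hW k i t => ?_⟩
  · have := Finset.sum_nonneg fun k (_ : k ∈ Finset.univ) => hb0 k
    positivity
  · have h1 := hA h hh W hW k i t
    have h2 : ∑ j : Fin (2 * p), ‖W (i + Pi.single k ((j : ℤ) - p + 1)) t - W i t‖
        ≤ 2 * p * (|C| + |C|) := by
      refine (Finset.sum_le_card_nsmul _ _ (|C| + |C|) fun j _ => ?_).trans_eq ?_
      · exact (norm_sub_le _ _).trans (add_le_add ((hW _ _).trans (le_abs_self _))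
          ((hW _ _).trans (le_abs_self _)))
      · simp; ring
    have h3 : b k ≤ ∑ k, b k :=
      Finset.single_le_sum (fun k _ => hb0 k) (Finset.mem_univ k)
    have h4 := hb k (W i t) (hW i t)
    have h5 : |fluxAt Q h W k i t| ≤ |fluxAt Q h W k i t - q k (W i t)| + |q k (W i t)| := by
      simpa using abs_add_le (fluxAt Q h W k i t - q k (W i t)) (q k (W i t))
    linarith [mul_le_mul_of_nonneg_left h2 hA0]

/-- The numerical flux may be replaced by the flux at the cell value: by consistency the difference
is controlled by jumps, and these vanish by weak BV. -/
theorem tendsto_integral_dx_mul_flux_sub (hφ : ContDiff ℝ 1 φ) (hs : HasCompactSupport φ)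
    (hQ : IsConsistentFlux Q q) (hh : ∀ l, 0 < h l)
    (hW : ∀ l i, Continuous (W l i)) (hC : ∀ l i t, ‖W l i t‖ ≤ C) {r : ℝ} (hr : 1 ≤ r)
    (hBV : ∀ T, 0 < T → ∀ k, Tendsto (fun l => jump (h l) r T (W l) (Pi.single k 1)) atTop (𝓝 0))
    (k : Fin d) :
    Tendsto (fun l => ∫ z, dx k φ z * (q k (W l (cellIndex (h l) z.1) z.2)
      - fluxAt Q (h l) (W l) k (cellIndex (h l) z.1) z.2) ∂(spaceTime d)) atTop (𝓝 0) := by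
  obtain ⟨R, hR0, hR⟩ := exists_radius hs
  obtain ⟨A, hA0, hA⟩ := abs_fluxAt_sub_le hQ C
  obtain ⟨D, hD⟩ := (hasCompactSupport_dx hs k).exists_bound_of_continuous (continuous_dx hφ k)
  have hD0 : 0 ≤ D := (norm_nonneg _).trans (hD 0)
  have hmeas : ∀ l (m : ℤ), Measurable fun z : Space d × ℝ =>
      W l (cellIndex (h l) z.1 + Pi.single k m) z.2 - W l (cellIndex (h l) z.1) z.2 := fun l m =>
    measurable_comp_cellIndex (h l) (Ψ := fun i t => W l (i + Pi.single k m) t - W l i t)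
      fun i => ((hW l _).sub (hW l i)).measurable
  have h1 : Tendsto (fun l => ENNReal.ofReal (D * A) * ∑ j : Fin (2 * p), ∫⁻ z,
      ‖W l (cellIndex (h l) z.1 + Pi.single k ((j : ℤ) - p + 1)) z.2
        - W l (cellIndex (h l) z.1) z.2‖ₑ ∂(ballMeasure d R)) atTop (𝓝 0) := by
    have h2 := tendsto_finsetSum (Finset.univ : Finset (Fin (2 * p))) fun j _ =>
      tendsto_lintegral_jump hr hh (fun l i => (hW l i).measurable) k (hBV R hR0 k)
        ((j : ℤ) - p + 1)
    have h3 := ENNReal.Tendsto.const_mul (a := ENNReal.ofReal (D * A)) h2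
      (Or.inr ENNReal.ofReal_ne_top)
    simpa using h3
  rw [tendsto_zero_iff_enorm_tendsto_zero]
  refine tendsto_of_tendsto_of_tendsto_of_le_of_le tendsto_const_nhds h1 (fun l => zero_le)
    fun l => ?_
  simp only
  rw [← setIntegral_eq_integral_of_forall_compl_eq_zero (s := Metric.closedBall 0 R) fun z hz => by
    have hz' : R < ‖z‖ := by simpa using hz
    simp [dx, (hR z hz').2]]
  refine (enorm_integral_le_lintegral_enorm _).trans ?_
  rw [← lintegral_finsetSum _ fun j _ => (hmeas l _).enorm,
    ← lintegral_const_mul' _ _ ENNReal.ofReal_ne_top]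
  refine lintegral_mono fun z => ?_
  have h4 : ‖dx k φ z * (q k (W l (cellIndex (h l) z.1) z.2)
      - fluxAt Q (h l) (W l) k (cellIndex (h l) z.1) z.2)‖
      ≤ (D * A) * ∑ j : Fin (2 * p), ‖W l (cellIndex (h l) z.1 + Pi.single k ((j : ℤ) - p + 1)) z.2
        - W l (cellIndex (h l) z.1) z.2‖ := by
    rw [norm_mul, mul_assoc]
    refine mul_le_mul (hD z) ?_ (norm_nonneg _) hD0
    rw [Real.norm_eq_abs, abs_sub_comm]
    exact hA (h l) (hh l) (W l) (hC l) k _ _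
  rw [← ofReal_norm]
  refine (ENNReal.ofReal_le_ofReal h4).trans_eq ?_
  rw [ENNReal.ofReal_mul (mul_nonneg hD0 hA0),
    ENNReal.ofReal_sum_of_nonneg fun _ _ => norm_nonneg _]
  simp only [ofReal_norm]

/-- Difference quotients of a test function may be replaced by derivatives. -/
theorem tendsto_integral_dx_sub_diffQuot_mul (hφ : ContDiff ℝ 1 φ) (hs : HasCompactSupport φ)
    (hh : ∀ l, 0 < h l) (hh0 : Tendsto h atTop (𝓝 0)) {G : ℕ → Space d × ℝ → ℝ} {B : ℝ}
    (hB : ∀ l z, |G l z| ≤ B) (k : Fin d) :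
    Tendsto (fun l => ∫ z, (dx k φ z - diffQuot (h l) k φ z) * G l z ∂(spaceTime d))
      atTop (𝓝 0) := by
  obtain ⟨R, hR0, hR⟩ := exists_radius hs
  have hB0 : 0 ≤ B := (abs_nonneg _).trans (hB 0 0)
  set m := (spaceTime d).real (Metric.closedBall 0 (R + 1)) with hm
  have hm0 : 0 ≤ m := measureReal_nonneg
  rw [Metric.tendsto_atTop]
  intro ε hε
  obtain ⟨δ, hδ, hδε⟩ := abs_diffQuot_sub_dx_le hφ hs k (ε := ε / (2 * (B * m + 1)))
    (by positivity)
  have hev : ∀ᶠ l in atTop, h l < min δ 1 := hh0.eventually_lt_const (by positivity)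
  obtain ⟨l₀, hl₀⟩ := eventually_atTop.1 hev
  refine ⟨l₀, fun l hl => ?_⟩
  have hlt := hl₀ l hl
  rw [dist_zero_right,
    ← setIntegral_eq_integral_of_forall_compl_eq_zero (s := Metric.closedBall 0 (R + 1))
      fun z hz => by
        have hz' : R + 1 < ‖z‖ := by simpa using hz
        rw [diffQuot_eq_zero (fun z hz => (hR z hz).1) (hh l).le
          (hlt.le.trans (min_le_right _ _)) k hz', dx, (hR z (by linarith)).2]
        simp]
  have hfin : (spaceTime d) (Metric.closedBall 0 (R + 1)) < ∞ :=
    (isCompact_closedBall (0 : Space d × ℝ) (R + 1)).measure_lt_top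
  refine (norm_setIntegral_le_of_norm_le_const hfin
    (C := ε / (2 * (B * m + 1)) * B) fun z _ => ?_).trans_lt ?_
  · rw [norm_mul]
    refine mul_le_mul ?_ (hB l z) (norm_nonneg _) (by positivity)
    rw [Real.norm_eq_abs, abs_sub_comm]
    exact hδε (h l) (hh l) (hlt.trans_le (min_le_left _ _)) z
  · rw [← hm, div_mul_eq_mul_div, div_mul_eq_mul_div, div_lt_iff₀ (by positivity)]
    nlinarith [mul_nonneg hB0 hm0]

/-- The left-hand side of the weak formulation for a deterministic function `w`. -/
def weakForm (η : Phase N → ℝ) (q : Fin d → Phase N → ℝ) (φ : Space d × ℝ → ℝ)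
    (w : Space d × ℝ → Phase N) : ℝ :=
  (∫ z, (dt φ z * η (w z) + ∑ k, dx k φ z * q k (w z)) ∂(spaceTime d))
    + ∫ x, φ (x, 0) * η (w (x, 0))

/-- A Lax–Wendroff estimate. Grid functions that satisfy a discrete entropy inequality (tested with
`φ`) and the weak BV bound satisfy the weak entropy inequality up to a vanishing error. -/
theorem exists_tendsto_zero_le_weakForm (hφ : ContDiff ℝ 1 φ) (hs : HasCompactSupport φ)
    {η : Phase N → ℝ} (hη : Continuous η)
    (hQ : IsConsistentFlux Q q) (hq : ∀ k, Continuous (q k)) (hh : ∀ l, 0 < h l)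
    (hh0 : Tendsto h atTop (𝓝 0))
    (hW : ∀ l i, Continuous (W l i)) (hC : ∀ l i t, ‖W l i t‖ ≤ C) {r : ℝ} (hr : 1 ≤ r)
    (hBV : ∀ T, 0 < T → ∀ k, Tendsto (fun l => jump (h l) r T (W l) (Pi.single k 1)) atTop (𝓝 0))
    (hineq : ∀ l x t, 0 < t → ∃ a', HasDerivAt (fun s => η (W l (cellIndex (h l) x) s)) a' t ∧
      φ (x, t) * (a' + fluxDifference Q (h l) (fun j => W l j t) (cellIndex (h l) x)) ≤ 0) :
    ∃ e : ℕ → ℝ, Tendsto e atTop (𝓝 0) ∧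
      ∀ l, e l ≤ weakForm η q φ fun z => W l (cellIndex (h l) z.1) z.2 := by
  obtain ⟨A, -, hA⟩ := exists_bound_on_ball hη C
  obtain ⟨B, -, hB⟩ := abs_fluxAt_le hQ hq C
  have hBl := fun l => hB (h l) (hh l) (W l) (hC l)
  have hGc := fun l k i => continuous_fluxAt hQ (hh l) (hW l) k i
  choose b hb0 hb using fun k => exists_bound_on_ball (hq k) C
  -- `e1` is the consistency error of the numerical flux, `e2` the error of the difference quotient
  let e1 : Fin d → ℕ → ℝ := fun k l => ∫ z, dx k φ z * (q k (W l (cellIndex (h l) z.1) z.2)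
      - fluxAt Q (h l) (W l) k (cellIndex (h l) z.1) z.2) ∂(spaceTime d)
  let e2 : Fin d → ℕ → ℝ := fun k l => ∫ z, (dx k φ z - diffQuot (h l) k φ z)
      * fluxAt Q (h l) (W l) k (cellIndex (h l) z.1) z.2 ∂(spaceTime d)
  refine ⟨fun l => ∑ k, (e1 k l + e2 k l), ?_, fun l => ?_⟩
  · have h1 := tendsto_finsetSum (Finset.univ : Finset (Fin d)) fun k _ =>
      (tendsto_integral_dx_mul_flux_sub hφ hs hQ hh hW hC hr hBV k).add
        (tendsto_integral_dx_sub_diffQuot_mul hφ hs hh hh0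
          (G := fun l z => fluxAt Q (h l) (W l) k (cellIndex (h l) z.1) z.2)
          (fun l z => hBl l k _ _) k)
    simpa using h1
  · have hdisc := discrete_weak_inequality (hh l) hφ hs (a := fun i t => η (W l i t))
      (fun i => hη.comp (hW l i)) (fun i t => hA _ (hC l i t))
      (G := fluxAt Q (h l) (W l)) (hGc l) (hBl l) (hineq l)
    have hmG : ∀ k, Measurable fun z : Space d × ℝ =>
        fluxAt Q (h l) (W l) k (cellIndex (h l) z.1) z.2 := fun k =>
      measurable_comp_cellIndex (h l) fun i => (hGc l k i).measurable
    have hmW : Measurable fun z : Space d × ℝ => W l (cellIndex (h l) z.1) z.2 :=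
      measurable_comp_cellIndex (h l) fun i => (hW l i).measurable
    have hi1 : Integrable (fun z => dt φ z * η (W l (cellIndex (h l) z.1) z.2)) (spaceTime d) :=
      integrable_mul_of_bound (continuous_dt hφ) (hasCompactSupport_dt hs)
        (hη.measurable.comp hmW) fun z => hA _ (hC l _ _)
    have hi2 : ∀ k, Integrable (fun z => dx k φ z * q k (W l (cellIndex (h l) z.1) z.2))
        (spaceTime d) := fun k =>
      integrable_mul_of_bound (continuous_dx hφ k) (hasCompactSupport_dx hs k)
        ((hq k).measurable.comp hmW) fun z => hb k _ (hC l _ _)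
    have hi3 : ∀ k, Integrable (fun z => dx k φ z
        * fluxAt Q (h l) (W l) k (cellIndex (h l) z.1) z.2) (spaceTime d) := fun k =>
      integrable_mul_of_bound (continuous_dx hφ k) (hasCompactSupport_dx hs k) (hmG k)
        fun z => hBl l k _ _
    have hi4 : ∀ k, Integrable (fun z => diffQuot (h l) k φ z
        * fluxAt Q (h l) (W l) k (cellIndex (h l) z.1) z.2) (spaceTime d) := fun k =>
      integrable_mul_of_bound (continuous_diffQuot hφ.continuous _ k)
        (hasCompactSupport_diffQuot hs _ k) (hmG k) fun z => hBl l k _ _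
    have he : ∀ k, e1 k l + e2 k l = (∫ z, dx k φ z * q k (W l (cellIndex (h l) z.1) z.2)
        ∂(spaceTime d)) - ∫ z, diffQuot (h l) k φ z
          * fluxAt Q (h l) (W l) k (cellIndex (h l) z.1) z.2 ∂(spaceTime d) := fun k => by
      simp only [e1, e2, mul_sub, sub_mul]
      rw [integral_sub (hi2 k) (hi3 k), integral_sub (hi3 k) (hi4 k)]
      ring
    rw [weakForm, integral_add hi1 (integrable_finsetSum _ fun k _ => hi2 k),
      integral_finsetSum _ fun k _ => hi2 k]
    simp only [he, Finset.sum_sub_distrib]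
    linarith

end Consistency

/-! ### Local integrability of Young measures -/

section LocallyIntegrable

variable {Z : Type*} [MeasurableSpace Z] {N : ℕ} {μ : Measure Z}
  {ν : Z → ProbabilityMeasure (Phase N)} {h : Phase N → ℝ}

theorem monotone_cutoff (ξ : Phase N) : Monotone fun n : ℕ => cutoff n ξ := by
  intro m n hmn
  have : (m : ℝ) ≤ n := by exact_mod_cast hmn
  exact max_le_max le_rfl (min_le_min le_rfl (by linarith))

theorem IsYoungMeasure.aemeasurable_lintegral (hν : IsYoungMeasure μ ν) (hc : Continuous h) :
    AEMeasurable (fun z => ∫⁻ ξ, ‖h ξ‖ₑ ∂(ν z : Measure (Phase N))) μ := by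
  have hpos : ∀ (n : ℕ) ξ, 0 ≤ truncate n (fun ξ => ‖h ξ‖) hc.norm ξ := fun n ξ =>
    mul_nonneg (le_max_left _ _) (norm_nonneg _)
  refine aemeasurable_of_tendsto_metrizable_ae (u := atTop) (f := fun (n : ℕ) z =>
    ∫⁻ ξ, ENNReal.ofReal (truncate n (fun ξ => ‖h ξ‖) hc.norm ξ) ∂(ν z : Measure (Phase N)))
    (fun n => ?_) (ae_of_all _ fun z => ?_)
  · have h1 := hν.aemeasurable_integral (truncate n (fun ξ => ‖h ξ‖) hc.norm).continuous
      (ae_of_all _ fun z => (truncate n (fun ξ => ‖h ξ‖) hc.norm).integrable _)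
    refine h1.ennreal_ofReal.congr (ae_of_all _ fun z => ?_)
    exact ofReal_integral_eq_lintegral_ofReal
      ((truncate n (fun ξ => ‖h ξ‖) hc.norm).integrable _) (ae_of_all _ (hpos n))
  · refine lintegral_tendsto_of_tendsto_of_monotone
      (fun n => (truncate n _ hc.norm).continuous.measurable.ennreal_ofReal.aemeasurable)
      (ae_of_all _ fun ξ m n hmn => ENNReal.ofReal_le_ofReal
        (mul_le_mul_of_nonneg_right (monotone_cutoff ξ hmn) (norm_nonneg _)))
      (ae_of_all _ fun ξ => ?_)
    refine tendsto_const_nhds.congr' ?_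
    obtain ⟨n, hn⟩ := exists_nat_ge ‖ξ‖
    filter_upwards [eventually_ge_atTop n] with m hm
    rw [truncate_of_norm_le _ _ (hn.trans (by exact_mod_cast hm)), ofReal_norm]

variable [TopologicalSpace Z]

theorem LocIntegrable.ae_integrable [SigmaCompactSpace Z] (hν : IsYoungMeasure μ ν)
    (hc : Continuous h) (hl : LocIntegrable μ ν h) :
    ∀ᵐ z ∂μ, Integrable h (ν z : Measure (Phase N)) := by
  have h1 : ∀ n, ∀ᵐ z ∂(μ.restrict (compactCovering Z n)),
      Integrable h (ν z : Measure (Phase N)) := fun n => by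
    filter_upwards [ae_lt_top' (hν.aemeasurable_lintegral hc).restrict
      (hl _ (isCompact_compactCovering Z n)).ne] with z hz
    exact ⟨hc.aestronglyMeasurable, hz⟩
  have h2 := (ae_restrict_iUnion_iff (fun n => compactCovering Z n) _).2 h1
  rwa [iUnion_compactCovering, Measure.restrict_univ] at h2

theorem LocIntegrable.integrable_mul [SigmaCompactSpace Z] [OpensMeasurableSpace Z] [T2Space Z]
    (hν : IsYoungMeasure μ ν) (hc : Continuous h)
    (hl : LocIntegrable μ ν h) {ψ : Z → ℝ} (hψ : Continuous ψ) (hs : HasCompactSupport ψ) :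
    Integrable (fun z => ψ z * ∫ ξ, h ξ ∂(ν z : Measure (Phase N))) μ := by
  refine ⟨hψ.measurable.aestronglyMeasurable.mul
    (hν.aemeasurable_integral hc (hl.ae_integrable hν hc)).aestronglyMeasurable, ?_⟩
  obtain ⟨D, hD⟩ := hs.exists_bound_of_continuous hψ
  have h1 : ∀ z, ‖ψ z * ∫ ξ, h ξ ∂(ν z : Measure (Phase N))‖ₑ
      ≤ (tsupport ψ).indicator (fun z => ENNReal.ofReal D *
        ∫⁻ ξ, ‖h ξ‖ₑ ∂(ν z : Measure (Phase N))) z := by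
    intro z
    by_cases hz : z ∈ tsupport ψ
    · rw [Set.indicator_of_mem hz, enorm_mul, ← ofReal_norm]
      exact mul_le_mul' (ENNReal.ofReal_le_ofReal (hD z)) (enorm_integral_le_lintegral_enorm _)
    · simp [image_eq_zero_of_notMem_tsupport hz]
  refine (lintegral_mono h1).trans_lt ?_
  rw [lintegral_indicator (isClosed_tsupport ψ).measurableSet,
    lintegral_const_mul' _ _ ENNReal.ofReal_ne_top]
  exact ENNReal.mul_lt_top ENNReal.ofReal_lt_top (hl _ hs.isCompact)

theorem locIntegrable_of_ae_norm_le [IsFiniteMeasureOnCompacts μ] {E : Type*}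
    [NormedAddCommGroup E] {C : ℝ} (hC : ∀ᵐ z ∂μ, ∀ᵐ ξ ∂(ν z : Measure (Phase N)), ‖ξ‖ ≤ C)
    {h : Phase N → E} (hc : Continuous h) : LocIntegrable μ ν h := by
  obtain ⟨B, -, hB⟩ := exists_bound_on_ball hc.norm C
  intro K hK
  calc ∫⁻ z in K, ∫⁻ ξ, ‖h ξ‖ₑ ∂(ν z : Measure (Phase N)) ∂μ
      ≤ ∫⁻ _ in K, ENNReal.ofReal B ∂μ := by
        refine lintegral_mono_ae ?_
        filter_upwards [ae_restrict_of_ae hC] with z hz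
        calc ∫⁻ ξ, ‖h ξ‖ₑ ∂(ν z : Measure (Phase N))
            ≤ ∫⁻ _, ENNReal.ofReal B ∂(ν z : Measure (Phase N)) := by
              refine lintegral_mono_ae ?_
              filter_upwards [hz] with ξ hξ
              rw [← ofReal_norm]
              exact ENNReal.ofReal_le_ofReal ((le_abs_self _).trans (hB ξ hξ))
          _ = ENNReal.ofReal B := by simp
    _ < ∞ := by
        rw [lintegral_const, Measure.restrict_apply_univ]
        exact ENNReal.mul_lt_top ENNReal.ofReal_lt_top hK.measure_lt_top

end LocallyIntegrable

/-! ### Passage to the limit -/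

section Limit

variable {d N p : ℕ} {F : ℝ → Fin d → (Fin (2 * p) → Phase N) → Phase N} {Δx₀ : ℝ}
  (S : ∀ l, NumericalEvolution F (meshWidth Δx₀ l))
  {Ω : Type*} [MeasurableSpace Ω] (P : Measure Ω) {u₀ : Ω → InitialData d N}

instance : NeZero (spaceTime d) := by
  refine ⟨fun h => ?_⟩
  have h1 : spaceTime d (Set.univ ×ˢ Set.univ) = 0 := by rw [h]; rfl
  rw [spaceTime_eq_prod, Measure.prod_prod] at h1
  have h2 : (volume : Measure (Space d)) = 0 := by simpa using h1
  exact NeZero.ne _ h2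

theorem norm_field_le {Ω : Type*} {u₀ : Ω → InitialData d N} {C : ℝ}
    (hC : ∀ l ω x t, 0 ≤ t → ‖approx S u₀ l ω (x, t)‖ ≤ C) (l : ℕ) (ω : Ω)
    (z : Space d × ℝ) : ‖field (S l) (u₀ ω) z‖ ≤ C := by
  simpa only [approx, field] using hC l ω z.1 (max z.2 0) (le_max_right _ _)

/-- The initial part of the weak formulation. -/
def traceObservable (ψ : Space d → ℝ) (g : Phase N →ᵇ ℝ) (l : ℕ) (v : InitialData d N) : ℝ :=
  ∫ x, ψ x * g (field (S l) v (x, 0))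

theorem measurable_traceObservable {ψ : Space d → ℝ} (hψ : Continuous ψ) (g : Phase N →ᵇ ℝ)
    (l : ℕ) : Measurable (traceObservable S ψ g l) := by
  have h : StronglyMeasurable fun y : InitialData d N × Space d =>
      ψ y.2 * g (field (S l) y.1 (y.2, 0)) :=
    ((hψ.measurable.comp measurable_snd).mul (g.continuous.measurable.comp
      ((measurable_field (S l)).comp
        (measurable_fst.prodMk (measurable_snd.prodMk measurable_const))))).stronglyMeasurable
  exact h.integral_prod_right'.measurable

theorem abs_traceObservable_le {ψ : Space d → ℝ} (hψ : Integrable ψ) (g : Phase N →ᵇ ℝ)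
    (l : ℕ) (v : InitialData d N) : |traceObservable S ψ g l v| ≤ (∫ x, ‖ψ x‖) * ‖g‖ := by
  rw [traceObservable, ← integral_mul_const, ← Real.norm_eq_abs]
  refine norm_integral_le_of_norm_le (hψ.norm.mul_const _) (ae_of_all _ fun x => ?_)
  rw [norm_mul]
  exact mul_le_mul_of_nonneg_left (g.norm_coe_le_norm _) (norm_nonneg _)

theorem integrable_trace [IsProbabilityMeasure P] (hu₀ : Measurable u₀) {ψ : Space d → ℝ}
    (hψ : Integrable ψ) (g : Phase N →ᵇ ℝ) (l : ℕ) :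
    Integrable fun x => ψ x * ∫ ξ, g ξ ∂(P.map fun ω => approx S u₀ l ω (x, 0)) := by
  have h1 : ∀ x, ∫ ξ, g ξ ∂(P.map fun ω => approx S u₀ l ω (x, 0))
      = ∫ ω, g (field (S l) (u₀ ω) (x, 0)) ∂P := fun x => by
    rw [integral_map (measurable_approx S hu₀ l le_rfl).aemeasurable
      g.continuous.aestronglyMeasurable]
    simp only [approx, field_of_nonneg (S l) _ (le_refl ((x, (0 : ℝ)) : Space d × ℝ).2)]
  simp only [h1]
  refine hψ.mul_bdd (c := ‖g‖) ?_ (ae_of_all _ fun z => ?_)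
  · have h2 : Measurable fun y : Space d × Ω => g (field (S l) (u₀ y.2) (y.1, 0)) :=
      g.continuous.measurable.comp ((measurable_field (S l)).comp
        ((hu₀.comp measurable_snd).prodMk (measurable_fst.prodMk measurable_const)))
    exact h2.stronglyMeasurable.integral_prod_right'.aestronglyMeasurable
  · exact (norm_integral_le_of_norm_le_const (ae_of_all _ fun ω => g.norm_coe_le_norm _)).trans
      (by simp)

theorem integral_traceObservable [IsProbabilityMeasure P] (hu₀ : Measurable u₀)
    {ψ : Space d → ℝ} (hψ : Integrable ψ) (g : Phase N →ᵇ ℝ) (l : ℕ) :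
    ∫ ω, traceObservable S ψ g l (u₀ ω) ∂P
      = ∫ x, ψ x * ∫ ξ, g ξ ∂(P.map fun ω => approx S u₀ l ω (x, 0)) := by
  have h1 : ∀ x, ∫ ξ, g ξ ∂(P.map fun ω => approx S u₀ l ω (x, 0))
      = ∫ ω, g (field (S l) (u₀ ω) (x, 0)) ∂P := fun x => by
    rw [integral_map (measurable_approx S hu₀ l le_rfl).aemeasurable
      g.continuous.aestronglyMeasurable]
    simp only [approx, field_of_nonneg (S l) _ (le_refl ((x, (0 : ℝ)) : Space d × ℝ).2)]
  simp only [h1, ← integral_const_mul]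
  rw [integral_integral_swap]
  · rfl
  · have h2 : Measurable fun y : Space d × Ω => g (field (S l) (u₀ y.2) (y.1, 0)) :=
      g.continuous.measurable.comp ((measurable_field (S l)).comp
        ((hu₀.comp measurable_snd).prodMk (measurable_fst.prodMk measurable_const)))
    exact (hψ.comp_fst P).mul_bdd (c := ‖g‖) h2.aestronglyMeasurable
      (ae_of_all _ fun y => g.norm_coe_le_norm _)

theorem integral_truncate_trace (hu₀ : Measurable u₀) {C : ℝ}
    (hC : ∀ l ω x t, 0 ≤ t → ‖approx S u₀ l ω (x, t)‖ ≤ C) {η : Phase N → ℝ} (hη : Continuous η)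
    (l : ℕ) (x : Space d) :
    ∫ ξ, truncate C η hη ξ ∂(P.map fun ω => approx S u₀ l ω (x, 0))
      = ∫ ξ, η ξ ∂(P.map fun ω => approx S u₀ l ω (x, 0)) := by
  have hm := (measurable_approx S hu₀ l (z := (x, 0)) le_rfl).aemeasurable (μ := P)
  rw [integral_map hm (truncate C η hη).continuous.aestronglyMeasurable,
    integral_map hm hη.aestronglyMeasurable]
  simp only [truncate_of_norm_le _ _ (hC l _ x 0 le_rfl)]

variable {φ : Space d × ℝ → ℝ} {η : Phase N → ℝ} {q : Fin d → Phase N → ℝ} {C : ℝ}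

/-- As the solutions are bounded by `C`, the weak form is a sum of pairings with bounded
functions. -/
theorem weakForm_field_eq {Ω : Type*} {u₀ : Ω → InitialData d N} (hφ : ContDiff ℝ 1 φ)
    (hs : HasCompactSupport φ) (hη : Continuous η)
    (hq : ∀ k, Continuous (q k)) (hC : ∀ l ω x t, 0 ≤ t → ‖approx S u₀ l ω (x, t)‖ ≤ C)
    (l : ℕ) (ω : Ω) :
    weakForm η q φ (field (S l) (u₀ ω))
      = observable S (dt φ) (truncate C η hη) l (u₀ ω)
        + ∑ k, observable S (dx k φ) (truncate C (q k) (hq k)) l (u₀ ω)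
        + traceObservable S (fun x => φ (x, 0)) (truncate C η hη) l (u₀ ω) := by
  have hb := norm_field_le S hC l ω
  have h1 := integrable_observable S ((continuous_dt hφ).integrable_of_hasCompactSupport
    (μ := spaceTime d) (hasCompactSupport_dt hs)) (truncate C η hη) l (u₀ ω)
  have h2 := fun k => integrable_observable S ((continuous_dx hφ k).integrable_of_hasCompactSupport
    (μ := spaceTime d) (hasCompactSupport_dx hs k)) (truncate C (q k) (hq k)) l (u₀ ω)
  simp only [observable, traceObservable, weakForm]
  rw [← integral_finsetSum _ fun k _ => h2 k,
    ← integral_add h1 (integrable_finsetSum _ fun k _ => h2 k)]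
  simp only [truncate_of_norm_le _ _ (hb _)]

/-- In the mean, the weak entropy inequality holds up to a vanishing error. -/
theorem eventually_neg_le_integral_weakForm [IsProbabilityMeasure P] (hu₀ : Measurable u₀)
    (hφ : ContDiff ℝ 1 φ) (hs : HasCompactSupport φ) (hη : Continuous η)
    (hq : ∀ k, Continuous (q k)) (hC : ∀ l ω x t, 0 ≤ t → ‖approx S u₀ l ω (x, t)‖ ≤ C)
    (hsample : ∀ ω, ∃ e : ℕ → ℝ, Tendsto e atTop (𝓝 0) ∧
      ∀ l, e l ≤ weakForm η q φ (field (S l) (u₀ ω))) {ε : ℝ} (hε : 0 < ε) :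
    ∀ᶠ l in atTop, -ε ≤ ∫ ω, weakForm η q φ (field (S l) (u₀ ω)) ∂P := by
  have hi1 := (continuous_dt hφ).integrable_of_hasCompactSupport
    (μ := spaceTime d) (hasCompactSupport_dt hs)
  have hi2 := fun k => (continuous_dx hφ k).integrable_of_hasCompactSupport
    (μ := spaceTime d) (hasCompactSupport_dx hs k)
  have hc0 : Continuous fun x : Space d => φ (x, 0) := hφ.continuous.comp (by fun_prop)
  have hi3 := hc0.integrable_of_hasCompactSupport (μ := volume) (hasCompactSupport_trace hs)
  have hmeas : ∀ l, Measurable fun ω => weakForm η q φ (field (S l) (u₀ ω)) := fun l => by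
    simp only [weakForm_field_eq S hφ hs hη hq hC]
    exact (((measurable_observable S hi1 _ l).comp hu₀).add
      (Finset.measurable_fun_sum _ fun k _ => (measurable_observable S (hi2 k) _ l).comp hu₀)).add
      ((measurable_traceObservable S hc0 _ l).comp hu₀)
  obtain ⟨B, hB⟩ : ∃ B, ∀ l ω, |weakForm η q φ (field (S l) (u₀ ω))| ≤ B := by
    refine ⟨(∫ z, ‖dt φ z‖ ∂(spaceTime d)) * ‖truncate C η hη‖
      + ∑ k, (∫ z, ‖dx k φ z‖ ∂(spaceTime d)) * ‖truncate C (q k) (hq k)‖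
      + (∫ x, ‖φ (x, 0)‖) * ‖truncate C η hη‖, fun l ω => ?_⟩
    rw [weakForm_field_eq S hφ hs hη hq hC]
    refine (abs_add_le _ _).trans (add_le_add ((abs_add_le _ _).trans (add_le_add
      (abs_observable_le S hi1 _ l _) ((Finset.abs_sum_le_sum_abs _ _).trans
        (Finset.sum_le_sum fun k _ => abs_observable_le S (hi2 k) _ l _))))
      (abs_traceObservable_le S hi3 _ l _))
  have hint : ∀ l, Integrable (fun ω => weakForm η q φ (field (S l) (u₀ ω))) P := fun l =>
    Integrable.of_bound (hmeas l).aestronglyMeasurable B (ae_of_all _ (hB l))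
  -- the negative parts tend to zero
  have hneg : Tendsto (fun l => ∫ ω, min (weakForm η q φ (field (S l) (u₀ ω))) 0 ∂P) atTop
      (𝓝 (∫ _, (0 : ℝ) ∂P)) := by
    refine tendsto_integral_of_dominated_convergence (fun _ => B)
      (fun l => ((hmeas l).min measurable_const).aestronglyMeasurable) (integrable_const _)
      (fun l => ae_of_all _ fun ω => ?_) (ae_of_all _ fun ω => ?_)
    · have := hB l ω
      rw [Real.norm_eq_abs]
      refine le_trans ?_ this
      rcases le_total (weakForm η q φ (field (S l) (u₀ ω))) 0 with h | h
      · rw [min_eq_left h]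
      · rw [min_eq_right h, abs_zero]; exact abs_nonneg _
    · obtain ⟨e, he, hle⟩ := hsample ω
      have he' := he.min (tendsto_const_nhds (x := (0 : ℝ)))
      rw [min_self] at he'
      exact tendsto_of_tendsto_of_tendsto_of_le_of_le he' tendsto_const_nhds
        (fun l => min_le_min (hle l) le_rfl) fun l => min_le_right _ _
  rw [integral_zero] at hneg
  filter_upwards [hneg.eventually_const_lt (by linarith : -ε < 0)] with l hl
  refine hl.le.trans (integral_mono ?_ (hint l) fun ω => min_le_left _ _)
  exact (hint l).inf (integrable_zero _ _ _)

/-- The weak form of the entropy inequality for a Young measure `ν` with initial data `σ`. -/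
def youngForm (η : Phase N → ℝ) (q : Fin d → Phase N → ℝ) (φ : Space d × ℝ → ℝ)
    (σ : Space d → ProbabilityMeasure (Phase N))
    (ν : Space d × ℝ → ProbabilityMeasure (Phase N)) : ℝ :=
  (∫ z, (dt φ z * (∫ ξ, η ξ ∂(ν z : Measure (Phase N)))
      + ∑ k, dx k φ z * (∫ ξ, q k ξ ∂(ν z : Measure (Phase N)))) ∂(spaceTime d))
    + ∫ x, φ (x, 0) * (∫ ξ, η ξ ∂(σ x : Measure (Phase N)))

theorem ae_integral_truncate_eq {ν : Space d × ℝ → ProbabilityMeasure (Phase N)}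
    (hνC : ∀ᵐ z ∂(spaceTime d), ∀ᵐ ξ ∂(ν z : Measure (Phase N)), ‖ξ‖ ≤ C)
    {h : Phase N → ℝ} (hc : Continuous h) :
    ∀ᵐ z ∂(spaceTime d), ∫ ξ, truncate C h hc ξ ∂(ν z : Measure (Phase N))
      = ∫ ξ, h ξ ∂(ν z : Measure (Phase N)) := by
  filter_upwards [hνC] with z hz
  refine integral_congr_ae ?_
  filter_upwards [hz] with ξ hξ
  exact truncate_of_norm_le h hc hξ

/-- The limit of approximate solutions in the sense of Young measures satisfies the weak entropy
inequality. -/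
theorem youngForm_nonneg [IsProbabilityMeasure P] (hu₀ : Measurable u₀)
    (hφ : ContDiff ℝ 1 φ) (hs : HasCompactSupport φ) (hη : Continuous η)
    (hq : ∀ k, Continuous (q k)) (hC : ∀ l ω x t, 0 ≤ t → ‖approx S u₀ l ω (x, t)‖ ≤ C)
    (hsample : ∀ ω, ∃ e : ℕ → ℝ, Tendsto e atTop (𝓝 0) ∧
      ∀ l, e l ≤ weakForm η q φ (field (S l) (u₀ ω)))
    {σ : Space d → ProbabilityMeasure (Phase N)} (hσ : IsYoungMeasure volume σ)
    (hσl : LocIntegrable volume σ η)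
    (hinit : ∀ ε : ℝ, 0 < ε → ∀ᶠ l in atTop,
      ∫ x, φ (x, 0) * ((∫ ξ, η ξ ∂(P.map fun ω => approx S u₀ l ω (x, 0)))
        - ∫ ξ, η ξ ∂(σ x : Measure (Phase N))) ≤ ε)
    {ν : Space d × ℝ → ProbabilityMeasure (Phase N)} (hν : IsYoungMeasure (spaceTime d) ν)
    (hνC : ∀ᵐ z ∂(spaceTime d), ∀ᵐ ξ ∂(ν z : Measure (Phase N)), ‖ξ‖ ≤ C)
    {χ : ℕ → ℕ} (hχ : StrictMono χ)
    (hlim : TendstoNarrowly (spaceTime d) (fun n => lawOf P (approx S u₀ (χ n))) (signed ν)) :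
    0 ≤ youngForm η q φ σ ν := by
  have hi1 := (continuous_dt hφ).integrable_of_hasCompactSupport
    (μ := spaceTime d) (hasCompactSupport_dt hs)
  have hi2 := fun k => (continuous_dx hφ k).integrable_of_hasCompactSupport
    (μ := spaceTime d) (hasCompactSupport_dx hs k)
  have hc0 : Continuous fun x : Space d => φ (x, 0) := hφ.continuous.comp (by fun_prop)
  have hi3 := hc0.integrable_of_hasCompactSupport (μ := volume) (hasCompactSupport_trace hs)
  have hobs : ∀ {ψ : Space d × ℝ → ℝ}, Integrable ψ (spaceTime d) → ∀ (g : Phase N →ᵇ ℝ) l,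
      Integrable (fun ω => observable S ψ g l (u₀ ω)) P := fun hψ g l =>
    Integrable.of_bound ((measurable_observable S hψ g l).comp hu₀).aestronglyMeasurable _
      (ae_of_all _ fun ω => abs_observable_le S hψ g l (u₀ ω))
  have hobs0 : ∀ l, Integrable (fun ω => traceObservable S (fun x => φ (x, 0))
      (truncate C η hη) l (u₀ ω)) P := fun l =>
    Integrable.of_bound ((measurable_traceObservable S hc0 _ l).comp hu₀).aestronglyMeasurable _
      (ae_of_all _ fun ω => abs_traceObservable_le S hi3 _ l (u₀ ω))
  have hmean : ∀ l, ∫ ω, weakForm η q φ (field (S l) (u₀ ω)) ∂P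
      = pairing (spaceTime d) (dt φ) (lawOf P (approx S u₀ l)) (truncate C η hη)
        + ∑ k, pairing (spaceTime d) (dx k φ) (lawOf P (approx S u₀ l)) (truncate C (q k) (hq k))
        + ∫ x, φ (x, 0) * ∫ ξ, η ξ ∂(P.map fun ω => approx S u₀ l ω (x, 0)) := fun l => by
    simp only [weakForm_field_eq S hφ hs hη hq hC]
    rw [integral_add ((hobs hi1 _ l).fun_add (integrable_finsetSum _ fun k _ => hobs (hi2 k) _ l))
      (hobs0 l), integral_add (hobs hi1 _ l) (integrable_finsetSum _ fun k _ => hobs (hi2 k) _ l),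
      integral_finsetSum _ fun k _ => hobs (hi2 k) _ l, pairing_lawOf S P hu₀ l hi1]
    simp only [pairing_lawOf S P hu₀ l (hi2 _)]
    rw [integral_traceObservable S P hu₀ hi3]
    simp only [integral_truncate_trace S P hu₀ hC hη]
  have hJl : ∀ l, ∫ x, φ (x, 0) * ((∫ ξ, η ξ ∂(P.map fun ω => approx S u₀ l ω (x, 0)))
        - ∫ ξ, η ξ ∂(σ x : Measure (Phase N)))
      = (∫ x, φ (x, 0) * ∫ ξ, η ξ ∂(P.map fun ω => approx S u₀ l ω (x, 0)))
        - ∫ x, φ (x, 0) * ∫ ξ, η ξ ∂(σ x : Measure (Phase N)) := fun l => by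
    have h1 := integrable_trace S P hu₀ hi3 (truncate C η hη) l
    simp only [integral_truncate_trace S P hu₀ hC hη] at h1
    rw [← integral_sub h1 (hσl.integrable_mul hσ hη hc0 (hasCompactSupport_trace hs))]
    simp only [mul_sub]
  have hA := ((hlim (dt φ) hi1 (truncate C η hη)).add
    (tendsto_finsetSum (Finset.univ : Finset (Fin d)) fun k _ =>
      hlim (dx k φ) (hi2 k) (truncate C (q k) (hq k))))
  have hν1 : pairing (spaceTime d) (dt φ) (signed ν) (truncate C η hη)
      + ∑ k, pairing (spaceTime d) (dx k φ) (signed ν) (truncate C (q k) (hq k))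
      = ∫ z, (dt φ z * (∫ ξ, η ξ ∂(ν z : Measure (Phase N)))
        + ∑ k, dx k φ z * (∫ ξ, q k ξ ∂(ν z : Measure (Phase N)))) ∂(spaceTime d) := by
    simp only [pairing, integral_signed]
    rw [← integral_finsetSum _ fun k _ => integrable_mul_integral_signed hν (hi2 k) _,
      ← integral_add (integrable_mul_integral_signed hν hi1 _)
        (integrable_finsetSum _ fun k _ => integrable_mul_integral_signed hν (hi2 k) _)]
    refine integral_congr_ae ?_
    filter_upwards [ae_integral_truncate_eq hνC hη,
      ae_all_iff.2 fun k => ae_integral_truncate_eq hνC (hq k)] with z h1 h2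
    simp only [h1, h2]
  rw [hν1] at hA
  refine le_of_forall_pos_le_add fun ε hε => ?_
  have hev : ∀ᶠ n in atTop, -ε - (∫ x, φ (x, 0) * ∫ ξ, η ξ ∂(σ x : Measure (Phase N)))
      ≤ pairing (spaceTime d) (dt φ) (lawOf P (approx S u₀ (χ n))) (truncate C η hη)
        + ∑ k, pairing (spaceTime d) (dx k φ) (lawOf P (approx S u₀ (χ n)))
          (truncate C (q k) (hq k)) := by
    filter_upwards [hχ.tendsto_atTop.eventually (hinit (ε / 2) (by positivity)),
      hχ.tendsto_atTop.eventually (eventually_neg_le_integral_weakForm S P hu₀ hφ hs hη hq hC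
        hsample (ε := ε / 2) (by positivity))] with n h1 h2
    rw [hmean] at h2
    rw [hJl] at h1
    linarith
  have h := ge_of_tendsto hA hev
  rw [youngForm]
  linarith

end Limit

/-! ### Sample paths of the scheme -/

section Paths

variable {d N p : ℕ} {F : ℝ → Fin d → (Fin (2 * p) → Phase N) → Phase N} {Δx₀ : ℝ}

theorem meshWidth_pos (h : 0 < Δx₀) (l : ℕ) : 0 < meshWidth Δx₀ l := by
  unfold meshWidth; positivity

theorem tendsto_meshWidth : Tendsto (meshWidth Δx₀) atTop (𝓝 0) :=
  tendsto_const_nhds.div_atTop (tendsto_pow_atTop_atTop_of_one_lt (by norm_num))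

theorem cells_of_nonneg {Δx : ℝ} (T : NumericalEvolution F Δx) (v : InitialData d N)
    (i : Fin d → ℤ) {t : ℝ} (ht : 0 ≤ t) : cells T v i t = T.evolve v (midpoint Δx i) t := by
  rw [cells, max_eq_left ht]

theorem hasDerivAt_cells {Δx : ℝ} (T : NumericalEvolution F Δx) (v : InitialData d N)
    (i : Fin d → ℤ) {t : ℝ} (ht : 0 < t) :
    HasDerivAt (cells T v i) (-fluxDifference F Δx (fun j => cells T v j t) i) t := by
  have h1 := (T.ode v i t ht.le).hasDerivAt (Ici_mem_nhds ht)
  simp only [cells_of_nonneg T v _ ht.le]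
  refine h1.congr_of_eventuallyEq ?_
  filter_upwards [eventually_gt_nhds ht] with s hs
  exact cells_of_nonneg T v i hs.le

variable (S : ∀ l, NumericalEvolution F (meshWidth Δx₀ l)) {Ω : Type*} [MeasurableSpace Ω]
  {P : Measure Ω} {f : Fin d → Phase N → Phase N} {σ : Space d → ProbabilityMeasure (Phase N)}
  {u₀ : Ω → InitialData d N}

theorem cellValue_eq_cells {Ω : Type*} {u₀ : Ω → InitialData d N} (l : ℕ) (ω : Ω)
    {t : ℝ} (ht : 0 ≤ t) (i : Fin d → ℤ) :
    cellValue S u₀ l ω t i = cells (S l) (u₀ ω) i t := by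
  rw [cells_of_nonneg _ _ _ ht, cellValue, approx]

/-- The weak BV bound, one coordinate direction at a time. -/
theorem SchemeRequirements.exists_tendsto_jump (hreq : SchemeRequirements P f S σ u₀) :
    ∃ r : ℝ, 1 ≤ r ∧ ∀ ω T, 0 < T → ∀ k, Tendsto (fun l =>
      jump (meshWidth Δx₀ l) r T (cells (S l) (u₀ ω)) (Pi.single k 1)) atTop (𝓝 0) := by
  obtain ⟨r, hr, h⟩ := hreq.weakBV
  refine ⟨r, hr, fun ω T hT k => tendsto_of_tendsto_of_tendsto_of_le_of_le tendsto_const_nhds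
    (h ω T hT) (fun l => zero_le) fun l => ?_⟩
  have hsum : ∀ (g : (Fin d → ℤ) → Fin d → ℝ≥0∞), ∑' i, g i k ≤ ∑' i, ∑ k, g i k := fun g =>
    ENNReal.tsum_le_tsum fun i =>
      Finset.single_le_sum (f := g i) (fun _ _ => zero_le) (Finset.mem_univ k)
  have hle : ∀ t ∈ Set.Icc 0 T, ∑' i : Fin d → ℤ, ‖cells (S l) (u₀ ω) (i + Pi.single k 1) t
      - cells (S l) (u₀ ω) i t‖ₑ ^ r * ENNReal.ofReal (meshWidth Δx₀ l ^ d)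
      ≤ ∑' i : Fin d → ℤ, ∑ k : Fin d, ‖cellValue S u₀ l ω t (i + Pi.single k 1)
        - cellValue S u₀ l ω t i‖ₑ ^ r * ENNReal.ofReal (meshWidth Δx₀ l ^ d) := by
    intro t ht
    have h1 := hsum fun i k => ‖cellValue S u₀ l ω t (i + Pi.single k 1)
        - cellValue S u₀ l ω t i‖ₑ ^ r * ENNReal.ofReal (meshWidth Δx₀ l ^ d)
    rw [funext (cellValue_eq_cells S l ω ht.1)] at h1 ⊢
    exact h1
  have h3 := setLIntegral_mono' (μ := volume) measurableSet_Icc hle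
  simpa only [jump] using h3

/-- Every sample path satisfies the weak form of a discrete inequality up to a vanishing error. -/
theorem SchemeRequirements.exists_le_weakForm (hΔx₀ : 0 < Δx₀)
    (hreq : SchemeRequirements P f S σ u₀) {φ : Space d × ℝ → ℝ}
    (hφ : ContDiff ℝ 1 φ) (hs : HasCompactSupport φ) {p' : ℕ}
    {Q : ℝ → Fin d → (Fin (2 * p') → Phase N) → ℝ} {q : Fin d → Phase N → ℝ} {η : Phase N → ℝ}
    (hη : Continuous η) (hQ : IsConsistentFlux Q q) (hq : ∀ k, Continuous (q k))
    (hineq : ∀ l ω i x t, 0 < t → ∃ a', HasDerivAt (fun s => η (cells (S l) (u₀ ω) i s)) a' t ∧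
      φ (x, t) * (a' + fluxDifference Q (meshWidth Δx₀ l)
        (fun j => cells (S l) (u₀ ω) j t) i) ≤ 0) (ω : Ω) :
    ∃ e : ℕ → ℝ, Tendsto e atTop (𝓝 0) ∧
      ∀ l, e l ≤ weakForm η q φ (field (S l) (u₀ ω)) := by
  obtain ⟨C, hC⟩ := hreq.uniformlyBounded
  obtain ⟨r, hr, hBV⟩ := hreq.exists_tendsto_jump S
  obtain ⟨e, he, hle⟩ := exists_tendsto_zero_le_weakForm (h := meshWidth Δx₀)
    (W := fun l => cells (S l) (u₀ ω)) (C := C) hφ hs hη hQ hq (meshWidth_pos hΔx₀)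
    tendsto_meshWidth (fun l i => continuous_cells _ _ _)
    (fun l i t => by simpa only [approx, cells] using hC l ω _ (max t 0) (le_max_right _ _)) hr
    (hBV ω) (fun l x t ht => hineq l ω _ x t ht)
  refine ⟨e, he, fun l => (hle l).trans_eq ?_⟩
  rw [funext (field_eq_cells (S l) (u₀ ω))]

/-- The coordinates of a consistent flux. -/
theorem IsConsistentFlux.coord (hF : IsConsistentFlux F f) (j : Fin N) :
    IsConsistentFlux (fun Δx k w => F Δx k w j) (fun k ξ => f k ξ j) where
  locallyLipschitz Δx h k :=
    (EuclideanSpace.proj (𝕜 := ℝ) j).lipschitz.locallyLipschitz.comp (hF.locallyLipschitz Δx h k)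
  consistent K hK := by
    obtain ⟨C, hC⟩ := hF.consistent K hK
    refine ⟨C, fun Δx h k w i hw => le_trans ?_ (hC Δx h k w i hw)⟩
    exact PiLp.norm_apply_le (F Δx k (stencil p k w i) - f k (w i)) j

theorem fluxDifference_coord (Δx : ℝ) (w : (Fin d → ℤ) → Phase N) (i : Fin d → ℤ) (j : Fin N) :
    fluxDifference (fun Δx k w => F Δx k w j) Δx w i = fluxDifference F Δx w i j := by
  simp [fluxDifference]

/-- The cell values solve the scheme, coordinate by coordinate. -/
theorem hasDerivAt_cells_coord {Ω : Type*} {u₀ : Ω → InitialData d N} (l : ℕ) (ω : Ω)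
    (i : Fin d → ℤ) (j : Fin N) {t : ℝ} (ht : 0 < t) :
    ∃ a', HasDerivAt (fun s => cells (S l) (u₀ ω) i s j) a' t ∧
      a' + fluxDifference (fun Δx k w => F Δx k w j) (meshWidth Δx₀ l)
        (fun j => cells (S l) (u₀ ω) j t) i = 0 := by
  have h := hasDerivAt_cells (S l) (u₀ ω) i ht
  refine ⟨_, (EuclideanSpace.proj (𝕜 := ℝ) j).hasFDerivAt.comp_hasDerivAt t h, ?_⟩
  rw [fluxDifference_coord]
  simp

theorem SchemeRequirements.entropy_cells (hreq : SchemeRequirements P f S σ u₀) {η : Phase N → ℝ}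
    {q : Fin d → Phase N → ℝ} (hpair : IsEntropyPair f η q) :
    ∃ (p' : ℕ) (Q : ℝ → Fin d → (Fin (2 * p') → Phase N) → ℝ), IsConsistentFlux Q q ∧
      ∀ l ω i t, 0 < t → ∃ a', HasDerivAt (fun s => η (cells (S l) (u₀ ω) i s)) a' t ∧
        a' + fluxDifference Q (meshWidth Δx₀ l) (fun j => cells (S l) (u₀ ω) j t) i ≤ 0 := by
  obtain ⟨p', Q, hQ, h⟩ := hreq.entropyStable η q hpair
  refine ⟨p', Q, hQ, fun l ω i t ht => ?_⟩
  have h1 := (hpair.differentiable _).hasFDerivAt.comp_hasDerivAt t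
    (hasDerivAt_cells (S l) (u₀ ω) i ht)
  refine ⟨_, h1, ?_⟩
  have h2 : (fun s => η (cellValue S u₀ l ω s i)) =ᶠ[𝓝 t] η ∘ cells (S l) (u₀ ω) i := by
    filter_upwards [eventually_gt_nhds ht] with s hs
    rw [cellValue_eq_cells S l ω hs.le, Function.comp_apply]
  have h3 := h l ω i t ht
  rw [h2.deriv_eq, h1.deriv, funext (cellValue_eq_cells S l ω ht.le)] at h3
  exact h3

end Paths

/-! ### Coordinates of vector-valued integrals -/

section Coordinates

variable {d N : ℕ}

theorem contDiff_coord {E : Type*} [NormedAddCommGroup E] [NormedSpace ℝ E] {φ : E → Phase N}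
    (hφ : ContDiff ℝ 1 φ) (j : Fin N) : ContDiff ℝ 1 fun z => φ z j :=
  (EuclideanSpace.proj (𝕜 := ℝ) j).contDiff.comp hφ

theorem hasCompactSupport_coord {E : Type*} [TopologicalSpace E] {φ : E → Phase N}
    (hs : HasCompactSupport φ) (j : Fin N) : HasCompactSupport fun z => φ z j :=
  hs.comp_left (g := fun ξ : Phase N => ξ j) rfl

theorem fderiv_coord {φ : Space d × ℝ → Phase N} (hφ : ContDiff ℝ 1 φ) (j : Fin N)
    (z v : Space d × ℝ) : fderiv ℝ (fun z => φ z j) z v = fderiv ℝ φ z v j := by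
  have h := (EuclideanSpace.proj (𝕜 := ℝ) j).hasFDerivAt.comp z
    (hφ.differentiable one_ne_zero z).hasFDerivAt
  have h2 := h.fderiv
  have h3 : (EuclideanSpace.proj (𝕜 := ℝ) j) ∘ φ = fun z => φ z j := rfl
  rw [h3] at h2
  rw [h2]
  rfl

theorem inner_eq_sum (a b : Phase N) : inner ℝ a b = ∑ j, a j * b j := by
  simp [PiLp.inner_apply, mul_comm]

theorem integrable_coord_of_ae_norm_le {m : Measure (Phase N)} [IsFiniteMeasure m] {C : ℝ}
    (hm : ∀ᵐ ξ ∂m, ‖ξ‖ ≤ C) {h : Phase N → ℝ} (hc : Continuous h) : Integrable h m := by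
  obtain ⟨B, -, hB⟩ := exists_bound_on_ball hc C
  refine Integrable.of_bound hc.aestronglyMeasurable B ?_
  filter_upwards [hm] with ξ hξ using hB ξ hξ

theorem continuous_coord (j : Fin N) : Continuous fun ξ : Phase N => ξ j :=
  (EuclideanSpace.proj (𝕜 := ℝ) j).continuous

theorem LocIntegrable.coord {Z : Type*} [MeasurableSpace Z] [TopologicalSpace Z] {μ : Measure Z}
    {ν : Z → ProbabilityMeasure (Phase N)} (hl : LocIntegrable μ ν id) (j : Fin N) :
    LocIntegrable μ ν fun ξ : Phase N => ξ j := fun K hK =>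
  (lintegral_mono fun z => lintegral_mono fun ξ => by
    rw [← ofReal_norm, ← ofReal_norm]
    exact ENNReal.ofReal_le_ofReal (PiLp.norm_apply_le ξ j)).trans_lt (hl K hK)

end Coordinates

/-! ### The limit is an entropy measure valued solution -/

section Main

variable {d N p : ℕ} {F : ℝ → Fin d → (Fin (2 * p) → Phase N) → Phase N} {Δx₀ : ℝ}
  {S : ∀ l, NumericalEvolution F (meshWidth Δx₀ l)} {Ω : Type*} [MeasurableSpace Ω]
  {P : Measure Ω} {f : Fin d → Phase N → Phase N} {σ : Space d → ProbabilityMeasure (Phase N)}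
  {u₀ : Ω → InitialData d N} {ν : Space d × ℝ → ProbabilityMeasure (Phase N)} {C : ℝ}

theorem youngForm_neg (η : Phase N → ℝ) (q : Fin d → Phase N → ℝ) (φ : Space d × ℝ → ℝ) :
    youngForm η q (fun z => -φ z) σ ν = -youngForm η q φ σ ν := by
  have h1 : ∀ z, fderiv ℝ (fun z => -φ z) z = -fderiv ℝ φ z := fun z => fderiv_fun_neg
  simp only [youngForm, dt, dx, h1, _root_.neg_apply, neg_mul, Finset.sum_neg_distrib,
    ← neg_add, integral_neg]

theorem integrable_mul_integral_of_ae_norm_le (hν : IsYoungMeasure (spaceTime d) ν)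
    (hνC : ∀ᵐ z ∂(spaceTime d), ∀ᵐ ξ ∂(ν z : Measure (Phase N)), ‖ξ‖ ≤ C)
    {h : Phase N → ℝ} (hc : Continuous h) {ψ : Space d × ℝ → ℝ}
    (hψ : Integrable ψ (spaceTime d)) :
    Integrable (fun z => ψ z * ∫ ξ, h ξ ∂(ν z : Measure (Phase N))) (spaceTime d) := by
  refine (integrable_mul_integral_signed hν hψ (truncate C h hc)).congr ?_
  filter_upwards [ae_integral_truncate_eq hνC hc] with z hz
  rw [hz]

/-- The vectorial weak formulation is the sum of the scalar ones over the coordinates. -/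
theorem weak_eq_sum_youngForm (hf : ∀ k, Continuous (f k)) (hσ : IsYoungMeasure volume σ)
    (hσl : LocIntegrable volume σ id) (hν : IsYoungMeasure (spaceTime d) ν)
    (hνC : ∀ᵐ z ∂(spaceTime d), ∀ᵐ ξ ∂(ν z : Measure (Phase N)), ‖ξ‖ ≤ C)
    {φ : Space d × ℝ → Phase N} (hφ : ContDiff ℝ 1 φ) (hs : HasCompactSupport φ) :
    ∫ z, (inner ℝ (dt φ z) (∫ ξ, ξ ∂(ν z : Measure (Phase N)))
        + ∑ k, inner ℝ (dx k φ z) (∫ ξ, f k ξ ∂(ν z : Measure (Phase N)))) ∂(spaceTime d)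
      + ∫ x, inner ℝ (φ (x, 0)) (∫ ξ, ξ ∂(σ x : Measure (Phase N)))
      = ∑ j, youngForm (fun ξ => ξ j) (fun k ξ => f k ξ j) (fun z => φ z j) σ ν := by
  have hcf : ∀ k j, Continuous fun ξ => f k ξ j := fun k j => (continuous_coord j).comp (hf k)
  have hφj := fun j => contDiff_coord hφ j
  have hsj := fun j => hasCompactSupport_coord hs j
  have hi1 : ∀ j, Integrable (fun z => dt (fun z => φ z j) z
      * ∫ ξ, ξ j ∂(ν z : Measure (Phase N))) (spaceTime d) := fun j =>
    integrable_mul_integral_of_ae_norm_le hν hνC (continuous_coord j)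
      ((continuous_dt (hφj j)).integrable_of_hasCompactSupport (hasCompactSupport_dt (hsj j)))
  have hi2 : ∀ j k, Integrable (fun z => dx k (fun z => φ z j) z
      * ∫ ξ, f k ξ j ∂(ν z : Measure (Phase N))) (spaceTime d) := fun j k =>
    integrable_mul_integral_of_ae_norm_le hν hνC (hcf k j)
      ((continuous_dx (hφj j) k).integrable_of_hasCompactSupport (hasCompactSupport_dx (hsj j) k))
  have hi3 : ∀ j, Integrable fun x : Space d => φ (x, 0) j
      * ∫ ξ, ξ j ∂(σ x : Measure (Phase N)) := fun j =>
    (hσl.coord j).integrable_mul hσ (continuous_coord j) ((hφj j).continuous.comp (by fun_prop))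
      (hasCompactSupport_trace (hsj j))
  have h1 : ∫ z, (inner ℝ (dt φ z) (∫ ξ, ξ ∂(ν z : Measure (Phase N)))
        + ∑ k, inner ℝ (dx k φ z) (∫ ξ, f k ξ ∂(ν z : Measure (Phase N)))) ∂(spaceTime d)
      = ∫ z, ∑ j, (dt (fun z => φ z j) z * (∫ ξ, ξ j ∂(ν z : Measure (Phase N)))
        + ∑ k, dx k (fun z => φ z j) z * ∫ ξ, f k ξ j ∂(ν z : Measure (Phase N)))
          ∂(spaceTime d) := by
    refine integral_congr_ae ?_
    filter_upwards [hνC] with z hz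
    have h2 : ∀ j, (∫ ξ, ξ ∂(ν z : Measure (Phase N))) j = ∫ ξ, ξ j ∂(ν z : Measure (Phase N)) :=
      fun j => eval_integral_piLp
        (fun i => integrable_coord_of_ae_norm_le hz (continuous_coord i)) j
    have h3 : ∀ k j, (∫ ξ, f k ξ ∂(ν z : Measure (Phase N))) j
        = ∫ ξ, f k ξ j ∂(ν z : Measure (Phase N)) := fun k j =>
      eval_integral_piLp (fun i => integrable_coord_of_ae_norm_le hz (hcf k i)) j
    simp only [inner_eq_sum, h2, h3, dt, dx, fderiv_coord hφ]
    rw [Finset.sum_comm, ← Finset.sum_add_distrib]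
  have h4 : ∫ x, inner ℝ (φ (x, 0)) (∫ ξ, ξ ∂(σ x : Measure (Phase N)))
      = ∫ x, ∑ j, φ (x, 0) j * ∫ ξ, ξ j ∂(σ x : Measure (Phase N)) := by
    refine integral_congr_ae ?_
    filter_upwards [ae_all_iff.2 fun j => (hσl.coord j).ae_integrable hσ (continuous_coord j)]
      with x hx
    simp only [inner_eq_sum]
    refine Finset.sum_congr rfl fun j _ => ?_
    rw [eval_integral_piLp hx j]
  rw [h1, h4, integral_finsetSum _ fun j _ => (hi1 j).fun_add
      (integrable_finsetSum _ fun k _ => hi2 j k),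
    integral_finsetSum _ fun j _ => hi3 j, ← Finset.sum_add_distrib]
  rfl

/-- Consistency with the initial mean, in coordinates. -/
theorem SchemeRequirements.tendsto_initial_coord [IsProbabilityMeasure P] (hu₀ : Measurable u₀)
    (hσ : IsYoungMeasure volume σ) (hreq : SchemeRequirements P f S σ u₀)
    (hC : ∀ l ω x t, 0 ≤ t → ‖approx S u₀ l ω (x, t)‖ ≤ C)
    {ψ : Space d → ℝ} (hψ : ContDiff ℝ 1 ψ) (hs : HasCompactSupport ψ) (j : Fin N) :
    Tendsto (fun l => ∫ x, ψ x * ((∫ ξ, ξ j ∂(P.map fun ω => approx S u₀ l ω (x, 0)))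
      - ∫ ξ, ξ j ∂(σ x : Measure (Phase N)))) atTop (𝓝 0) := by
  have hσl := hreq.initial_locIntegrable.1
  have h1 := ((EuclideanSpace.proj (𝕜 := ℝ) j).continuous.tendsto 0).comp
    (hreq.initial_mean ψ hψ hs)
  rw [map_zero] at h1
  refine h1.congr fun l => ?_
  have hm := fun x => (measurable_approx S hu₀ l (z := (x, 0)) le_rfl).aemeasurable (μ := P)
  have hprob : ∀ x, IsProbabilityMeasure (P.map fun ω => approx S u₀ l ω (x, 0)) := fun x =>
    Measure.isProbabilityMeasure_map (hm x)
  have hball : ∀ x, ∀ᵐ ξ ∂(P.map fun ω => approx S u₀ l ω (x, 0)), ‖ξ‖ ≤ C := fun x =>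
    (ae_map_iff (hm x) (measurableSet_le measurable_norm measurable_const)).2
      (ae_of_all _ fun ω => hC l ω x 0 le_rfl)
  have hpt : ∀ᵐ x, ∀ i, (ψ x • ((∫ ξ, ξ ∂(P.map fun ω => approx S u₀ l ω (x, 0)))
      - ∫ ξ, ξ ∂(σ x : Measure (Phase N)))) i
      = ψ x * ((∫ ξ, ξ i ∂(P.map fun ω => approx S u₀ l ω (x, 0)))
      - ∫ ξ, ξ i ∂(σ x : Measure (Phase N))) := by
    filter_upwards [ae_all_iff.2 fun j => (hσl.coord j).ae_integrable hσ (continuous_coord j)]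
      with x hx i
    have := hprob x
    rw [PiLp.smul_apply, PiLp.sub_apply, smul_eq_mul, eval_integral_piLp hx i,
      eval_integral_piLp (fun i => integrable_coord_of_ae_norm_le (hball x) (continuous_coord i)) i]
  have hint : ∀ i, Integrable fun x => (ψ x • ((∫ ξ, ξ ∂(P.map fun ω => approx S u₀ l ω (x, 0)))
      - ∫ ξ, ξ ∂(σ x : Measure (Phase N)))) i := fun i => by
    have h2 := integrable_trace S P hu₀ (hψ.continuous.integrable_of_hasCompactSupport hs)
      (truncate C _ (continuous_coord i)) l
    simp only [integral_truncate_trace S P hu₀ hC (continuous_coord i)] at h2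
    refine (h2.sub ((hσl.coord i).integrable_mul hσ (continuous_coord i) hψ.continuous hs)).congr ?_
    filter_upwards [hpt] with x hx
    rw [hx i, mul_sub, Pi.sub_apply]
  refine (eval_integral_piLp hint j).trans (integral_congr_ae ?_)
  filter_upwards [hpt] with x hx using hx j

theorem contDiff_trace {φ : Space d × ℝ → ℝ} (hφ : ContDiff ℝ 1 φ) :
    ContDiff ℝ 1 fun x => φ (x, 0) :=
  hφ.comp (contDiff_id.prodMk contDiff_const)

/-- A narrow limit of the laws that is carried by the ball of radius `C` is an entropy measure
valued solution. -/
theorem SchemeRequirements.isEMVS [IsProbabilityMeasure P] (hf : ∀ k, Continuous (f k))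
    (hF : IsConsistentFlux F f) (hΔx₀ : 0 < Δx₀) (hu₀ : Measurable u₀)
    (hσ : IsYoungMeasure volume σ) (hreq : SchemeRequirements P f S σ u₀)
    (hC : ∀ l ω x t, 0 ≤ t → ‖approx S u₀ l ω (x, t)‖ ≤ C)
    (hν : IsYoungMeasure (spaceTime d) ν)
    (hνC : ∀ᵐ z ∂(spaceTime d), ∀ᵐ ξ ∂(ν z : Measure (Phase N)), ‖ξ‖ ≤ C)
    {χ : ℕ → ℕ} (hχ : StrictMono χ)
    (hlim : TendstoNarrowly (spaceTime d) (fun n => lawOf P (approx S u₀ (χ n))) (signed ν)) :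
    IsEMVS f σ ν := by
  have hσl := hreq.initial_locIntegrable.1
  have hcf : ∀ k j, Continuous fun ξ => f k ξ j := fun k j => (continuous_coord j).comp (hf k)
  have hqc : ∀ {η : Phase N → ℝ} {q : Fin d → Phase N → ℝ}, IsEntropyPair f η q →
      ∀ k, Continuous (q k) := fun hp k =>
    continuous_iff_continuousAt.2 fun u => (hp.flux k u).continuousAt
  have hcoord : ∀ φ : Space d × ℝ → ℝ, ContDiff ℝ 1 φ → HasCompactSupport φ → ∀ j : Fin N,
      0 ≤ youngForm (fun ξ => ξ j) (fun k ξ => f k ξ j) φ σ ν := by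
    intro φ hφ hs j
    refine youngForm_nonneg S P hu₀ hφ hs (continuous_coord j) (fun k => hcf k j) hC
      (hreq.exists_le_weakForm S hΔx₀ hφ hs (continuous_coord j) (hF.coord j) (fun k => hcf k j)
        fun l ω i x t ht => ?_) hσ (hσl.coord j) (fun ε hε => ?_) hν hνC hχ hlim
    · obtain ⟨a', ha', h⟩ := hasDerivAt_cells_coord S l ω i j ht (u₀ := u₀)
      exact ⟨a', ha', by rw [h, mul_zero]⟩
    · filter_upwards [(hreq.tendsto_initial_coord hu₀ hσ hC (contDiff_trace hφ)
        (hasCompactSupport_trace hs) j).eventually_lt_const hε] with l hl using hl.le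
  exact
    { young := hν
      locIntegrable_id := locIntegrable_of_ae_norm_le hνC continuous_id
      locIntegrable_flux := fun k => locIntegrable_of_ae_norm_le hνC (hf k)
      locIntegrable_initial := hσl
      weak := fun φ hφ hs => by
        rw [weak_eq_sum_youngForm hf hσ hσl hν hνC hφ hs]
        -- `youngForm` is odd in the test function and nonnegative for both `φ` and `-φ`
        refine Finset.sum_eq_zero fun j _ => le_antisymm ?_ ?_
        · have h := hcoord (fun z => -φ z j) (contDiff_coord hφ j).neg
            (hasCompactSupport_coord hs j).neg j
          rw [youngForm_neg] at h
          linarith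
        · exact hcoord _ (contDiff_coord hφ j) (hasCompactSupport_coord hs j) j
      locIntegrable_entropy := fun η q hp =>
        locIntegrable_of_ae_norm_le hνC hp.differentiable.continuous
      locIntegrable_entropyFlux := fun η q hp k => locIntegrable_of_ae_norm_le hνC (hqc hp k)
      locIntegrable_entropy_initial := hreq.initial_locIntegrable.2
      entropy := fun η q hp φ hφ hs hpos => by
        obtain ⟨p', Q, hQ, h⟩ := hreq.entropy_cells S hp
        refine youngForm_nonneg S P hu₀ hφ hs hp.differentiable.continuous (hqc hp) hC
          (hreq.exists_le_weakForm S hΔx₀ hφ hs hp.differentiable.continuous hQ (hqc hp)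
            fun l ω i x t ht => ?_) hσ (hreq.initial_locIntegrable.2 η q hp)
          (hreq.initial_entropy η q hp _ (contDiff_trace hφ) (hasCompactSupport_trace hs)
            fun x => hpos _) hν hνC hχ hlim
        obtain ⟨a', ha', hle⟩ := h l ω i t ht
        exact ⟨a', ha', mul_nonpos_of_nonneg_of_nonpos (hpos _) hle⟩ }

/-- The compactness theorem supplies a limit to which `SchemeRequirements.isEMVS` applies. -/
theorem SchemeRequirements.exists_isEMVS [IsProbabilityMeasure P] (hf : ∀ k, Continuous (f k))
    (hF : IsConsistentFlux F f) (hΔx₀ : 0 < Δx₀) (hu₀ : Measurable u₀)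
    (hσ : IsYoungMeasure volume σ) (hreq : SchemeRequirements P f S σ u₀) :
    ∃ ν : Space d × ℝ → ProbabilityMeasure (Phase N), IsEMVS f σ ν ∧
      ∃ χ : ℕ → ℕ, StrictMono χ ∧
        TendstoNarrowly (spaceTime d) (fun n => lawOf P (approx S u₀ (χ n))) (signed ν) := by
  obtain ⟨C, hC⟩ := hreq.uniformlyBounded
  obtain ⟨ν, hν, hνC, χ, hχ, hlim⟩ := exists_youngMeasure_tendsto (spaceTime d) P
    (fun l y => field (S l) (u₀ y.2) y.1) (measurable_field_comp S hu₀) C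
    fun l y => norm_field_le S hC l y.2 y.1
  have hlim' : TendstoNarrowly (spaceTime d) (fun n => lawOf P (approx S u₀ (χ n)))
      (signed ν) := fun ψ hψ g => by
    simp only [pairing, integral_signed]
    refine (hlim ψ hψ g).congr fun n => integral_congr_ae ?_
    filter_upwards [integral_lawOf_approx S P hu₀ (χ n) g] with z hz
    rw [hz]
  exact ⟨ν, hreq.isEMVS hf hF hΔx₀ hu₀ hσ hC hν hνC hχ hlim', χ, hχ, hlim'⟩

end Main

end

end MLMC

open MLMC in
theorem theorem3p1 {d N p : ℕ}
    -- the flux, a numerical flux consistent with it, and the evolution operators on the meshes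
    (f : Fin d → Phase N → Phase N) (hf : ∀ k, ContDiff ℝ 1 (f k))
    (F : ℝ → Fin d → (Fin (2 * p) → Phase N) → Phase N) (hF : IsConsistentFlux F f)
    (Δx₀ : ℝ) (hΔx₀ : 0 < Δx₀) (S : ∀ l, NumericalEvolution F (meshWidth Δx₀ l))
    -- the initial Young measure and a random field with this law
    (σ : Space d → ProbabilityMeasure (Phase N)) (hσ : IsYoungMeasure volume σ)
    {Ω : Type*} [MeasurableSpace Ω] (P : Measure Ω) [IsProbabilityMeasure P]
    (u₀ : Ω → InitialData d N) (hu₀ : Measurable u₀)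
    (hlaw : ∀ x, P.map (fun ω => (u₀ ω).1 x) = (σ x : Measure (Phase N))) :
    -- existence of a limit
    (SchemeRequirements P f S σ u₀ →
      ∃ ν : Space d × ℝ → ProbabilityMeasure (Phase N), IsEMVS f σ ν ∧
        ∃ χ : ℕ → ℕ, StrictMono χ ∧
          TendstoNarrowly (spaceTime d) (fun n => lawOf P (approx S u₀ (χ n))) (signed ν)) ∧
    -- the error estimates: any numbers of levels and samples, any samples `U l k` of `u₀` that are
    -- independent within each level
    ∀ {Ω' : Type*} [MeasurableSpace Ω'] (P' : Measure Ω') [IsProbabilityMeasure P']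
      (L : ℕ) (M : ℕ → ℕ) (U : ℕ → ℕ → Ω' → InitialData d N),
      (∀ l ≤ L, 0 < M l) →
      (∀ l ≤ L, ∀ k < M l, IdentDistrib (U l k) u₀ P' P) →
      (∀ l ≤ L, iIndepFun (fun k : Fin (M l) => U l k) P') →
      ∀ (ψ : Space d × ℝ → ℝ), Integrable ψ (spaceTime d) → ∀ g : Phase N →ᵇ ℝ,
        (∀ ν : Space d × ℝ → ProbabilityMeasure (Phase N), IsEMVS f σ ν →
          (∃ χ : ℕ → ℕ, StrictMono χ ∧
            TendstoNarrowly (spaceTime d) (fun n => lawOf P (approx S u₀ (χ n))) (signed ν)) →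
          MemLp (fun ω => pairing (spaceTime d) ψ (signed ν - mlmc S L M U ω) g) 2 P' ∧
          l2Norm P' (fun ω => pairing (spaceTime d) ψ (signed ν - mlmc S L M U ω) g)
            ≤ |pairing (spaceTime d) ψ (signed ν - lawOf P (approx S u₀ L)) g|
              + √(baseVar P S u₀ ψ g) / √(M 0 : ℝ)
              + ∑ l ∈ Finset.range L, √(levelVar P S u₀ ψ g l) / √(M (l + 1) : ℝ)) ∧
        ((∀ l ≤ L, ∀ l' ≤ L, l ≠ l' → ∀ k < M l, ∀ k' < M l', IndepFun (U l k) (U l' k') P') →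
          MemLp (fun ω => pairing (spaceTime d) ψ
            (lawOf P (approx S u₀ L) - mlmc S L M U ω) g) 2 P' ∧
          l2Norm P' (fun ω => pairing (spaceTime d) ψ
              (lawOf P (approx S u₀ L) - mlmc S L M U ω) g) ^ 2
            = baseVar P S u₀ ψ g / (M 0 : ℝ)
              + ∑ l ∈ Finset.range L, levelVar P S u₀ ψ g l / (M (l + 1) : ℝ)) := by
  refine ⟨fun hreq => hreq.exists_isEMVS (fun k => (hf k).continuous) hF hΔx₀ hu₀ hσ, ?_⟩
  intro Ω' _ P' _ L M U hM hU hind ψ hψ g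
  exact ⟨fun ν hν _ => error_le S hu₀ hM hU hind hψ g hν.young,
    fun hind' => error_sq_eq S hu₀ hM hU hind hind' hψ g⟩
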